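/- **Setting (static model with collision sensing).** There are $K\ge 1$ arms, $M$ players with $1\le M\le K$, and a horizon $T\ge 2$. The values $X_k(t)\in[0,1]$ ($1\le k\le K$, $t\ge 1$) are independent and, for each $k$, identically distributed in $t$ with mean $\mu_k$. In each round $t$ every player $j$ pulls an arm $\pi^j(t)$, observes the collision indicator $\eta_{\pi^j(t)}(t)$, where $\eta_k(t)=1$ if at least two players pull arm $k$ in round $t$ and $\eta_k(t)=0$ otherwise, and receives and observes the reward $r^j(t)=X_{\pi^j(t)}(t)\,(1-\eta_{\pi^j(t)}(t))$. All players start together, know $K$ and $T$ but not $M$ or the distributions, have independent private randomness, run the same algorithm, and observe nothing else. Let $\mu_{(1)}\ge\dots\ge\mu_{(K)}$ be the ordered means, and put $\mu_{(K+1)}:=0$. The expected regret is $$R_T=\sum_{t=1}^T\sum_{k=1}^M\mu_{(k)}-\mathbb E\Big[\sum_{t=1}^T\sum_{j=1}^M r^j(t)\Big].$$ **Algorithm (SIC-MMAB with $T_0=\lceil K\log T\rceil$),** run by each player and stopped after round $T$. 1. *Musical Chairs, $T_0$ rounds.* Pull a uniformly random arm in each round until a round without collision; from then on stay on that arm. The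 arm $k$ pulled in the last of these rounds is the external rank. 2. *Rank estimation, $2K$ rounds.* Start with $\hat M=j=1$. Pull $k$ for $2k$ rounds, increasing both $\hat M$ and $j$ by $1$ at each collision; then pull $k+1,k+2,\dots$ (mod $K$) for $2(K-k)$ rounds, increasing $\hat M$ by $1$ at each collision. The player takes $\hat M$ as the number of players and $j$ as her internal rank. Set $M_1=\hat M$; all arms are active; $T[k]=0$ for every arm $k$. 3. *Phases $p=1,2,\dots$,* with $M_p$ active players and $K_p$ active arms. - *Exploration:* starting just after the $j$-th active arm, hop cyclically through the active arms (in increasing order) for $K_p2^p$ rounds, adding the rewards received from arm $k$ to a sum $s[k]$, which is kept over all the phases. - *Communication:* round each $s[k]$ at random to an integer $\widetilde S^j[k]$, namely $\lfloor s[k]\rfloor+1$ with probability $s[k]-\lfloor s[k]\rfloor$ and $\lfloor s[k]\rfloor$ otherwise. For each triple $(i,l,k)$ of two active ranks $i\ne l$ and an active arm $k$, in a fixed common order, spend $p+1$ rounds in which player $i$ sends the $p+1$ binary digits of $\widetilde S^i[k]$, lowest first, to player $l$: she sends $1$ by pulling the $l$-th active arm and $0$ by pulling the $i$-th active arm. Every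 other active player pulls the active arm whose index is her own rank, and player $l$ reads a collision as $1$ and no collision as $0$. - *Update:* add $M_p2^p$ to $T[k]$ for every active arm $k$. With $\widetilde\mu_k=\frac1{T[k]}\sum_{l=1}^{\hat M}\widetilde S^l[k]$ (the last known statistics for players who are no longer active) and $B_s=3\sqrt{\log(T)/(2s)}$, accept every active arm $k$ such that $\widetilde\mu_k-B_{T[k]}\ge\widetilde\mu_i+B_{T[i]}$ for at least $K_p-M_p$ active arms $i$, and reject every active arm $k$ such that $\widetilde\mu_i-B_{T[i]}\ge\widetilde\mu_k+B_{T[k]}$ for at least $M_p$ active arms $i$. If $a$ arms are accepted and $M_p-j+1\le a$, the player pulls the $(M_p-j+1)$-th accepted arm until round $T$. Otherwise $M_{p+1}=M_p-a$, the accepted and rejected arms are no longer active, and phase $p+1$ starts. **Theorem.** There are universal constants $c_1,c_2,c_3>0$ such that for all $K\ge1$, $1\le M\le K$, $T\ge2$ and all distributions of the arms on $[0,1]$, if all the players run SIC-MMAB with $T_0=\lceil K\log T\rceil$, then $$R_T\le c_1\sum_{k=M+1}^{K}\min\Big\{\frac{\log T}{\mu_{(M)}-\mu_{(k)}},\sqrt{T\log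 T}\Big\}+c_2\,KM\log T+c_3\,KM^3\log^2\Big(\min\Big\{\frac{\log T}{(\mu_{(M)}-\mu_{(M+1)})^2},\,T\Big\}\Big),$$ where $\log(T)/0:=\infty$. -/

import Mathlib

open MeasureTheory ProbabilityTheory

noncomputable section

namespace MultiPlayerBandit

/-! ## The synchronized multiplayer bandit with collision sensing -/

/-- A decentralized randomized algorithm for one player facing `K` arms, with collision sensing.
In every round the player gets a fresh private seed, pulls the arm `act state seed`, observes her
own reward and the collision indicator of the arm that she pulled, and moves to the state
`next state seed reward collision`. She sees nothing else. -/
structure Policy (K : ℕ) where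
  State : Type
  Seed : Type
  measurableSeed : MeasurableSpace Seed
  seedLaw : Measure Seed
  isProb : IsProbabilityMeasure seedLaw
  start : State
  act : State → Seed → Fin K
  next : State → Seed → ℝ → Bool → State

attribute [instance] Policy.measurableSeed Policy.isProb

variable {K : ℕ}

/-- The randomness of one round with `M` players: the values `X_k(t)` of all the arms and the
private seeds of all the players. -/
abbrev Round (A : Policy K) (M : ℕ) : Type := (Fin K → ℝ) × (Fin M → A.Seed)

/-- `collides a k`: at least two players pull arm `k`, where player `j` pulls `a j`. -/
def collides {M : ℕ} (a : Fin M → Fin K) (k : Fin K) : Bool :=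
  decide (1 < (Finset.univ.filter fun j => a j = k).card)

/-- The reward `X_{a j} (1 - η_{a j})` of player `j`. -/
def reward {M : ℕ} (x : Fin K → ℝ) (a : Fin M → Fin K) (j : Fin M) : ℝ :=
  x (a j) * (1 - if collides a (a j) then 1 else 0)

/-- The states of the `M` players, who all run the algorithm `A`, before round `t`
(rounds are numbered from `0`). -/
def states (A : Policy K) (M : ℕ) : ℕ → (ℕ → Round A M) → Fin M → A.State
  | 0, _, _ => A.start
  | t + 1, ω, j =>
    let σ := states A M t ω
    let a : Fin M → Fin K := fun i => A.act (σ i) ((ω t).2 i)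
    A.next (σ j) ((ω t).2 j) (reward (ω t).1 a j) (collides a (a j))

/-- The arms pulled by the players in round `t`. -/
def actions (A : Policy K) (M : ℕ) (t : ℕ) (ω : ℕ → Round A M) : Fin M → Fin K :=
  fun j => A.act (states A M t ω j) ((ω t).2 j)

/-- The law of one round: `X_k` has law `ν k`, each seed has law `A.seedLaw`, and all of these
are independent. -/
def roundLaw (A : Policy K) (M : ℕ) (ν : Fin K → Measure ℝ) : Measure (Round A M) :=
  (Measure.pi ν).prod (Measure.pi fun _ => A.seedLaw)

instance (A : Policy K) (M : ℕ) (ν : Fin K → Measure ℝ) [∀ k, IsProbabilityMeasure (ν k)] :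
    IsProbabilityMeasure (roundLaw A M ν) := by
  unfold roundLaw; infer_instance

/-- The law of the whole game: independent and identically distributed rounds. -/
def gameLaw (A : Policy K) (M : ℕ) (ν : Fin K → Measure ℝ) [∀ k, IsProbabilityMeasure (ν k)] :
    Measure (ℕ → Round A M) :=
  Measure.infinitePi fun _ => roundLaw A M ν

/-- The mean of each arm. -/
def means (ν : Fin K → Measure ℝ) (k : Fin K) : ℝ := ∫ x, x ∂(ν k)

/-- `orderStat μ n` is the `n`-th largest of the numbers `μ k` (so `orderStat μ 1` is the largest
and `orderStat μ K` the smallest), with the convention that it is `0` for `n = K + 1`. -/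
def orderStat (μ : Fin K → ℝ) (n : ℕ) : ℝ :=
  if h : 1 ≤ n ∧ n ≤ K then μ (Tuple.sort (fun k => -μ k) ⟨n - 1, by omega⟩) else 0

/-- The expected regret at horizon `T` of `M` players running `A`. -/
def regret (A : Policy K) (M T : ℕ) (ν : Fin K → Measure ℝ)
    [∀ k, IsProbabilityMeasure (ν k)] : ℝ :=
  (∑ _t ∈ Finset.range T, ∑ k ∈ Finset.Icc 1 M, orderStat (means ν) k) -
    ∫ ω, ∑ t ∈ Finset.range T, ∑ j : Fin M, reward (ω t).1 (actions A M t ω) j ∂(gameLaw A M ν)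

/-- `min (a / d) c`, where `a / 0 = ∞`. -/
def minDiv (a d c : ℝ) : ℝ := if d = 0 then c else min (a / d) c

/-! ## The algorithm SIC-MMAB -/

namespace SIC

/-- The discrete memory of an active player after the initialization. Internal ranks are numbered
from `0`. -/
structure Mem (K : ℕ) where
  /-- the estimated total number `M` of players -/
  total : ℕ
  /-- own internal rank -/
  rank : ℕ
  /-- the number `p` of the current phase -/
  phase : ℕ
  /-- the number `M_p` of active players -/
  players : ℕ
  /-- the set `[K_p]` of active arms, in increasing order -/
  active : List (Fin K)
  /-- entry `l` holds the last quantized statistics of the player of rank `l` -/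
  quant : List (Fin K → ℕ)
  /-- the centralized numbers of exploration pulls of the arms -/
  pulls : Fin K → ℕ

/-- Where a player stands in the algorithm. The number `n` counts the rounds already spent in the
current procedure (in `comm`: in the current transmission). -/
inductive Stage (K : ℕ) where
  /-- Musical Chairs; `fixed` is the arm on which the player sits, if any -/
  | chairs (n : ℕ) (fixed : Option (Fin K))
  /-- estimation of the number of players and of the internal rank, from the external rank `k`;
  `total` and `rank` are the current estimates -/
  | estim (k : Fin K) (n total rank : ℕ)
  /-- exploration phase -/
  | explore (m : Mem K) (n : ℕ)
  /-- communication phase: `q` holds the own quantized statistics, and `todo` lists the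
  transmissions `(i, l, k)` still to be done (the first one is in progress), in which the player
  of rank `i` sends to the player of rank `l` her statistic of arm `k` -/
  | comm (m : Mem K) (q : Fin K → ℕ) (todo : List (ℕ × ℕ × Fin K)) (n : ℕ)
  /-- exploitation of the arm `k` until the horizon -/
  | exploit (k : Fin K)

/-- The confidence radius `B_s = 3 √(log T / (2 s))`. -/
def radius (T s : ℕ) : ℝ := 3 * √(Real.log T / (2 * s))

variable [NeZero K]

/-- The active arm of index `i` (from `0`), cyclically. -/
def Mem.arm (m : Mem K) (i : ℕ) : Fin K := m.active.getD (i % m.active.length) 0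

/-- The memory at the start of the first phase. -/
def Mem.first (total rank : ℕ) : Mem K where
  total := total
  rank := rank
  phase := 1
  players := total
  active := List.finRange K
  quant := List.replicate total 0
  pulls := 0

/-- The transmissions of a communication phase, in lexicographic order. -/
def Mem.schedule (m : Mem K) : List (ℕ × ℕ × Fin K) :=
  (List.range m.players).flatMap fun i =>
    ((List.range m.players).filter fun l => decide (i ≠ l)).flatMap fun l =>
      m.active.map fun k => (i, l, k)

/-- The end of a phase: count the pulls, accept and reject arms, and either start exploiting an
accepted arm or go on to the exploration phase of the next number. -/
def Mem.finishPhase (T : ℕ) (m : Mem K) : Stage K :=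
  let pulls : Fin K → ℕ := fun k =>
    if k ∈ m.active then m.pulls k + m.players * 2 ^ m.phase else m.pulls k
  let mean : Fin K → ℝ := fun k => (((m.quant.map fun f => f k).sum : ℕ) : ℝ) / pulls k
  -- arm `i` is better than arm `k` with confidence
  let better : Fin K → Fin K → Bool := fun i k =>
    decide (mean i - radius T (pulls i) ≥ mean k + radius T (pulls k))
  let rej := m.active.filter fun k =>
    decide (m.active.countP (fun i => better i k) ≥ m.players)
  let acc := m.active.filter fun k =>
    decide (m.active.countP (fun i => better k i) + m.players ≥ m.active.length)
  if m.players - m.rank ≤ acc.length then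
    .exploit (acc.getD (m.players - m.rank - 1) 0)
  else
    .explore
      { m with
        phase := m.phase + 1
        players := m.players - acc.length
        active := m.active.filter fun k => decide (k ∉ acc ∧ k ∉ rej)
        pulls := pulls } 0

/-- The quantization of the statistics `s` by means of uniform variables `v`: the value `s k` is
rounded up with probability equal to its fractional part, and down otherwise. -/
def quantize (s : Fin K → ℝ) (v : Fin K → unitInterval) (k : Fin K) : ℕ :=
  ⌊s k⌋₊ + if (v k : ℝ) < Int.fract (s k) then 1 else 0

/-- The start of a communication phase with own quantized statistics `q`. -/
def Mem.startComm (T : ℕ) (m : Mem K) (q : Fin K → ℕ) : Stage K :=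
  let m₁ : Mem K := { m with quant := m.quant.set m.rank q }
  match m₁.schedule with
  | [] => m₁.finishPhase T
  | todo => .comm m₁ q todo 0

/-- The bit number `n` of the statistic of arm `k` sent by the player of rank `i` has been
received. The received number is built up from `0`. -/
def Mem.receive (m : Mem K) (i : ℕ) (k : Fin K) (n : ℕ) (bit : Bool) : Mem K :=
  { m with
    quant := m.quant.modify i fun f =>
      Function.update f k ((if n = 0 then 0 else f k) + if bit then 2 ^ n else 0) }

/-- The arm pulled at a stage; `u` is an arm sampled uniformly at random. -/
def pull (u : Fin K) : Stage K → Fin K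
  | .chairs _ none => u
  | .chairs _ (some k) => k
  | .estim k n _ _ =>
    -- stay for `2 (k + 1)` rounds on the external rank (arms are numbered from `0`), then hop
    if n < 2 * (k.val + 1) then k else Fin.ofNat K (k.val + (n - 2 * (k.val + 1)) + 1)
  | .explore m n => m.arm (m.rank + n + 1)
  | .comm m q ((i, l, k) :: _) n =>
    if i = m.rank ∧ (q k).testBit n = true then m.arm l else m.arm m.rank
  | .comm m _ [] _ => m.arm m.rank
  | .exploit k => k

/-- The state after a round, from the stage, the own sums of exploration rewards `s`, the seed
`(u, v)`, the reward `r` and the collision indicator `c`. -/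
def step (T T₀ : ℕ) (x : Stage K × (Fin K → ℝ)) (u : Fin K) (v : Fin K → unitInterval)
    (r : ℝ) (c : Bool) : Stage K × (Fin K → ℝ) :=
  match x with
  | (.chairs n fixed, s) =>
    let k := pull u (.chairs n fixed)
    if n + 1 < T₀ then
      (.chairs (n + 1) (if fixed = none ∧ c = true then none else some k), s)
    else
      -- the arm pulled in the last round is the external rank
      (.estim k 0 1 0, s)
  | (.estim k n total rank, s) =>
    let total' := if c then total + 1 else total
    let rank' := if c = true ∧ n < 2 * (k.val + 1) then rank + 1 else rank
    if n + 1 < 2 * K then (.estim k (n + 1) total' rank', s)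
    else (.explore (Mem.first total' rank') 0, s)
  | (.explore m n, s) =>
    let k := pull u (.explore m n)
    let s' := Function.update s k (s k + r)
    if n + 1 < m.active.length * 2 ^ m.phase then (.explore m (n + 1), s')
    else (m.startComm T (quantize s' v), s')
  | (.comm m q ((i, l, k) :: rest) n, s) =>
    let m' := if l = m.rank then m.receive i k n c else m
    if n < m.phase then (.comm m' q ((i, l, k) :: rest) (n + 1), s)
    else
      match rest with
      | [] => (m'.finishPhase T, s)
      | todo => (.comm m' q todo 0, s)
  | (.comm m _ [] _, s) => (m.finishPhase T, s)
  | (.exploit k, s) => (.exploit k, s)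

end SIC

/-- The algorithm SIC-MMAB for `K` arms and horizon `T`, whose Musical Chairs procedure lasts `T₀`
rounds. It does not know the number of players. A seed consists of a uniform random arm and of
independent uniform random variables on `[0, 1]`, one for each arm. -/
def sicMMAB (K : ℕ) [NeZero K] (T T₀ : ℕ) : Policy K where
  State := SIC.Stage K × (Fin K → ℝ)
  Seed := Fin K × (Fin K → unitInterval)
  measurableSeed := inferInstance
  seedLaw := (uniformOn Set.univ).prod volume
  isProb := by
    have : IsProbabilityMeasure (uniformOn (Set.univ : Set (Fin K))) :=
      isProbabilityMeasure_uniformOn Set.finite_univ Set.univ_nonempty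
    infer_instance
  start := (.chairs 0 none, 0)
  act := fun x ξ => SIC.pull ξ.1 x.1
  next := fun x ξ r c => SIC.step T T₀ x ξ.1 ξ.2 r c

end MultiPlayerBandit

end

open MultiPlayerBandit

set_option linter.unusedSectionVars false

namespace MultiPlayerBandit

/-! ## Resampling one coordinate of a product measure -/

section Resampling

variable {ι : Type*} {X : ι → Type*} [∀ i, MeasurableSpace (X i)]

/-! The proof isolates a good event of probability at least `1 - 5K/T` and bounds the pseudo-regret
deterministically on it. Off this event the pseudo-regret is at most `M T`, which costs only `5KM`
in expectation. Rewards may be replaced by means in the regret because the arms pulled in a round do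
not depend on the values drawn in that round (`regret_eq_integral_gap`).

The good event (`Good`, `exists_bad_event`) asks for three things. Every player finds a free arm
during Musical Chairs, since whatever the others do she collides with probability at most `1 - 1/K`.
The rewards of each arm collected in exploration concentrate, uniformly in time, by a Hoeffding
bound for predictable selections of rounds. The randomized roundings made at the end of each
exploration phase concentrate, simultaneously for all sets of players of rank at least `r`. All
these bounds rest on one device: resampling one coordinate of the product measure, which replaces
conditioning on the past.

On the good event the players stay synchronized. External ranks are distinct, two players meet
exactly once in the rank estimation, explorers and exploiters never collide, and a communicated bit
is exactly a collision. Hence all active players hold the same statistics and take the same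
decisions; `Config` is this common knowledge and `Tracked` collects the invariants of a phase.

The statistics are accurate within the radius (`Tracked.accurate`). The delicate point is the
rounding error of the players who have left, since their statistics are frozen with the error made
at their last phase. A player who leaves after phase `q` has pulled each arm still active `2^(q+1) -
2` times, so Cauchy-Schwarz bounds the accumulated error by a constant below one times the number of
pulls, under the square root (`roundConst`, `sqrt_add_sqrt_le`). Accuracy makes acceptances and
rejections correct, and every arm that survives with `N` pulls is within four radii of the threshold
(`Config.Correct.next_tight`).

The regret of an exploration phase is then at most (number of bad active arms) × (new pulls) × 8
radii. This telescopes as a difference of `√(N log T)`, capped by `min (log T / gap) √(T log T)` for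
each bad arm. A communication phase lasts `O(p K M²)` rounds and costs at most `M` per round; only
`O(log (min (log T / gap²) T))` phases occur, so the sum over `p` is quadratic in this logarithm.
`Tracked.sum_gap_le` performs both summations by a potential argument. -/

lemma measurable_uncurry_update [DecidableEq ι] (t : ι) :
    Measurable fun p : (∀ i, X i) × X t => Function.update p.1 t p.2 := by
  refine measurable_pi_lambda _ fun i => ?_
  by_cases h : i = t
  · subst h; simpa using measurable_snd
  · simp only [Function.update_of_ne h]; exact (measurable_pi_apply i).comp measurable_fst

/-- Resampling one coordinate preserves a product of probability measures. -/
lemma measurePreserving_update [DecidableEq ι] (μ : ∀ i, Measure (X i))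
    [∀ i, IsProbabilityMeasure (μ i)] (t : ι) :
    MeasurePreserving (fun p : (∀ i, X i) × X t => Function.update p.1 t p.2)
      ((Measure.infinitePi μ).prod (μ t)) (Measure.infinitePi μ) := by
  refine ⟨measurable_uncurry_update t, Measure.eq_infinitePi _ fun s S hS => ?_⟩
  rw [Measure.map_apply (measurable_uncurry_update t)
    (MeasurableSet.pi s.countable_toSet fun i _ => hS i)]
  have key : (fun p : (∀ i, X i) × X t => Function.update p.1 t p.2) ⁻¹' (Set.pi s S) =
      (Set.pi (s.erase t : Finset ι) S) ×ˢ (if t ∈ s then S t else Set.univ) := by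
    ext ⟨x, y⟩
    simp only [Set.mem_preimage, Set.mem_pi, Finset.mem_coe, Set.mem_prod, Finset.mem_erase]
    constructor
    · intro h
      refine ⟨fun i hi => by simpa [Function.update_of_ne hi.1] using h i hi.2, ?_⟩
      split_ifs with ht
      · simpa using h t ht
      · trivial
    · rintro ⟨h1, h2⟩ i hi
      by_cases hit : i = t
      · subst hit; simpa [hi] using h2
      · simpa [Function.update_of_ne hit] using h1 i ⟨hit, hi⟩
  rw [key, Measure.prod_prod, Measure.infinitePi_pi _ fun i _ => hS i]
  split_ifs with ht
  · exact Finset.prod_erase_mul s (fun i => μ i (S i)) ht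
  · rw [Finset.erase_eq_of_notMem ht]; simp

lemma lintegral_resample [DecidableEq ι] (μ : ∀ i, Measure (X i))
    [∀ i, IsProbabilityMeasure (μ i)] (t : ι) {F : (∀ i, X i) → ENNReal} (hF : Measurable F) :
    ∫⁻ ω, F ω ∂Measure.infinitePi μ =
      ∫⁻ ω, ∫⁻ ξ, F (Function.update ω t ξ) ∂μ t ∂Measure.infinitePi μ := by
  have h := lintegral_prod _ (hF.comp (measurable_uncurry_update t)).aemeasurable
    (μ := Measure.infinitePi μ) (ν := μ t)
  exact ((measurePreserving_update μ t).lintegral_comp hF).symm.trans h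

lemma integral_resample [DecidableEq ι] (μ : ∀ i, Measure (X i))
    [∀ i, IsProbabilityMeasure (μ i)] (t : ι) {F : (∀ i, X i) → ℝ} (hF : Measurable F)
    (hI : Integrable F (Measure.infinitePi μ)) :
    ∫ ω, F ω ∂Measure.infinitePi μ =
      ∫ ω, ∫ ξ, F (Function.update ω t ξ) ∂μ t ∂Measure.infinitePi μ := by
  have hp := measurePreserving_update μ t
  have h1 : ∫ p, F (Function.update p.1 t p.2) ∂(Measure.infinitePi μ).prod (μ t) =
      ∫ ω, F ω ∂Measure.infinitePi μ := by
    have h := integral_map hp.measurable.aemeasurable (f := F) (by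
      rw [hp.map_eq]; exact hF.aestronglyMeasurable)
    rw [← h, hp.map_eq]
  rw [← h1, integral_prod]
  exact hp.integrable_comp_of_integrable hI

lemma lintegral_resample_pi [Fintype ι] [DecidableEq ι] (μ : ∀ i, Measure (X i))
    [∀ i, IsProbabilityMeasure (μ i)] (t : ι) {F : (∀ i, X i) → ENNReal} (hF : Measurable F) :
    ∫⁻ ω, F ω ∂Measure.pi μ =
      ∫⁻ ω, ∫⁻ ξ, F (Function.update ω t ξ) ∂μ t ∂Measure.pi μ := by
  simpa only [Measure.infinitePi_eq_pi] using lintegral_resample μ t hF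

end Resampling

/-! ## Hoeffding's inequality for predictable selections -/

lemma lintegral_exp_le_one_of_subgaussian {Ω : Type*} [MeasurableSpace Ω] {μ : Measure Ω}
    {Y : Ω → ℝ} (hY : HasSubgaussianMGF Y (1 / 4) μ) (l : ℝ) :
    ∫⁻ ξ, ENNReal.ofReal (Real.exp (l * Y ξ - l ^ 2 / 8)) ∂μ ≤ 1 := by
  have h1 : ∀ ξ, Real.exp (l * Y ξ - l ^ 2 / 8) =
      Real.exp (l * Y ξ) * Real.exp (-(l ^ 2 / 8)) := fun ξ => by
    rw [← Real.exp_add]; ring_nf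
  rw [← ofReal_integral_eq_lintegral_ofReal]
  · rw [ENNReal.ofReal_le_one]
    simp_rw [h1]
    rw [integral_mul_const]
    have h2 := hY.mgf_le l
    rw [mgf] at h2
    calc _ ≤ Real.exp ((1 / 4 : NNReal) * l ^ 2 / 2) * Real.exp (-(l ^ 2 / 8)) := by
          gcongr
      _ = 1 := by rw [← Real.exp_add]; push_cast; ring_nf; simp
  · simp_rw [h1]; exact (hY.integrable_exp_mul l).mul_const _
  · exact ae_of_all _ fun _ => (Real.exp_pos _).le

section Predictable

variable {Ω : Type*} [MeasurableSpace Ω] {μ : Measure Ω} [IsProbabilityMeasure μ]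
  {Y : Ω → ℝ} {a : ℕ → (ℕ → Ω) → ℝ}

/-- The exponential is a supermartingale: resampling the last round `n` leaves `a n` and all earlier
terms fixed, and the new factor has mean at most one, whether the round is selected or not. -/
lemma lintegral_exp_predictable_le_one (hY : HasSubgaussianMGF Y (1 / 4) μ) (hYm : Measurable Y)
    (ham : ∀ t, Measurable (a t)) (ha : ∀ t ω, a t ω = 0 ∨ a t ω = 1)
    (hpred : ∀ t ω t' ξ, t ≤ t' → a t (Function.update ω t' ξ) = a t ω) (l : ℝ) (n : ℕ) :
    ∫⁻ ω, ENNReal.ofReal (Real.exp (∑ t ∈ Finset.range n,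
      (l * (a t ω * Y (ω t)) - l ^ 2 / 8 * a t ω))) ∂Measure.infinitePi (fun _ : ℕ => μ) ≤ 1 := by
  have hm : ∀ n, Measurable fun ω : ℕ → Ω => ∑ t ∈ Finset.range n,
      (l * (a t ω * Y (ω t)) - l ^ 2 / 8 * a t ω) := fun n => by fun_prop
  induction n with
  | zero => simp
  | succ n ih =>
    refine le_trans (le_of_eq (lintegral_resample (fun _ : ℕ => μ) n ?_)) (le_trans ?_ ih)
    · exact (Real.measurable_exp.comp (hm (n + 1))).ennreal_ofReal
    refine lintegral_mono fun ω => ?_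
    have hsum : ∀ ξ, ∑ t ∈ Finset.range (n + 1), (l * (a t (Function.update ω n ξ) *
        Y (Function.update ω n ξ t)) - l ^ 2 / 8 * a t (Function.update ω n ξ)) =
        ∑ t ∈ Finset.range n, (l * (a t ω * Y (ω t)) - l ^ 2 / 8 * a t ω) +
          (l * (a n ω * Y ξ) - l ^ 2 / 8 * a n ω) := fun ξ => by
      rw [Finset.sum_range_succ, hpred n ω n ξ le_rfl, Function.update_self]
      congr 1
      refine Finset.sum_congr rfl fun t ht => ?_
      have htn := Finset.mem_range.1 ht
      rw [hpred t ω n ξ htn.le, Function.update_of_ne htn.ne]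
    simp_rw [hsum, Real.exp_add, ENNReal.ofReal_mul (Real.exp_pos _).le]
    rw [lintegral_const_mul' _ _ ENNReal.ofReal_ne_top]
    refine mul_le_of_le_one_right zero_le ?_
    rcases ha n ω with h | h <;> rw [h]
    · simp
    · simpa using lintegral_exp_le_one_of_subgaussian hY l

lemma measure_predictable_sum_ge_le (hY : HasSubgaussianMGF Y (1 / 4) μ) (hYm : Measurable Y)
    (ham : ∀ t, Measurable (a t)) (ha : ∀ t ω, a t ω = 0 ∨ a t ω = 1)
    (hpred : ∀ t ω t' ξ, t ≤ t' → a t (Function.update ω t' ξ) = a t ω) {n : ℕ} {s : ℝ}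
    (hs : 0 < s) (hsum : ∀ ω, ∑ t ∈ Finset.range n, a t ω ≤ s) {x : ℝ} (hx : 0 ≤ x) :
    Measure.infinitePi (fun _ : ℕ => μ) {ω | x ≤ ∑ t ∈ Finset.range n, a t ω * Y (ω t)} ≤
      ENNReal.ofReal (Real.exp (-2 * x ^ 2 / s)) := by
  -- This value maximizes `l x - l² s / 8`, and the maximum is `2 x² / s`.
  set l : ℝ := 4 * x / s
  have hl : 0 ≤ l := by positivity
  have h1 := lintegral_exp_predictable_le_one hY hYm ham ha hpred l n
  set f : (ℕ → Ω) → ENNReal := fun ω => ENNReal.ofReal (Real.exp (∑ t ∈ Finset.range n,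
      (l * (a t ω * Y (ω t)) - l ^ 2 / 8 * a t ω)))
  have hf : Measurable f := by
    refine (Real.measurable_exp.comp ?_).ennreal_ofReal
    fun_prop
  set ε := ENNReal.ofReal (Real.exp (2 * x ^ 2 / s))
  have h2 : {ω : ℕ → Ω | x ≤ ∑ t ∈ Finset.range n, a t ω * Y (ω t)} ⊆ {ω | ε ≤ f ω} := by
    intro ω hω
    refine ENNReal.ofReal_le_ofReal (Real.exp_le_exp.2 ?_)
    rw [Finset.sum_sub_distrib, ← Finset.mul_sum, ← Finset.mul_sum]
    have h3 : l * x ≤ l * ∑ t ∈ Finset.range n, a t ω * Y (ω t) := by gcongr; exact hω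
    have h4 : l ^ 2 / 8 * ∑ t ∈ Finset.range n, a t ω ≤ l ^ 2 / 8 * s := by
      gcongr; exact hsum ω
    have h5 : l * x - l ^ 2 / 8 * s = 2 * x ^ 2 / s := by simp only [l]; field_simp; ring
    linarith
  have h3 := (mul_meas_ge_le_lintegral hf ε).trans h1
  have hε : ε ≠ 0 := by simp [ε, Real.exp_pos]
  calc _ ≤ Measure.infinitePi (fun _ : ℕ => μ) {ω | ε ≤ f ω} := measure_mono h2
    _ ≤ ε⁻¹ := by
      rw [mul_comm] at h3
      exact ENNReal.le_inv_iff_mul_le.2 h3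
    _ = _ := by
      rw [← ENNReal.ofReal_inv_of_pos (Real.exp_pos _), ← Real.exp_neg]
      ring_nf

end Predictable

/-! ## Randomized rounding -/

lemma measure_pi_sum_ge_le {ι : Type*} [Fintype ι] {S : ι → Type*} [∀ i, MeasurableSpace (S i)]
    {μ : ∀ i, Measure (S i)} [∀ i, IsProbabilityMeasure (μ i)] {g : ∀ i, S i → ℝ}
    (hg : ∀ i, HasSubgaussianMGF (g i) (1 / 4) (μ i)) (hgm : ∀ i, Measurable (g i))
    (J : Finset ι) {x : ℝ} (hx : 0 ≤ x) :
    Measure.pi μ {ξ | x ≤ ∑ i ∈ J, g i (ξ i)} ≤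
      ENNReal.ofReal (Real.exp (-2 * x ^ 2 / J.card)) := by
  have hind : iIndepFun (fun i (ξ : ∀ i, S i) => g i (ξ i)) (Measure.pi μ) :=
    iIndepFun_pi fun i => (hgm i).aemeasurable
  have hsub : ∀ i ∈ J, HasSubgaussianMGF (fun ξ : ∀ i, S i => g i (ξ i)) (1 / 4)
      (Measure.pi μ) := fun i _ => by
    have hp := measurePreserving_eval μ i
    refine HasSubgaussianMGF.of_map (X := g i) hp.measurable.aemeasurable ?_
    rw [hp.map_eq]; exact hg i
  have h := HasSubgaussianMGF.measure_sum_ge_le_of_iIndepFun hind hsub hx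
  rw [measureReal_def] at h
  refine (ENNReal.le_ofReal_iff_toReal_le (measure_ne_top _ _) (Real.exp_pos _).le).2
    (h.trans (Real.exp_le_exp.2 (le_of_eq ?_)))
  push_cast [Finset.sum_const, nsmul_eq_mul]
  rw [show (2 * ((J.card : ℝ) * (1 / 4))) = J.card / 2 by ring, div_div_eq_mul_div]
  ring

lemma volume_coord_lt {κ : Type*} [Fintype κ] (k : κ) {f : ℝ} (h0 : 0 ≤ f) (h1 : f ≤ 1) :
    (volume : Measure (κ → unitInterval)) {v | (v k : ℝ) < f} = ENNReal.ofReal f := by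
  have h2 := (measurePreserving_eval (fun _ : κ => (volume : Measure unitInterval)) k).measure_preimage
    (measurableSet_lt measurable_subtype_coe measurable_const : MeasurableSet
      {x : unitInterval | (x : ℝ) < f}).nullMeasurableSet
  rw [volume_pi]
  refine h2.trans ?_
  have h3 : {x : unitInterval | (x : ℝ) < f} = Set.Iio ⟨f, h0, h1⟩ := by
    ext x; rfl
  rw [h3, unitInterval.volume_Iio]

/-- The rounding error of a number with fractional part `f`. -/
noncomputable def roundErr {κ : Type*} (k : κ) (f : ℝ) (v : κ → unitInterval) : ℝ :=
  (if (v k : ℝ) < f then 1 else 0) - f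

lemma measurable_roundErr {κ : Type*} (k : κ) (f : ℝ) : Measurable (roundErr k f) := by
  unfold roundErr
  refine (Measurable.ite ?_ measurable_const measurable_const).sub_const _
  exact measurableSet_lt (measurable_subtype_coe.comp (measurable_pi_apply k)) measurable_const

/-- The error lies in an interval of length one and is centered, because a uniform variable falls
below `f` with probability `f`; Hoeffding's lemma gives the parameter `1/4`. -/
lemma hasSubgaussianMGF_roundErr {κ : Type*} [Fintype κ] (k : κ) {f : ℝ} (h0 : 0 ≤ f)
    (h1 : f ≤ 1) :
    HasSubgaussianMGF (roundErr k f) (1 / 4) (volume : Measure (κ → unitInterval)) := by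
  have h := hasSubgaussianMGF_of_mem_Icc_of_integral_eq_zero (a := -f) (b := 1 - f)
    (μ := (volume : Measure (κ → unitInterval)))
    (measurable_roundErr k f).aemeasurable (ae_of_all _ fun v => by
      unfold roundErr; split_ifs <;> constructor <;> linarith) ?_
  · convert h using 1
    ext; simp; norm_num
  · have hS : MeasurableSet {v : κ → unitInterval | (v k : ℝ) < f} :=
      measurableSet_lt (measurable_subtype_coe.comp (measurable_pi_apply k)) measurable_const
    have h2 : roundErr k f = fun v => ({v : κ → unitInterval | (v k : ℝ) < f}.indicator 1 v : ℝ) - f := by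
      ext v; simp [roundErr, Set.indicator_apply]
    rw [h2, integral_sub, integral_indicator_one hS, integral_const, measureReal_def,
      volume_coord_lt k h0 h1]
    · simp [h0]
    · exact (integrable_const (1 : ℝ)).indicator hS
    · exact integrable_const _


/-! ## Policies with measurable dynamics -/

/-- The dynamics of the policy is measurable for the given `σ`-algebra on its states. -/
structure Policy.IsMeasurable {K : ℕ} (A : Policy K) [MeasurableSpace A.State] : Prop where
  act : Measurable fun p : A.State × A.Seed => A.act p.1 p.2
  next : Measurable fun p : A.State × A.Seed × ℝ × Bool => A.next p.1 p.2.1 p.2.2.1 p.2.2.2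

section Measurability

variable {K M : ℕ} {A : Policy K}

/-- The arms pulled in a round by players in the states `σ` with the seeds `ξ`. -/
def acts (A : Policy K) (σ : Fin M → A.State) (ξ : Fin M → A.Seed) : Fin M → Fin K :=
  fun i => A.act (σ i) (ξ i)

lemma actions_eq_acts (t : ℕ) (ω : ℕ → Round A M) :
    actions A M t ω = acts A (states A M t ω) (ω t).2 := rfl

lemma states_succ (t : ℕ) (ω : ℕ → Round A M) (j : Fin M) :
    states A M (t + 1) ω j = A.next (states A M t ω j) ((ω t).2 j)
      (reward (ω t).1 (actions A M t ω) j) (collides (actions A M t ω) (actions A M t ω j)) := rfl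

lemma states_congr {t : ℕ} {ω ω' : ℕ → Round A M} (h : ∀ s < t, ω s = ω' s) :
    states A M t ω = states A M t ω' := by
  induction t with
  | zero => rfl
  | succ t ih =>
    have h1 := ih fun s hs => h s (by omega)
    funext j
    rw [states_succ, states_succ, actions_eq_acts, actions_eq_acts, h1, h t (by omega)]

lemma states_update {t t' : ℕ} (h : t ≤ t') (ω : ℕ → Round A M) (ξ : Round A M) :
    states A M t (Function.update ω t' ξ) = states A M t ω :=
  states_congr fun s hs => Function.update_of_ne (by omega) _ _

lemma actions_update_self (t : ℕ) (ω : ℕ → Round A M) (ξ : Round A M) :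
    actions A M t (Function.update ω t ξ) = acts A (states A M t ω) ξ.2 := by
  rw [actions_eq_acts, states_update le_rfl, Function.update_self]

lemma measurable_collides : Measurable fun p : (Fin M → Fin K) × Fin K => collides p.1 p.2 :=
  measurable_of_countable _

lemma exists_reward_eq_mul (a : Fin M → Fin K) (j : Fin M) :
    ∃ c : ℝ, ∀ x, reward x a j = x (a j) * c := ⟨_, fun _ => rfl⟩

lemma measurable_reward (j : Fin M) :
    Measurable fun p : (Fin K → ℝ) × (Fin M → Fin K) => reward p.1 p.2 j := by
  refine measurable_from_prod_countable_left fun a => ?_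
  obtain ⟨c, hc⟩ := exists_reward_eq_mul a j
  simp only [hc]
  exact Measurable.mul_const (f := fun x : Fin K → ℝ => x (a j)) (measurable_pi_apply (a j)) _

lemma reward_mem {x : Fin K → ℝ} (hx : ∀ k, x k ∈ Set.Icc (0 : ℝ) 1) (a : Fin M → Fin K)
    (j : Fin M) : reward x a j ∈ Set.Icc (0 : ℝ) 1 := by
  unfold reward
  have h := hx (a j)
  split_ifs <;> simp
  exact h

variable [MeasurableSpace A.State] (hA : A.IsMeasurable)
include hA

lemma measurable_acts :
    Measurable fun p : (Fin M → A.State) × (Fin M → A.Seed) => acts A p.1 p.2 := by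
  refine measurable_pi_lambda _ fun i => ?_
  have h1 : Measurable fun p : (Fin M → A.State) × (Fin M → A.Seed) => p.1 i :=
    (measurable_pi_apply i).comp measurable_fst
  have h2 : Measurable fun p : (Fin M → A.State) × (Fin M → A.Seed) => p.2 i :=
    (measurable_pi_apply i).comp measurable_snd
  exact hA.act.comp (h1.prodMk h2)

lemma measurable_states (t : ℕ) : Measurable (states A M t) := by
  induction t with
  | zero => exact measurable_const
  | succ t ih =>
    have h0 : Measurable fun ω : ℕ → Round A M => ω t := measurable_pi_apply t
    have h1 : Measurable (actions A M t) :=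
      (measurable_acts hA).comp (ih.prodMk (measurable_snd.comp h0))
    refine measurable_pi_lambda _ fun j => ?_
    have h2 : Measurable fun ω : ℕ → Round A M => reward (ω t).1 (actions A M t ω) j :=
      (measurable_reward j).comp ((measurable_fst.comp h0).prodMk h1)
    have h3 : Measurable fun ω : ℕ → Round A M =>
        collides (actions A M t ω) (actions A M t ω j) :=
      measurable_collides.comp (h1.prodMk ((measurable_pi_apply j).comp h1))
    exact hA.next.comp (((measurable_pi_apply j).comp ih).prodMk
      (((measurable_pi_apply j).comp (measurable_snd.comp h0)).prodMk (h2.prodMk h3)))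

lemma measurable_actions (t : ℕ) : Measurable (actions A M t) :=
  (measurable_acts hA).comp ((measurable_states hA t).prodMk
    (measurable_snd.comp (measurable_pi_apply t)))

end Measurability

/-! ## The pseudo-regret -/

section PseudoRegret

variable {K M : ℕ} {A : Policy K} {ν : Fin K → Measure ℝ} [∀ k, IsProbabilityMeasure (ν k)]

/-- The pseudo-regret of round `t`. -/
noncomputable def gap (A : Policy K) (M : ℕ) (ν : Fin K → Measure ℝ) (t : ℕ)
    (ω : ℕ → Round A M) : ℝ :=
  ∑ k ∈ Finset.Icc 1 M, orderStat (means ν) k - ∑ j, reward (means ν) (actions A M t ω) j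

lemma means_mem (hν : ∀ k, ∀ᵐ x ∂(ν k), x ∈ Set.Icc (0 : ℝ) 1) (k : Fin K) :
    means ν k ∈ Set.Icc (0 : ℝ) 1 := by
  have hI : Integrable (fun x : ℝ => x) (ν k) :=
    Integrable.of_mem_Icc 0 1 aemeasurable_id (hν k)
  constructor
  · exact integral_nonneg_of_ae ((hν k).mono fun x hx => hx.1)
  · have h := integral_mono_ae hI (integrable_const 1) ((hν k).mono fun x hx => hx.2)
    simpa [means] using h

lemma orderStat_mem (hν : ∀ k, ∀ᵐ x ∂(ν k), x ∈ Set.Icc (0 : ℝ) 1) (n : ℕ) :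
    orderStat (means ν) n ∈ Set.Icc (0 : ℝ) 1 := by
  unfold orderStat
  split_ifs
  · exact means_mem hν _
  · simp

lemma gap_mem (hν : ∀ k, ∀ᵐ x ∂(ν k), x ∈ Set.Icc (0 : ℝ) 1) (t : ℕ) (ω : ℕ → Round A M) :
    gap A M ν t ω ∈ Set.Icc (-M : ℝ) M := by
  have h1 : ∑ k ∈ Finset.Icc 1 M, orderStat (means ν) k ≤ M := by
    simpa using Finset.sum_le_card_nsmul (Finset.Icc 1 M) _ 1 fun k _ => (orderStat_mem hν k).2
  have h2 : ∑ j, reward (means ν) (actions A M t ω) j ≤ M := by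
    simpa using Finset.sum_le_card_nsmul Finset.univ _ 1
      fun j _ => (reward_mem (means_mem hν) (actions A M t ω) j).2
  have h3 : 0 ≤ ∑ k ∈ Finset.Icc 1 M, orderStat (means ν) k :=
    Finset.sum_nonneg fun k _ => (orderStat_mem hν k).1
  have h4 : 0 ≤ ∑ j, reward (means ν) (actions A M t ω) j :=
    Finset.sum_nonneg fun j _ => (reward_mem (means_mem hν) (actions A M t ω) j).1
  unfold gap
  constructor <;> linarith

lemma ae_round (hν : ∀ k, ∀ᵐ x ∂(ν k), x ∈ Set.Icc (0 : ℝ) 1) :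
    ∀ᵐ ξ ∂roundLaw A M ν, ∀ k, ξ.1 k ∈ Set.Icc (0 : ℝ) 1 := by
  refine ae_all_iff.2 fun k => ?_
  have h1 := (measurePreserving_eval ν k).quasiMeasurePreserving.ae (hν k)
  have h2 : Measure.QuasiMeasurePreserving (Prod.fst : Round A M → _) (roundLaw A M ν)
      (Measure.pi ν) := by
    unfold roundLaw; exact Measure.quasiMeasurePreserving_fst
  exact h2.ae h1

lemma ae_game (hν : ∀ k, ∀ᵐ x ∂(ν k), x ∈ Set.Icc (0 : ℝ) 1) :
    ∀ᵐ ω ∂gameLaw A M ν, ∀ t k, (ω t).1 k ∈ Set.Icc (0 : ℝ) 1 := by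
  refine ae_all_iff.2 fun t => ?_
  have h := measurePreserving_eval_infinitePi (fun _ : ℕ => roundLaw A M ν) t
  exact h.quasiMeasurePreserving.ae (ae_round hν)

instance : IsProbabilityMeasure (gameLaw A M ν) := by unfold gameLaw; infer_instance

variable [MeasurableSpace A.State] (hA : A.IsMeasurable)
include hA

/-- For fixed states the pulled arms are functions of the seeds alone, which are independent of the
arm values, and a reward is linear in the value of the pulled arm. -/
lemma integral_round_reward (hν : ∀ k, ∀ᵐ x ∂(ν k), x ∈ Set.Icc (0 : ℝ) 1)
    (σ : Fin M → A.State) (j : Fin M) :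
    ∫ ξ, reward ξ.1 (acts A σ ξ.2) j ∂roundLaw A M ν =
      ∫ ξ, reward (means ν) (acts A σ ξ.2) j ∂roundLaw A M ν := by
  have hm : Measurable fun ξ : Round A M => acts A σ ξ.2 :=
    (measurable_acts hA).comp (measurable_const.prodMk measurable_snd)
  have hI1 : Integrable (fun ξ : Round A M => reward ξ.1 (acts A σ ξ.2) j) (roundLaw A M ν) :=
    Integrable.of_mem_Icc 0 1 ((measurable_reward j).comp
      (measurable_fst.prodMk hm)).aemeasurable
      ((ae_round hν).mono fun ξ hξ => reward_mem hξ _ j)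
  have hI2 : Integrable (fun ξ : Round A M => reward (means ν) (acts A σ ξ.2) j)
      (roundLaw A M ν) :=
    Integrable.of_mem_Icc 0 1 ((measurable_reward j).comp
      ((measurable_const (a := means ν)).prodMk hm)).aemeasurable
      (ae_of_all _ fun ξ => reward_mem (means_mem hν) _ j)
  unfold roundLaw at hI1 hI2 ⊢
  rw [integral_prod_symm _ hI1, integral_prod_symm _ hI2]
  refine integral_congr_ae (ae_of_all _ fun y => ?_)
  obtain ⟨c, hc⟩ := exists_reward_eq_mul (acts A σ y) j
  simp only [hc]
  rw [integral_mul_const, integral_const]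
  have h := integral_map (μ := Measure.pi ν) (f := fun x : ℝ => x)
    (measurePreserving_eval ν (acts A σ y j)).measurable.aemeasurable
    aestronglyMeasurable_id
  rw [(measurePreserving_eval ν (acts A σ y j)).map_eq] at h
  simp [means, h]

lemma integrable_reward (hν : ∀ k, ∀ᵐ x ∂(ν k), x ∈ Set.Icc (0 : ℝ) 1) (t : ℕ) (j : Fin M) :
    Integrable (fun ω => reward (ω t).1 (actions A M t ω) j) (gameLaw A M ν) :=
  Integrable.of_mem_Icc 0 1 ((measurable_reward j).comp
      ((measurable_fst.comp (measurable_pi_apply t)).prodMk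
        (measurable_actions hA t))).aemeasurable
      ((ae_game hν).mono fun _ hω => reward_mem (hω t) _ j)

lemma measurable_reward_means (t : ℕ) (j : Fin M) :
    Measurable fun ω => reward (means ν) (actions A M t ω) j :=
  (measurable_reward j).comp ((measurable_const (a := means ν)).prodMk (measurable_actions hA t))

lemma integrable_reward_means (hν : ∀ k, ∀ᵐ x ∂(ν k), x ∈ Set.Icc (0 : ℝ) 1) (t : ℕ)
    (j : Fin M) :
    Integrable (fun ω => reward (means ν) (actions A M t ω) j) (gameLaw A M ν) :=
  Integrable.of_mem_Icc 0 1 (measurable_reward_means hA t j).aemeasurable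
    (ae_of_all _ fun _ => reward_mem (means_mem hν) _ j)

lemma integral_reward (hν : ∀ k, ∀ᵐ x ∂(ν k), x ∈ Set.Icc (0 : ℝ) 1) (t : ℕ) (j : Fin M) :
    ∫ ω, reward (ω t).1 (actions A M t ω) j ∂gameLaw A M ν =
      ∫ ω, reward (means ν) (actions A M t ω) j ∂gameLaw A M ν := by
  have hm : Measurable fun ω : ℕ → Round A M => reward (ω t).1 (actions A M t ω) j :=
    (measurable_reward j).comp
      ((measurable_fst.comp (measurable_pi_apply t)).prodMk (measurable_actions hA t))
  have h1 := integral_resample (fun _ : ℕ => roundLaw A M ν) t hm (integrable_reward hA hν t j)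
  have h2 := integral_resample (fun _ : ℕ => roundLaw A M ν) t
    (measurable_reward_means (ν := ν) hA t j) (integrable_reward_means hA hν t j)
  unfold gameLaw
  rw [h1, h2]
  refine integral_congr_ae (ae_of_all _ fun ω => ?_)
  simp only [actions_update_self, Function.update_self]
  exact integral_round_reward hA hν _ j

/-- Resampling round `t` freezes the states before it, so `integral_reward` lets each arm value be
averaged out and leaves a quantity that depends only on the pulled arms. -/
lemma regret_eq_integral_gap (hν : ∀ k, ∀ᵐ x ∂(ν k), x ∈ Set.Icc (0 : ℝ) 1) (T : ℕ) :
    regret A M T ν = ∫ ω, ∑ t ∈ Finset.range T, gap A M ν t ω ∂gameLaw A M ν := by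
  have hI : ∀ t, Integrable (fun ω => ∑ j, reward (means ν) (actions A M t ω) j)
      (gameLaw A M ν) := fun t => integrable_finsetSum _ fun j _ =>
    integrable_reward_means hA hν t j
  have hG : ∀ t, Integrable (fun ω => ∑ k ∈ Finset.Icc 1 M, orderStat (means ν) k -
      ∑ j, reward (means ν) (actions A M t ω) j) (gameLaw A M ν) := fun t =>
    (integrable_const _).sub (hI t)
  unfold regret gap
  rw [integral_finsetSum _ fun t _ => integrable_finsetSum _ fun j _ =>
      integrable_reward hA hν t j,
    integral_finsetSum _ fun t _ => hG t,
    ← Finset.sum_sub_distrib]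
  refine Finset.sum_congr rfl fun t _ => ?_
  rw [integral_finsetSum _ fun j _ => integrable_reward hA hν t j,
    integral_sub (integrable_const _) (hI t),
    integral_finsetSum _ fun j _ => integrable_reward_means hA hν t j]
  simp only [integral_const, probReal_univ, one_smul]
  congr 1
  exact Finset.sum_congr rfl fun j _ => integral_reward hA hν t j

/-- A bound for the regret from a bound for the pseudo-regret outside of a rare event. -/
lemma regret_le_of_bound (hν : ∀ k, ∀ᵐ x ∂(ν k), x ∈ Set.Icc (0 : ℝ) 1) (T : ℕ)
    {D δ : ℝ} (hδ : 0 ≤ δ) (hD : 0 ≤ D) {B : Set (ℕ → Round A M)}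
    (hB : gameLaw A M ν B ≤ ENNReal.ofReal δ)
    (hbound : ∀ ω ∉ B, (∀ t k, (ω t).1 k ∈ Set.Icc (0 : ℝ) 1) →
      ∑ t ∈ Finset.range T, gap A M ν t ω ≤ D) :
    regret A M T ν ≤ D + M * T * δ := by
  -- `B` need not be measurable, so it is enlarged to a measurable hull of the same measure.
  set B' := toMeasurable (gameLaw A M ν) B
  have hB' : MeasurableSet B' := measurableSet_toMeasurable _ _
  have hI : Integrable (fun ω => ∑ t ∈ Finset.range T, gap A M ν t ω) (gameLaw A M ν) :=
    integrable_finsetSum _ fun t _ => (integrable_const _).sub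
      (integrable_finsetSum _ fun j _ => integrable_reward_means hA hν t j)
  have hI2 : Integrable (B'.indicator fun _ => (M * T : ℝ)) (gameLaw A M ν) :=
    (integrable_const _).indicator hB'
  rw [regret_eq_integral_gap hA hν]
  calc _ ≤ ∫ ω, (D + B'.indicator (fun _ => (M * T : ℝ)) ω) ∂gameLaw A M ν := by
        refine integral_mono_ae hI ((integrable_const _).add hI2)
          ((ae_game hν).mono fun ω hω => ?_)
        by_cases h : ω ∈ B'
        · simp only [Set.indicator_of_mem h]
          have h1 : ∑ t ∈ Finset.range T, gap A M ν t ω ≤ T * M := by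
            simpa using Finset.sum_le_card_nsmul (Finset.range T) _ _
              fun t _ => (gap_mem hν t ω).2
          linarith
        · simp only [Set.indicator_of_notMem h, add_zero]
          exact hbound ω (fun h' => h (subset_toMeasurable _ _ h')) hω
    _ = D + M * T * (gameLaw A M ν).real B' := by
        rw [integral_add (integrable_const _) hI2, integral_indicator_const _ hB']
        simp [mul_comm]
    _ ≤ _ := by
        gcongr
        rw [measureReal_def, measure_toMeasurable]
        exact ENNReal.toReal_le_of_le_ofReal hδ hB

end PseudoRegret


/-! ## Measurability of SIC-MMAB -/

namespace SIC

variable {K : ℕ}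

/-- Countability allows the discrete σ-algebra on stages: the dynamics then only has to be
measurable in the real components, stage by stage. -/
instance : Countable (Mem K) := by
  have h : Function.Injective fun m : Mem K =>
      (m.total, m.rank, m.phase, m.players, m.active, m.quant, m.pulls) := by
    rintro ⟨⟩ ⟨⟩ h; simpa using h
  exact h.countable

instance : Countable (Stage K) := by
  let f : Stage K → (ℕ × Option (Fin K)) ⊕ (Fin K × ℕ × ℕ × ℕ) ⊕ (Mem K × ℕ) ⊕
      (Mem K × (Fin K → ℕ) × List (ℕ × ℕ × Fin K) × ℕ) ⊕ Fin K := fun g =>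
    match g with
    | .chairs n x => .inl (n, x)
    | .estim k n a b => .inr (.inl (k, n, a, b))
    | .explore m n => .inr (.inr (.inl (m, n)))
    | .comm m q l n => .inr (.inr (.inr (.inl (m, q, l, n))))
    | .exploit k => .inr (.inr (.inr (.inr k)))
  have h : Function.Injective f := by
    intro a b h
    cases a <;> cases b <;> simp_all [f]
  exact h.countable

instance : MeasurableSpace (Stage K) := ⊤

instance : DiscreteMeasurableSpace (Stage K) := ⟨fun _ => trivial⟩

lemma measurable_quantize :
    Measurable fun p : (Fin K → ℝ) × (Fin K → unitInterval) => quantize p.1 p.2 := by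
  refine measurable_pi_lambda _ fun k => ?_
  have h1 : Measurable fun p : (Fin K → ℝ) × (Fin K → unitInterval) => p.1 k :=
    (measurable_pi_apply k).comp measurable_fst
  have h2 : Measurable fun p : (Fin K → ℝ) × (Fin K → unitInterval) => (p.2 k : ℝ) :=
    measurable_subtype_coe.comp ((measurable_pi_apply k).comp measurable_snd)
  exact (Nat.measurable_floor.comp h1).add
    (Measurable.ite (measurableSet_lt h2 h1.fract) measurable_const measurable_const)

variable [NeZero K]

lemma measurable_step (T T₀ : ℕ) (g : Stage K) (u : Fin K) (c : Bool) :
    Measurable fun p : (Fin K → ℝ) × (Fin K → unitInterval) × ℝ =>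
      step T T₀ (g, p.1) u p.2.1 p.2.2 c := by
  have hc : ∀ g' : Stage K, Measurable fun p : (Fin K → ℝ) × (Fin K → unitInterval) × ℝ =>
      (g', p.1) := fun g' => measurable_const.prodMk measurable_fst
  rcases g with ⟨n, x⟩ | ⟨k, n, a, b⟩ | ⟨m, n⟩ | ⟨m, q, l, n⟩ | k
  · simp only [step]; split_ifs <;> exact hc _
  · simp only [step]; split_ifs <;> exact hc _
  · have hs : Measurable fun p : (Fin K → ℝ) × (Fin K → unitInterval) × ℝ =>
        Function.update p.1 (pull u (.explore m n)) (p.1 (pull u (.explore m n)) + p.2.2) := by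
      refine measurable_pi_lambda _ fun k => ?_
      by_cases h : k = pull u (.explore m n)
      · subst h
        simp only [Function.update_self]
        fun_prop
      · simp only [Function.update_of_ne h]
        fun_prop
    simp only [step]
    split_ifs
    · exact measurable_const.prodMk hs
    · exact ((Measurable.of_discrete (f := Mem.startComm T m)).comp
        (measurable_quantize.comp (hs.prodMk (measurable_fst.comp measurable_snd)))).prodMk hs
  · rcases l with _ | ⟨⟨i, j, k⟩, _ | ⟨y, l⟩⟩ <;> simp only [step] <;> try split_ifs
    all_goals exact hc _
  · exact hc _

end SIC

open SIC

variable {K : ℕ} [NeZero K] {T T₀ : ℕ}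

instance : MeasurableSpace (sicMMAB K T T₀).State :=
  inferInstanceAs (MeasurableSpace (Stage K × (Fin K → ℝ)))

lemma sicMMAB_isMeasurable : (sicMMAB K T T₀).IsMeasurable where
  act := by
    have h : Measurable fun p : Fin K × Stage K => pull p.1 p.2 := Measurable.of_discrete
    have h2 : Measurable fun p : (Stage K × (Fin K → ℝ)) × (Fin K × (Fin K → unitInterval)) =>
        (p.2.1, p.1.1) := by fun_prop
    exact h.comp h2
  next := by
    have h : Measurable fun p : (Stage K × Fin K × Bool) ×
        ((Fin K → ℝ) × (Fin K → unitInterval) × ℝ) =>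
        step T T₀ (p.1.1, p.2.1) p.1.2.1 p.2.2.1 p.2.2.2 p.1.2.2 :=
      measurable_from_prod_countable_right fun p => measurable_step T T₀ p.1 p.2.1 p.2.2
    have h2 : Measurable fun p : (Stage K × (Fin K → ℝ)) × (Fin K × (Fin K → unitInterval)) ×
        ℝ × Bool => ((p.1.1, p.2.1.1, p.2.2.2), (p.1.2, p.2.1.2, p.2.2.1)) := by fun_prop
    exact h.comp h2


/-! ### The stage, the collected rewards and the arm of each player along the game -/

open SIC

variable {K M : ℕ} [NeZero K] {T T₀ : ℕ}

/-- The law of the game on the sequences of rewards and seeds of SIC-MMAB. -/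
abbrev Game (K M T T₀ : ℕ) [NeZero K] : Type := ℕ → Round (sicMMAB K T T₀) M

/-- The stage of player `j` before round `t`. -/
noncomputable def stage (t : ℕ) (ω : Game K M T T₀) (j : Fin M) : Stage K := (states (sicMMAB K T T₀) M t ω j).1

/-- The exploration rewards collected by player `j` before round `t`. -/
noncomputable def sums (t : ℕ) (ω : Game K M T T₀) (j : Fin M) : Fin K → ℝ :=
  (states (sicMMAB K T T₀) M t ω j).2

/-- The arm pulled by player `j` in round `t`. -/
noncomputable def pulled (t : ℕ) (ω : Game K M T T₀) (j : Fin M) : Fin K := actions (sicMMAB K T T₀) M t ω j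

lemma pulled_eq (t : ℕ) (ω : Game K M T T₀) (j : Fin M) :
    pulled t ω j = pull ((ω t).2 j).1 (stage t ω j) := rfl

lemma state_succ (t : ℕ) (ω : Game K M T T₀) (j : Fin M) :
    (stage (t + 1) ω j, sums (t + 1) ω j) = step T T₀ (stage t ω j, sums t ω j) ((ω t).2 j).1
      ((ω t).2 j).2 (reward (ω t).1 (pulled t ω) j) (collides (pulled t ω) (pulled t ω j)) := rfl

lemma collides_iff (a : Fin M → Fin K) (j : Fin M) :
    collides a (a j) = true ↔ ∃ i, i ≠ j ∧ a i = a j := by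
  unfold collides
  rw [decide_eq_true_iff, Finset.one_lt_card]
  constructor
  · rintro ⟨x, hx, y, hy, hxy⟩
    simp only [Finset.mem_filter, Finset.mem_univ, true_and] at hx hy
    by_cases h : x = j
    · exact ⟨y, fun h' => hxy (h.trans h'.symm), hy⟩
    · exact ⟨x, h, hx⟩
  · rintro ⟨i, hi, h⟩
    exact ⟨i, by simp [h], j, by simp, hi⟩

/-! ## Musical Chairs -/

lemma stage_of_collides {t : ℕ} (ht : t < T₀) (ω : Game K M T T₀) (j : Fin M)
    (h : ∀ s < t, collides (pulled s ω) (pulled s ω j) = true) :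
    stage t ω j = .chairs t none := by
  induction t with
  | zero => rfl
  | succ t ih =>
    have h1 := ih (by omega) fun s hs => h s (by omega)
    have h2 := congrArg Prod.fst (state_succ t ω j)
    rw [h1] at h2
    simpa [step, ht, h t (by omega)] using h2

lemma uniform_fst_mem_le (S : Finset (Fin K)) :
    (sicMMAB K T T₀).seedLaw {ξ | (show Fin K × (Fin K → unitInterval) from ξ).1 ∈ S} =
      S.card / K := by
  have h : {ξ : Fin K × (Fin K → unitInterval) | ξ.1 ∈ S} = (S : Set (Fin K)) ×ˢ Set.univ := by
    ext; simp
  change ((uniformOn Set.univ).prod volume) {ξ : Fin K × (Fin K → unitInterval) | ξ.1 ∈ S} = _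
  rw [h, Measure.prod_prod, uniformOn_univ]
  simp [Measure.count_apply]

/-- Whatever the states of the players are, a player who pulls a uniform arm collides with
probability at most `1 - 1 / K`. -/
lemma collides_prob_le (hMK : M ≤ K) (σ : Fin M → (sicMMAB K T T₀).State) (j : Fin M) {n : ℕ}
    (hσ : (σ j).1 = .chairs n none) (ν : Fin K → Measure ℝ) [∀ k, IsProbabilityMeasure (ν k)] :
    roundLaw (sicMMAB K T T₀) M ν {ξ | collides (acts (sicMMAB K T T₀) σ ξ.2)
      (acts (sicMMAB K T T₀) σ ξ.2 j) = true} ≤ ((K - 1 : ℕ) : ENNReal) / K := by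
  let A : Policy K := sicMMAB K T T₀
  change roundLaw A M ν {ξ | collides (acts A σ ξ.2) (acts A σ ξ.2 j) = true} ≤ _
  have hm : Measurable fun η : Fin M → A.Seed => acts A σ η :=
    (measurable_acts sicMMAB_isMeasurable).comp ((measurable_const (a := σ)).prodMk measurable_id)
  have hS : MeasurableSet {η : Fin M → A.Seed | collides (acts A σ η) (acts A σ η j) = true} := by
    have h : Measurable fun η : Fin M → A.Seed => collides (acts A σ η) (acts A σ η j) :=
      measurable_collides.comp (hm.prodMk ((measurable_pi_apply j).comp hm))
    exact h (measurableSet_singleton true)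
  have h1 : {ξ : Round A M | collides (acts A σ ξ.2) (acts A σ ξ.2 j) = true} =
      Set.univ ×ˢ {η : Fin M → A.Seed | collides (acts A σ η) (acts A σ η j) = true} := by
    ext; simp
  rw [h1, roundLaw, Measure.prod_prod, measure_univ, one_mul, ← lintegral_indicator_one hS,
    lintegral_resample_pi _ j (measurable_one.indicator hS)]
  refine (lintegral_mono fun η => ?_ : _ ≤ ∫⁻ _, ((K - 1 : ℕ) : ENNReal) / K
    ∂Measure.pi fun _ : Fin M => A.seedLaw).trans (by simp)
  -- The arms of the other players do not involve the seed of `j`. They form a set of at most `M - 1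
  -- ≤ K - 1` arms, and `j` collides exactly when her uniform arm falls in it.
  let S : Finset (Fin K) := (Finset.univ.erase j).image fun i => acts A σ η i
  have hcard : S.card ≤ K - 1 := by
    refine Finset.card_image_le.trans ?_
    rw [Finset.card_erase_of_mem (Finset.mem_univ _), Finset.card_univ, Fintype.card_fin]
    omega
  have h2 : ∀ ξ : A.Seed, Function.update η j ξ ∈
      {η : Fin M → A.Seed | collides (acts A σ η) (acts A σ η j) = true} ↔
      (show Fin K × (Fin K → unitInterval) from ξ).1 ∈ S := by
    intro ξ
    have h3 : ∀ i, i ≠ j → acts A σ (Function.update η j ξ) i = acts A σ η i := fun i hi => by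
      simp [acts, Function.update_of_ne hi]
    have h4 : acts A σ (Function.update η j ξ) j =
        (show Fin K × (Fin K → unitInterval) from ξ).1 := by
      simp only [acts, Function.update_self]
      change pull _ (σ j).1 = _
      rw [hσ]; rfl
    rw [Set.mem_ofPred_eq, collides_iff, h4]
    simp only [S, Finset.mem_image, Finset.mem_erase, Finset.mem_univ, and_true]
    exact exists_congr fun i => and_congr_right fun hi => by rw [h3 i hi]
  have h5 : MeasurableSet {ξ : A.Seed | (show Fin K × (Fin K → unitInterval) from ξ).1 ∈ S} :=
    (measurable_fst : Measurable fun ξ : Fin K × (Fin K → unitInterval) => ξ.1)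
      (MeasurableSet.of_discrete (s := (S : Set (Fin K))))
  calc _ = ∫⁻ ξ, {ξ : A.Seed | (show Fin K × (Fin K → unitInterval) from ξ).1 ∈ S}.indicator 1 ξ
        ∂A.seedLaw := by
        refine lintegral_congr fun ξ => ?_
        simp only [Set.indicator_apply, h2]
        rfl
    _ = S.card / K := by rw [lintegral_indicator_one h5, uniform_fst_mem_le]
    _ ≤ _ := by gcongr

/-- A player who has always collided is still drawing uniform arms, so each further round multiplies
the probability by the bound of `collides_prob_le`, after the last round has been resampled. -/
lemma collides_always_prob_le (hMK : M ≤ K) (j : Fin M) (ν : Fin K → Measure ℝ)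
    [∀ k, IsProbabilityMeasure (ν k)] {n : ℕ} (hn : n ≤ T₀) :
    gameLaw (sicMMAB K T T₀) M ν {ω | ∀ t < n, collides (pulled t ω) (pulled t ω j) = true} ≤
      (((K - 1 : ℕ) : ENNReal) / K) ^ n := by
  have hS : ∀ n, MeasurableSet {ω : Game K M T T₀ |
      ∀ t < n, collides (pulled t ω) (pulled t ω j) = true} := fun n => by
    have h : ∀ t, MeasurableSet {ω : Game K M T T₀ |
        collides (pulled t ω) (pulled t ω j) = true} := fun t => by
      have h1 : Measurable fun ω : Game K M T T₀ => collides (pulled t ω) (pulled t ω j) :=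
        measurable_collides.comp ((measurable_actions sicMMAB_isMeasurable t).prodMk
          ((measurable_pi_apply j).comp (measurable_actions sicMMAB_isMeasurable t)))
      exact h1 (measurableSet_singleton true)
    simp only [Set.ofPred_forall]
    exact MeasurableSet.iInter fun t => MeasurableSet.iInter fun _ => h t
  induction n with
  | zero => simp
  | succ n ih =>
    rw [← lintegral_indicator_one (hS _)]
    unfold gameLaw at ih ⊢
    rw [lintegral_resample _ n (measurable_one.indicator (hS _)), pow_succ]
    refine le_trans ?_ (mul_le_mul_left (ih (by omega)) _)
    rw [← lintegral_indicator_one (hS _), ← lintegral_mul_const _ (measurable_one.indicator (hS _))]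
    refine lintegral_mono fun ω => ?_
    have h1 : ∀ t < n, ∀ ξ, pulled t (Function.update ω n ξ) = pulled t ω := fun t ht ξ => by
      funext i
      rw [pulled_eq, pulled_eq, stage, stage, states_update ht.le,
        Function.update_of_ne ht.ne]
    by_cases h : ω ∈ {ω : Game K M T T₀ | ∀ t < n, collides (pulled t ω) (pulled t ω j) = true}
    · rw [Set.indicator_of_mem h, Pi.one_apply, one_mul]
      have h2 := collides_prob_le hMK (states _ M n ω) j (stage_of_collides (by omega) ω j h) ν
      refine le_trans ?_ h2
      refine (lintegral_mono (g := Set.indicator {ξ : Round (sicMMAB K T T₀) M |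
        collides (acts _ (states _ M n ω) ξ.2) (acts _ (states _ M n ω) ξ.2 j) = true} 1)
        fun ξ => ?_).trans (lintegral_indicator_one_le _)
      by_cases h3 : Function.update ω n ξ ∈ {ω : Game K M T T₀ |
          ∀ t < n + 1, collides (pulled t ω) (pulled t ω j) = true}
      · have h4 := h3 n (by omega)
        have h5 : pulled n (Function.update ω n ξ) = acts _ (states _ M n ω) ξ.2 :=
          actions_update_self n ω ξ
        rw [h5] at h4
        rw [Set.indicator_of_mem h3, Set.indicator_of_mem (a := ξ) (by exact h4)]
        rfl
      · rw [Set.indicator_of_notMem h3]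
        exact zero_le
    · rw [Set.indicator_of_notMem h, zero_mul]
      refine le_of_eq ((lintegral_congr fun ξ => ?_).trans lintegral_zero)
      refine Set.indicator_of_notMem (fun h3 => h fun t ht => ?_) _
      have h4 := h3 t (by omega)
      rwa [h1 t ht ξ] at h4


open SIC

variable {K M : ℕ} [NeZero K] {T T₀ : ℕ}

/-! ## Concentration of the exploration rewards -/

/-- A player at this stage explores arm `k`. -/
def SIC.Stage.Explores (g : Stage K) (k : Fin K) : Prop :=
  match g with
  | .explore m n => m.arm (m.rank + n + 1) = k
  | _ => False

open Classical in
/-- The number of rounds before `t` in which some player explores arm `k`. -/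
noncomputable def count (k : Fin K) (t : ℕ) (ω : Game K M T T₀) : ℕ :=
  ∑ s ∈ Finset.range t, if ∃ j, (stage s ω j).Explores k then 1 else 0

open Classical in
/-- The deviation of the sum of the rewards of arm `k` in the rounds before `t` in which some player
explores it. -/
noncomputable def deviation (ν : Fin K → Measure ℝ) (k : Fin K) (t : ℕ) (ω : Game K M T T₀) : ℝ :=
  ∑ s ∈ Finset.range t,
    if ∃ j, (stage s ω j).Explores k then (ω s).1 k - means ν k else 0

open Classical in
/-- Indicator of the rounds `t` in which arm `k` is explored for one of the first `s` times. -/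
noncomputable def early (k : Fin K) (s t : ℕ) (ω : Game K M T T₀) : ℝ :=
  if (∃ j, (stage t ω j).Explores k) ∧ count k t ω < s then 1 else 0

lemma stage_update {t t' : ℕ} (h : t ≤ t') (ω : Game K M T T₀) (ξ) :
    stage t (Function.update ω t' ξ) = stage t ω := by
  unfold stage; rw [states_update h]

lemma count_update (k : Fin K) {t t' : ℕ} (h : t ≤ t') (ω : Game K M T T₀) (ξ) :
    count k t (Function.update ω t' ξ) = count k t ω := by
  refine Finset.sum_congr rfl fun s hs => ?_
  rw [stage_update ((Finset.mem_range.1 hs).le.trans h)]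

lemma measurable_stage (t : ℕ) : Measurable fun ω : Game K M T T₀ => stage t ω := by
  refine measurable_pi_lambda _ fun j => ?_
  exact measurable_fst.comp ((measurable_pi_apply j).comp
    (measurable_states (sicMMAB_isMeasurable (K := K) (T := T) (T₀ := T₀)) t))

lemma measurable_sums (t : ℕ) (j : Fin M) : Measurable fun ω : Game K M T T₀ => sums t ω j :=
  measurable_snd.comp ((measurable_pi_apply j).comp
    (measurable_states (sicMMAB_isMeasurable (K := K) (T := T) (T₀ := T₀)) t))

lemma measurable_count (k : Fin K) (t : ℕ) : Measurable fun ω : Game K M T T₀ => count k t ω := by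
  classical
  refine Finset.measurable_sum _ fun s _ => ?_
  exact (Measurable.of_discrete (f := fun g : Fin M → Stage K =>
    if ∃ j, (g j).Explores k then 1 else 0)).comp (measurable_stage s)

lemma measurable_early (k : Fin K) (s t : ℕ) : Measurable fun ω : Game K M T T₀ => early k s t ω := by
  classical
  exact (Measurable.of_discrete (f := fun p : (Fin M → Stage K) × ℕ =>
    (if (∃ j, (p.1 j).Explores k) ∧ p.2 < s then 1 else 0 : ℝ))).comp
    ((measurable_stage t).prodMk (measurable_count k t))

open Classical in
lemma count_succ (k : Fin K) (t : ℕ) (ω : Game K M T T₀) :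
    count k (t + 1) ω = count k t ω + if ∃ j, (stage t ω j).Explores k then 1 else 0 :=
  Finset.sum_range_succ _ _

lemma count_succ_le (k : Fin K) (t : ℕ) (ω : Game K M T T₀) :
    count k (t + 1) ω ≤ count k t ω + 1 := by
  rw [count_succ]
  split_ifs <;> omega

lemma count_mono (k : Fin K) (ω : Game K M T T₀) : Monotone fun t => count k t ω := by
  refine monotone_nat_of_le_succ fun t => ?_
  simp only [count, Finset.sum_range_succ]
  omega

lemma count_le (k : Fin K) (t : ℕ) (ω : Game K M T T₀) : count k t ω ≤ t := by
  induction t with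
  | zero => simp [count]
  | succ t ih => exact (count_succ_le k t ω).trans (by omega)

lemma sum_early_le (k : Fin K) (s n : ℕ) (ω : Game K M T T₀) :
    ∑ t ∈ Finset.range n, early k s t ω ≤ s := by
  -- The induction needs the count inside the bound, since the selection stops when the count
  -- reaches `s`.
  have h : ∑ t ∈ Finset.range n, early k s t ω ≤ min (count k n ω : ℝ) s := by
    induction n with
    | zero => simp
    | succ n ih =>
      rw [Finset.sum_range_succ]
      rw [count_succ, early]
      by_cases h2 : ∃ j, (stage n ω j).Explores k
      · by_cases h3 : count k n ω < s
        · have h4 : (count k n ω : ℝ) + 1 ≤ s := by exact_mod_cast h3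
          simp only [h2, h3, and_self, if_true]
          push_cast
          rw [min_eq_left h4]
          linarith [min_le_left (count k n ω : ℝ) s]
        · simp only [h2, h3, and_false, if_true, if_false, add_zero]
          push_cast
          exact ih.trans (min_le_min (by linarith) le_rfl)
      · simp only [h2, false_and, if_false, add_zero]
        exact ih
  exact h.trans (min_le_right _ _)

/-- With `s` equal to the count at time `t`, the first `s` explorations are exactly those made
before `t`. A deviation over a random number of pulls is thus one of the finitely many sums with
fixed `s`, and a union bound over `s ≤ T` covers all times. -/
lemma deviation_eq_sum_early (ν : Fin K → Measure ℝ) (k : Fin K) {t n : ℕ} (htn : t ≤ n)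
    (ω : Game K M T T₀) :
    deviation ν k t ω =
      ∑ u ∈ Finset.range n, early k (count k t ω) u ω * ((ω u).1 k - means ν k) := by
  rw [← Finset.sum_subset (Finset.range_subset_range.2 htn)]
  · refine Finset.sum_congr rfl fun u hu => ?_
    have hu' := Finset.mem_range.1 hu
    by_cases h : ∃ j, (stage u ω j).Explores k
    · have h1 : count k u ω < count k t ω := by
        refine lt_of_lt_of_le ?_ (count_mono k ω (show u + 1 ≤ t from hu'))
        simp only [count_succ, if_pos h]; omega
      simp [early, h, h1]
    · simp [early, h]
  · intro u _ hu
    have h1 : count k t ω ≤ count k u ω := count_mono k ω (by simpa using hu)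
    simp [early, not_lt.2 h1]

section Events

variable {ν : Fin K → Measure ℝ} [∀ k, IsProbabilityMeasure (ν k)]

lemma hasSubgaussianMGF_round {A : Policy K} (hν : ∀ k, ∀ᵐ x ∂(ν k), x ∈ Set.Icc (0 : ℝ) 1)
    (k : Fin K) :
    HasSubgaussianMGF (fun ξ : Round A M => ξ.1 k - means ν k) (1 / 4) (roundLaw A M ν) := by
  have h := hasSubgaussianMGF_of_mem_Icc (a := (0 : ℝ)) (b := 1) aemeasurable_id (hν k)
  have h2 : MeasurePreserving (fun ξ : Round A M => ξ.1 k) (roundLaw A M ν) (ν k) := by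
    unfold roundLaw
    exact (measurePreserving_eval ν k).comp measurePreserving_fst
  have h3 := HasSubgaussianMGF.of_map (X := fun x : ℝ => x - means ν k)
    (c := 1 / 4) h2.measurable.aemeasurable (by
      rw [h2.map_eq]
      convert h using 1
      · ext; simp [means]
      · ext; simp; norm_num)
  exact h3

/-- The number of rounds in which an arm is explored is fixed in this concentration event. -/
def DeviationFails (ν : Fin K → Measure ℝ) (k : Fin K) (s : ℕ) (ω : Game K M T T₀) : Prop :=
  √(s * Real.log T) ≤ ∑ u ∈ Finset.range T, early k s u ω * ((ω u).1 k - means ν k) ∨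
    √(s * Real.log T) ≤ ∑ u ∈ Finset.range T, early k s u ω * -((ω u).1 k - means ν k)

lemma exp_neg_mul_log {T : ℕ} (hT : 1 ≤ T) (n : ℕ) :
    Real.exp (-(n * Real.log T)) = ((T : ℝ) ^ n)⁻¹ := by
  rw [Real.exp_neg, mul_comm, Real.exp_mul, Real.exp_log (by positivity), Real.rpow_natCast]

/-- The threshold `√(s log T)` gives `exp (-2 log T) = T⁻²` on each side. The exponent two pays for
the union over the `T` values of `s` and leaves `1/T`. -/
lemma deviationFails_prob_le (hν : ∀ k, ∀ᵐ x ∂(ν k), x ∈ Set.Icc (0 : ℝ) 1) (hT : 1 ≤ T)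
    (k : Fin K) {s : ℕ} (hs : 0 < s) :
    gameLaw (sicMMAB K T T₀) M ν {ω | DeviationFails ν k s ω} ≤
      ENNReal.ofReal (2 * ((T : ℝ) ^ 2)⁻¹) := by
  have hlog : 0 ≤ Real.log T := Real.log_natCast_nonneg T
  have hs' : (0 : ℝ) < s := by exact_mod_cast hs
  have hsq : -2 * √(s * Real.log T) ^ 2 / s = -((2 : ℕ) * Real.log T) := by
    rw [Real.sq_sqrt (by positivity)]; field_simp; push_cast; ring
  have hYm : Measurable fun ξ : Round (sicMMAB K T T₀) M => ξ.1 k - means ν k :=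
    ((measurable_pi_apply k).comp measurable_fst).sub_const _
  have hpred : ∀ t (ω : Game K M T T₀) t' ξ, t ≤ t' →
      early k s t (Function.update ω t' ξ) = early k s t ω := fun t ω t' ξ h => by
    unfold early; rw [stage_update h, count_update k h]
  have ha : ∀ t (ω : Game K M T T₀), early k s t ω = 0 ∨ early k s t ω = 1 := fun t ω => by
    unfold early; split_ifs <;> simp
  have h1 := measure_predictable_sum_ge_le (hasSubgaussianMGF_round hν k) hYm
    (measurable_early k s) ha hpred hs' (sum_early_le k s T) (Real.sqrt_nonneg (s * Real.log T))
  have h2 := measure_predictable_sum_ge_le (Y := fun ξ => -(ξ.1 k - means ν k))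
    (hasSubgaussianMGF_round hν k).neg hYm.neg
    (measurable_early k s) ha hpred hs' (sum_early_le k s T) (Real.sqrt_nonneg (s * Real.log T))
  rw [hsq, exp_neg_mul_log hT] at h1 h2
  refine (measure_union_le _ _).trans ((add_le_add h1 h2).trans (le_of_eq ?_))
  rw [← ENNReal.ofReal_add (by positivity) (by positivity), two_mul]

/-! ## Concentration of the rounding errors -/

/-- A player of rank at least `r` at this stage is in the last round of an exploration phase. -/
def SIC.Stage.EndsExploration (g : Stage K) (r : ℕ) : Prop :=
  match g with
  | .explore m n => n + 1 = m.active.length * 2 ^ m.phase ∧ r ≤ m.rank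
  | _ => False

open Classical in
/-- The sum of arm `k` after a round without collision. -/
noncomputable def nextSum (g : Stage K) (s x : Fin K → ℝ) (k : Fin K) : ℝ :=
  s k + if g.Explores k then x k else 0

open Classical in
/-- The players of rank at least `r` who finish an exploration phase. -/
noncomputable def finishers (g : Fin M → Stage K) (r : ℕ) : Finset (Fin M) :=
  Finset.univ.filter fun j => (g j).EndsExploration r

/-- The sum of the rounding errors for arm `k` of the players of rank at least `r` who finish an
exploration phase. -/
noncomputable def roundSum (r : ℕ) (k : Fin K) (t : ℕ) (ω : Game K M T T₀) : ℝ :=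
  ∑ j ∈ finishers (stage t ω) r,
    roundErr k (Int.fract (nextSum (stage t ω j) (sums t ω j) (ω t).1 k)) ((ω t).2 j).2

/-- The threshold gives probability `T⁻³` on each side, to afford a union over rounds and ranks. All
`r` are needed because the set of players who leave after a phase depends on the roundings
themselves, but it is always of the form "active of rank at least `r`". The inequality is strict, so
that an empty set of finishers never fails. -/
def RoundingFails (r : ℕ) (k : Fin K) (t : ℕ) (ω : Game K M T T₀) : Prop :=
  √(3 / 2 * (finishers (stage t ω) r).card * Real.log T) < |roundSum r k t ω|

lemma measurable_roundErr_uncurry (k : Fin K) :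
    Measurable fun p : ℝ × (Fin K → unitInterval) => roundErr k p.1 p.2 := by
  unfold roundErr
  refine (Measurable.ite ?_ measurable_const measurable_const).sub measurable_fst
  exact measurableSet_lt (measurable_subtype_coe.comp ((measurable_pi_apply k).comp measurable_snd))
    measurable_fst

lemma measurableSet_roundingFails (r : ℕ) (k : Fin K) (t : ℕ) :
    MeasurableSet {ω : Game K M T T₀ | RoundingFails r k t ω} := by
  classical
  have hround : Measurable fun ω : Game K M T T₀ => ω t := measurable_pi_apply t
  have hx : Measurable fun ω : Game K M T T₀ => (ω t).1 k :=
    (measurable_pi_apply k).comp (measurable_fst.comp hround)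
  have hv : ∀ j, Measurable fun ω : Game K M T T₀ => ((ω t).2 j).2 := fun j => by
    have h : Measurable fun ω : Game K M T T₀ => (ω t).2 j :=
      (measurable_pi_apply j).comp (measurable_snd.comp hround)
    exact (measurable_snd : Measurable fun ξ : Fin K × (Fin K → unitInterval) => ξ.2).comp h
  have hg : ∀ (S : Set (Fin M → Stage K)), MeasurableSet {ω : Game K M T T₀ | stage t ω ∈ S} :=
    fun S => measurable_stage t (MeasurableSet.of_discrete)
  have hsum : Measurable fun ω : Game K M T T₀ => roundSum r k t ω := by
    have h : (fun ω : Game K M T T₀ => roundSum r k t ω) = fun ω => ∑ j,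
        if (stage t ω j).EndsExploration r then roundErr k (Int.fract
          (nextSum (stage t ω j) (sums t ω j) (ω t).1 k)) ((ω t).2 j).2 else 0 := by
      funext ω
      rw [roundSum, finishers, Finset.sum_filter]
    rw [h]
    refine Finset.measurable_sum _ fun j _ => Measurable.ite (hg {g | (g j).EndsExploration r})
      ((measurable_roundErr_uncurry k).comp (Measurable.prodMk ?_ (hv j))) measurable_const
    refine Measurable.fract (Measurable.add ?_ (Measurable.ite (hg {g | (g j).Explores k}) hx
      measurable_const))
    exact (measurable_pi_apply k).comp (measurable_sums t j)
  have hcard : Measurable fun ω : Game K M T T₀ => ((finishers (stage t ω) r).card : ℝ) :=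
    (Measurable.of_discrete (f := fun g : Fin M → Stage K => ((finishers g r).card : ℝ))).comp
      (measurable_stage t)
  exact measurableSet_lt (Real.continuous_sqrt.measurable.comp
    ((hcard.const_mul (3 / 2)).mul_const _)) (continuous_abs.measurable.comp hsum)

/-- The rounding errors given the states and the rewards. -/
lemma seeds_roundErr_prob_le (hT : 1 ≤ T) (k : Fin K) (J : Finset (Fin M)) (f : Fin M → ℝ)
    (hf : ∀ j, 0 ≤ f j ∧ f j ≤ 1) :
    Measure.pi (fun _ : Fin M => (sicMMAB K T T₀).seedLaw) {η |
      √(3 / 2 * J.card * Real.log T) < |∑ j ∈ J, roundErr k (f j)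
        (show Fin K × (Fin K → unitInterval) from η j).2|} ≤
      ENNReal.ofReal (2 * ((T : ℝ) ^ 3)⁻¹) := by
  have hlog : 0 ≤ Real.log T := Real.log_natCast_nonneg T
  rcases J.eq_empty_or_nonempty with rfl | hJ
  · simp
  have hJ' : (0 : ℝ) < J.card := by exact_mod_cast hJ.card_pos
  have hsq : -2 * √(3 / 2 * J.card * Real.log T) ^ 2 / J.card = -((3 : ℕ) * Real.log T) := by
    rw [Real.sq_sqrt (by positivity)]; field_simp; push_cast; ring
  have hprob : IsProbabilityMeasure (uniformOn (Set.univ : Set (Fin K))) :=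
    isProbabilityMeasure_uniformOn Set.finite_univ Set.univ_nonempty
  have hsub : ∀ j, HasSubgaussianMGF
      (fun ξ : Fin K × (Fin K → unitInterval) => roundErr k (f j) ξ.2) (1 / 4)
      ((uniformOn (Set.univ : Set (Fin K))).prod volume) := fun j => by
    have h2 : MeasurePreserving (Prod.snd : Fin K × (Fin K → unitInterval) → _)
      ((uniformOn (Set.univ : Set (Fin K))).prod volume) volume := measurePreserving_snd
    refine HasSubgaussianMGF.of_map (X := roundErr k (f j)) h2.measurable.aemeasurable ?_
    rw [h2.map_eq]
    exact hasSubgaussianMGF_roundErr k (hf j).1 (hf j).2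
  have hm : ∀ j, Measurable
      (fun ξ : Fin K × (Fin K → unitInterval) => roundErr k (f j) ξ.2) := fun j =>
    (measurable_roundErr k (f j)).comp measurable_snd
  have h1 := measure_pi_sum_ge_le hsub hm J (Real.sqrt_nonneg (3 / 2 * J.card * Real.log T))
  have h2 := measure_pi_sum_ge_le (fun j => (hsub j).neg) (fun j => (hm j).neg) J
    (Real.sqrt_nonneg (3 / 2 * J.card * Real.log T))
  rw [hsq, exp_neg_mul_log hT] at h1 h2
  refine (measure_mono ?_).trans ((measure_union_le _ _).trans
    ((add_le_add h1 h2).trans (le_of_eq ?_)))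
  · intro η hη
    rcases le_abs'.1 (le_of_lt (Set.mem_ofPred_eq ▸ hη)) with h | h
    · right
      have h3 := le_neg.1 h
      rw [← Finset.sum_neg_distrib] at h3
      exact h3
    · left; exact h
  · rw [← ENNReal.ofReal_add (by positivity) (by positivity), two_mul]

/-- After round `t` is resampled and its rewards are fixed, the fractional parts and the set of
finishers are deterministic, and only the independent rounding seeds of that round remain. -/
lemma roundingFails_prob_le (hT : 1 ≤ T) (r : ℕ) (k : Fin K) (t : ℕ) :
    gameLaw (sicMMAB K T T₀) M ν {ω | RoundingFails r k t ω} ≤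
      ENNReal.ofReal (2 * ((T : ℝ) ^ 3)⁻¹) := by
  have hS := measurableSet_roundingFails (M := M) (T := T) (T₀ := T₀) r k t
  rw [← lintegral_indicator_one hS]
  unfold gameLaw
  rw [lintegral_resample _ t (measurable_one.indicator hS)]
  refine (lintegral_mono (g := fun _ => ENNReal.ofReal (2 * ((T : ℝ) ^ 3)⁻¹)) fun ω => ?_).trans
    (by rw [lintegral_const, measure_univ, mul_one])
  have hmu : Measurable fun ξ : Round (sicMMAB K T T₀) M => Function.update ω t ξ :=
    measurable_update ω
  have hS' := hmu hS
  change ∫⁻ ξ, ((fun ξ => Function.update ω t ξ) ⁻¹' {ω | RoundingFails r k t ω}).indicator 1 ξ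
    ∂(roundLaw (sicMMAB K T T₀) M ν) ≤ _
  rw [lintegral_indicator_one hS', roundLaw, Measure.prod_apply hS']
  refine (lintegral_mono (g := fun _ => ENNReal.ofReal (2 * ((T : ℝ) ^ 3)⁻¹)) fun x => ?_).trans
    (by rw [lintegral_const, measure_univ, mul_one])
  refine le_trans (measure_mono ?_) (seeds_roundErr_prob_le hT k (finishers (stage t ω) r)
    (fun j => Int.fract (nextSum (stage t ω j) (sums t ω j) x k))
    fun j => ⟨Int.fract_nonneg _, (Int.fract_lt_one _).le⟩)
  intro η hη
  have h1 : RoundingFails r k t (Function.update ω t (x, η)) := hη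
  unfold RoundingFails roundSum sums at h1
  rw [stage_update le_rfl, states_update le_rfl, Function.update_self] at h1
  exact h1

/-! ## The good event -/

/-- The favourable event for the analysis of SIC-MMAB. -/
structure Good (ν : Fin K → Measure ℝ) (ω : Game K M T T₀) : Prop where
  reward : ∀ t k, (ω t).1 k ∈ Set.Icc (0 : ℝ) 1
  chairs : ∀ j, ∃ t < T₀, collides (pulled t ω) (pulled t ω j) = false
  deviation : ∀ t ≤ T, ∀ k, |deviation ν k t ω| ≤ √(count k t ω * Real.log T)
  rounding : ∀ t < T, ∀ r < M, ∀ k,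
    |roundSum r k t ω| ≤ √(3 / 2 * (finishers (stage t ω) r).card * Real.log T)

/-- Good events have high probability. -/
lemma exists_bad_event (hν : ∀ k, ∀ᵐ x ∂(ν k), x ∈ Set.Icc (0 : ℝ) 1) (hMK : M ≤ K) (hMT : M ≤ T)
    (hT : 1 ≤ T) (hT₀ : K * Real.log T ≤ T₀) :
    ∃ B : Set (Game K M T T₀),
      gameLaw (sicMMAB K T T₀) M ν B ≤ ENNReal.ofReal (5 * K / T) ∧
      ∀ ω ∉ B, (∀ t k, (ω t).1 k ∈ Set.Icc (0 : ℝ) 1) → Good ν ω := by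
  have hT' : (0 : ℝ) < T := by exact_mod_cast hT
  have hK : 0 < K := Nat.pos_of_ne_zero (NeZero.ne K)
  have hK' : (0 : ℝ) < K := by exact_mod_cast hK
  let B₁ : Set (Game K M T T₀) := ⋃ j ∈ (Finset.univ : Finset (Fin M)),
    {ω | ∀ t < T₀, collides (pulled t ω) (pulled t ω j) = true}
  let B₂ : Set (Game K M T T₀) := ⋃ p ∈ (Finset.univ : Finset (Fin K)) ×ˢ Finset.Icc 1 T,
    {ω | DeviationFails ν p.1 p.2 ω}
  let B₃ : Set (Game K M T T₀) := ⋃ p ∈ Finset.range T ×ˢ Finset.range M ×ˢ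
    (Finset.univ : Finset (Fin K)), {ω | RoundingFails p.2.1 p.2.2 p.1 ω}
  have h1 : gameLaw (sicMMAB K T T₀) M ν B₁ ≤ ENNReal.ofReal (K / T) := by
    refine (measure_biUnion_finset_le _ _).trans ((Finset.sum_le_card_nsmul _ _
      (ENNReal.ofReal (T : ℝ)⁻¹) fun j _ => ?_).trans ?_)
    · refine (collides_always_prob_le hMK j ν le_rfl).trans ?_
      have h2 : ((K - 1 : ℕ) : ENNReal) / K = ENNReal.ofReal (1 - 1 / K) := by
        rw [← ENNReal.ofReal_natCast, ← ENNReal.ofReal_natCast (n := K),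
          ← ENNReal.ofReal_div_of_pos hK', Nat.cast_sub hK]
        congr 1
        field_simp
        simp
      have h3 : (0 : ℝ) ≤ 1 - 1 / K := by
        rw [sub_nonneg, div_le_one hK']; exact_mod_cast hK
      rw [h2, ← ENNReal.ofReal_pow h3]
      refine ENNReal.ofReal_le_ofReal ?_
      -- This is where `T₀ ≥ K log T` is used: a given player fails Musical Chairs with probability
      -- at most `1/T`.
      calc (1 - 1 / (K : ℝ)) ^ T₀ ≤ Real.exp (-(1 / K)) ^ T₀ := by
            gcongr
            linarith [Real.add_one_le_exp (-(1 / (K : ℝ)))]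
        _ = Real.exp (-(T₀ / K)) := by rw [← Real.exp_nat_mul]; ring_nf
        _ ≤ Real.exp (-Real.log T) := by
            refine Real.exp_le_exp.2 (neg_le_neg ?_)
            rw [le_div_iff₀ hK']; linarith
        _ = _ := by rw [Real.exp_neg, Real.exp_log hT']
    · rw [Finset.card_univ, Fintype.card_fin, nsmul_eq_mul, ← ENNReal.ofReal_natCast,
        ← ENNReal.ofReal_mul (by positivity), div_eq_mul_inv]
      gcongr
  have h2 : gameLaw (sicMMAB K T T₀) M ν B₂ ≤ ENNReal.ofReal (2 * K / T) := by
    refine (measure_biUnion_finset_le _ _).trans ((Finset.sum_le_card_nsmul _ _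
      (ENNReal.ofReal (2 * ((T : ℝ) ^ 2)⁻¹)) fun p hp => ?_).trans ?_)
    · exact deviationFails_prob_le hν hT p.1 (by
        have := (Finset.mem_product.1 hp).2; simp at this; omega)
    · rw [Finset.card_product, Finset.card_univ, Fintype.card_fin, Nat.card_Icc, nsmul_eq_mul,
        ← ENNReal.ofReal_natCast, ← ENNReal.ofReal_mul (by positivity)]
      refine ENNReal.ofReal_le_ofReal (le_of_eq ?_)
      push_cast
      field_simp
  have h3 : gameLaw (sicMMAB K T T₀) M ν B₃ ≤ ENNReal.ofReal (2 * K / T) := by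
    refine (measure_biUnion_finset_le _ _).trans ((Finset.sum_le_card_nsmul _ _
      (ENNReal.ofReal (2 * ((T : ℝ) ^ 3)⁻¹)) fun p hp => ?_).trans ?_)
    · exact roundingFails_prob_le hT p.2.1 p.2.2 p.1
    · rw [Finset.card_product, Finset.card_product, Finset.card_univ, Fintype.card_fin,
        Finset.card_range, Finset.card_range, nsmul_eq_mul,
        ← ENNReal.ofReal_natCast, ← ENNReal.ofReal_mul (by positivity)]
      refine ENNReal.ofReal_le_ofReal ?_
      have hMT' : (M : ℝ) ≤ T := by exact_mod_cast hMT
      push_cast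
      -- The union runs over `T M K` triples; `M ≤ T` absorbs the number of ranks into the third
      -- power of `T`.
      calc (T : ℝ) * (M * K) * (2 * ((T : ℝ) ^ 3)⁻¹) ≤ T * (T * K) * (2 * ((T : ℝ) ^ 3)⁻¹) := by
            gcongr
        _ = _ := by field_simp
  refine ⟨B₁ ∪ (B₂ ∪ B₃), ?_, fun ω hω hx => ?_⟩
  · refine (measure_union_le _ _).trans ((add_le_add h1 ((measure_union_le _ _).trans
      (add_le_add h2 h3))).trans (le_of_eq ?_))
    rw [← ENNReal.ofReal_add (by positivity) (by positivity),
      ← ENNReal.ofReal_add (by positivity) (by positivity)]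
    congr 1
    ring
  · simp only [Set.mem_union, not_or] at hω
    obtain ⟨hω1, hω2, hω3⟩ := hω
    refine ⟨hx, fun j => ?_, fun t ht k => ?_, fun t ht r hr k => ?_⟩
    · by_contra! h
      exact hω1 (Set.mem_biUnion (Finset.mem_univ j) fun t ht => by simpa using h t ht)
    -- The union over `s` starts at one, and a count of zero gives an empty sum.
    · rcases Nat.eq_zero_or_pos (count k t ω) with h | h
      · rw [deviation_eq_sum_early ν k ht, h]
        have h0 : ∀ u, early k 0 u ω = 0 := fun u => by simp [early]
        simp [h0]
      · have h4 : ¬ DeviationFails ν k (count k t ω) ω := fun h5 =>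
          hω2 (Set.mem_biUnion (x := (k, count k t ω)) (by
            simp only [Finset.coe_product, Set.mem_prod, Finset.mem_coe, Finset.mem_univ,
              Finset.mem_Icc, true_and]
            exact ⟨h, (count_le k t ω).trans ht⟩) h5)
        unfold DeviationFails at h4
        push Not at h4
        obtain ⟨h5, h6⟩ := h4
        simp only [mul_neg, Finset.sum_neg_distrib] at h6
        rw [← deviation_eq_sum_early ν k ht] at h5 h6
        exact (abs_lt.2 ⟨by linarith, h5⟩).le
    · by_contra! h
      exact hω3 (Set.mem_biUnion (x := (t, r, k)) (by simp [ht, hr]) h)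

end Events


open SIC

variable {K M : ℕ} [NeZero K] {T T₀ : ℕ}

/-! ## Musical Chairs and rank estimation -/

lemma stage_succ (t : ℕ) (ω : Game K M T T₀) (j : Fin M) :
    stage (t + 1) ω j = (step T T₀ (stage t ω j, sums t ω j) ((ω t).2 j).1
      ((ω t).2 j).2 (reward (ω t).1 (pulled t ω) j) (collides (pulled t ω) (pulled t ω j))).1 := rfl

lemma sums_succ (t : ℕ) (ω : Game K M T T₀) (j : Fin M) :
    sums (t + 1) ω j = (step T T₀ (stage t ω j, sums t ω j) ((ω t).2 j).1
      ((ω t).2 j).2 (reward (ω t).1 (pulled t ω) j) (collides (pulled t ω) (pulled t ω j))).2 := rfl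

/-- After the first round `τ` without collision, player `j` stays on her arm. -/
lemma stage_of_not_collides {τ t : ℕ} (ht : τ < t) (htT : t < T₀) (ω : Game K M T T₀) (j : Fin M)
    (h : ∀ s < τ, collides (pulled s ω) (pulled s ω j) = true)
    (hτ : collides (pulled τ ω) (pulled τ ω j) = false) :
    stage t ω j = .chairs t (some (pulled τ ω j)) := by
  induction t, ht using Nat.le_induction with
  | base =>
    rw [stage_succ, stage_of_collides (by omega) ω j h, hτ, pulled_eq,
      stage_of_collides (by omega) ω j h]
    simp [step, htT]
  | succ t ht ih =>
    rw [stage_succ, ih (by omega)]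
    simp [step, htT, pull]

lemma pulled_of_not_collides {τ t : ℕ} (ht : τ ≤ t) (htT : t < T₀) (ω : Game K M T T₀) (j : Fin M)
    (h : ∀ s < τ, collides (pulled s ω) (pulled s ω j) = true)
    (hτ : collides (pulled τ ω) (pulled τ ω j) = false) :
    pulled t ω j = pulled τ ω j := by
  rcases ht.eq_or_lt with rfl | ht
  · rfl
  · rw [pulled_eq t, stage_of_not_collides ht htT ω j h hτ]
    rfl

lemma exists_stage_chairs {t : ℕ} (htT : t < T₀) (ω : Game K M T T₀) (j : Fin M) :
    (∃ x, stage t ω j = .chairs t x) ∧ sums t ω j = 0 := by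
  induction t with
  | zero => exact ⟨⟨none, rfl⟩, rfl⟩
  | succ t ih =>
    obtain ⟨⟨x, hx⟩, hs⟩ := ih (by omega)
    rw [stage_succ, sums_succ, hx, hs]
    simp [step, htT]

/-- Let `τ j` be the first round without collision of `j`. If `τ i ≤ τ j` and both players settled
on the same arm, `i` would already be sitting there in round `τ j` and `j` would have collided. -/
lemma exists_externalRank (hT₀ : 0 < T₀) (ω : Game K M T T₀)
    (hω : ∀ j, ∃ t < T₀, collides (pulled t ω) (pulled t ω j) = false) :
    ∃ k : Fin M → Fin K, Function.Injective k ∧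
      ∀ j, stage T₀ ω j = .estim (k j) 0 1 0 ∧ sums T₀ ω j = 0 := by
  classical
  have h1 : ∀ j, ∃ τ < T₀, (∀ s < τ, collides (pulled s ω) (pulled s ω j) = true) ∧
      collides (pulled τ ω) (pulled τ ω j) = false := fun j => by
    have h := Nat.find_spec (hω j)
    refine ⟨Nat.find (hω j), h.1, fun s hs => ?_, h.2⟩
    have h2 := Nat.find_min (hω j) hs
    simp only [not_and, Bool.not_eq_false] at h2
    exact h2 (hs.trans h.1)
  choose τ hτ1 hτ2 hτ3 using h1
  refine ⟨fun j => pulled (τ j) ω j, fun i j hij => ?_, fun j => ?_⟩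
  · by_contra hne
    wlog h : τ i ≤ τ j generalizing i j
    · exact this j i hij.symm (Ne.symm hne) (by omega)
    have h2 := pulled_of_not_collides h (hτ1 j) ω i (hτ2 i) (hτ3 i)
    have h3 : collides (pulled (τ j) ω) (pulled (τ j) ω j) = true :=
      (collides_iff _ j).2 ⟨i, hne, h2.trans hij⟩
    rw [hτ3 j] at h3
    exact Bool.noConfusion h3
  · obtain ⟨t, rfl⟩ : ∃ t, T₀ = t + 1 := ⟨T₀ - 1, by omega⟩
    obtain ⟨⟨x, hx⟩, hs⟩ := exists_stage_chairs (t := t) (by omega) ω j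
    have h2 := pulled_of_not_collides (t := t) (by have := hτ1 j; omega) (by omega) ω j (hτ2 j)
      (hτ3 j)
    beta_reduce
    rw [← h2, stage_succ, sums_succ, pulled_eq, hx, hs]
    simp [step]

/-- The position of a player of external rank `k` in round `n` of the rank estimation. -/
lemma pull_estim_eq_iff {k k' : Fin K} (hne : k ≠ k') {n : ℕ} (hn : n < 2 * K) (u u' : Fin K)
    (a b a' b' : ℕ) :
    pull u (.estim k n a b) = pull u' (.estim k' n a' b') ↔ k.val + k'.val + 1 = n := by
  have hne' : k.val ≠ k'.val := fun h => hne (Fin.ext h)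
  have hk := k.isLt
  have hk' := k'.isLt
  -- A hopping player is at `n - k - 1` modulo `K`, so two hoppers never meet, nor do two waiting
  -- players. If `k < k'`, the hopper `k` meets the waiting `k'` once, at `n = k + k' + 1`, when
  -- `k'` is still waiting.
  have hv : ∀ (k : Fin K) (u : Fin K) (a b : ℕ), (pull u (.estim k n a b)).val =
      if n < 2 * (k.val + 1) then k.val else
        if n - k.val - 1 < K then n - k.val - 1 else n - k.val - 1 - K := fun k u a b => by
    simp only [pull]
    split_ifs with h1 h2
    · rfl
    · rw [Fin.val_ofNat, Nat.mod_eq_of_lt (by omega)]; omega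
    · rw [Fin.val_ofNat, Nat.mod_eq_sub_mod (by omega), Nat.mod_eq_of_lt (by omega)]; omega
  rw [Fin.ext_iff, hv, hv]
  split_ifs <;> omega

lemma card_filter_lt_succ {ι : Type*} [Fintype ι] (p : ι → Prop) [DecidablePred p] (f : ι → ℕ)
    (hf : Function.Injective f) (n : ℕ) [Decidable (∃ i, p i ∧ f i = n)] :
    (Finset.univ.filter fun i => p i ∧ f i < n + 1).card =
      (Finset.univ.filter fun i => p i ∧ f i < n).card + if ∃ i, p i ∧ f i = n then 1 else 0 := by
  classical
  have h : (Finset.univ.filter fun i => p i ∧ f i < n + 1) =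
      (Finset.univ.filter fun i => p i ∧ f i < n) ∪ Finset.univ.filter fun i => p i ∧ f i = n := by
    ext i
    simp only [Finset.mem_union, Finset.mem_filter, Finset.mem_univ, true_and, Nat.lt_succ_iff_lt_or_eq]
    tauto
  rw [h, Finset.card_union_of_disjoint]
  · congr 1
    split_ifs with h1
    · obtain ⟨i, hi⟩ := h1
      rw [Finset.card_eq_one]
      refine ⟨i, ?_⟩
      ext i'
      simp only [Finset.mem_filter, Finset.mem_univ, true_and, Finset.mem_singleton]
      exact ⟨fun h2 => hf (h2.2.trans hi.2.symm), fun h2 => h2 ▸ hi⟩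
    · rw [Finset.card_eq_zero, Finset.filter_eq_empty_iff]
      exact fun i _ h2 => h1 ⟨i, h2⟩
  · rw [Finset.disjoint_filter]
    intro i _ h1 h2
    omega

lemma collides_estim_iff (ω : Game K M T T₀) {k : Fin M → Fin K} (hk : Function.Injective k)
    {t n : ℕ} (hn : n < 2 * K) {a b : Fin M → ℕ} (h : ∀ j, stage t ω j = .estim (k j) n (a j) (b j))
    (j : Fin M) :
    collides (pulled t ω) (pulled t ω j) = true ↔ ∃ i, i ≠ j ∧ (k i).val + (k j).val + 1 = n := by
  rw [collides_iff]
  refine exists_congr fun i => and_congr_right fun hij => ?_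
  rw [pulled_eq, pulled_eq, h i, h j, pull_estim_eq_iff (hk.ne hij) hn]

/-- Since the meeting times `k i + k j + 1` are distinct for distinct `i`, the two counters are the
numbers of players, respectively of players with smaller external rank, who have already been met.
-/
lemma stage_estim (ω : Game K M T T₀) {k : Fin M → Fin K} (hk : Function.Injective k)
    (h0 : ∀ j, stage T₀ ω j = .estim (k j) 0 1 0 ∧ sums T₀ ω j = 0) {n : ℕ} (hn : n < 2 * K)
    (j : Fin M) :
    stage (T₀ + n) ω j = .estim (k j) n
        (1 + (Finset.univ.filter fun i => i ≠ j ∧ (k i).val + (k j).val + 1 < n).card)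
        (Finset.univ.filter fun i => k i < k j ∧ (k i).val + (k j).val + 1 < n).card ∧
      sums (T₀ + n) ω j = 0 := by
  classical
  induction n generalizing j with
  | zero => simpa using h0 j
  | succ n ih =>
    have ih' := fun j => ih (by omega) j
    have hc := collides_estim_iff ω hk (by omega) (fun j => (ih' j).1) j
    have hinj : Function.Injective fun i => (k i).val + (k j).val + 1 := fun a b hab => by
      simp only at hab; exact hk (Fin.ext (by omega))
    -- A meeting at time `k i + k j + 1` falls within the waiting period `n < 2 (k j + 1)` exactly
    -- when `k i < k j`.
    have hr : (∃ i, k i < k j ∧ (k i).val + (k j).val + 1 = n) ↔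
        collides (pulled (T₀ + n) ω) (pulled (T₀ + n) ω j) = true ∧ n < 2 * ((k j).val + 1) := by
      rw [hc]
      constructor
      · rintro ⟨i, h1, h2⟩
        have h1' : (k i).val < (k j).val := h1
        exact ⟨⟨i, fun h => by subst h; omega, h2⟩, by omega⟩
      · rintro ⟨⟨i, h1, h2⟩, h3⟩
        have h4 : (k i).val ≠ (k j).val := fun h => h1 (hk (Fin.ext h))
        exact ⟨i, show (k i).val < (k j).val by omega, h2⟩
    rw [card_filter_lt_succ _ _ hinj, card_filter_lt_succ _ _ hinj, ← add_assoc T₀, stage_succ,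
      sums_succ, (ih' j).1, (ih' j).2]
    simp only [step, hn, if_true, hr, ← hc, and_true, Stage.estim.injEq, true_and]
    constructor <;> split_ifs <;> omega

/-- The internal rank of a player, from the external ranks. -/
def internalRank (k : Fin M → Fin K) (j : Fin M) : ℕ := (Finset.univ.filter fun i => k i < k j).card

lemma internalRank_lt (k : Fin M → Fin K) (j : Fin M) : internalRank k j < M := by
  have h : (Finset.univ.filter fun i => k i < k j) ⊂ Finset.univ := by
    rw [Finset.ssubset_univ_iff]
    intro h
    have := Finset.mem_univ j
    rw [← h] at this
    simp at this
  simpa [internalRank] using Finset.card_lt_card h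

lemma internalRank_lt_of_lt (k : Fin M → Fin K) {i j : Fin M} (h : k i < k j) :
    internalRank k i < internalRank k j := by
  refine Finset.card_lt_card ⟨fun l => ?_, fun h2 => ?_⟩
  · simp only [Finset.mem_filter, Finset.mem_univ, true_and]
    exact fun h3 => h3.trans h
  · have := h2 (show i ∈ _ by simpa using h)
    simp at this

lemma internalRank_injective {k : Fin M → Fin K} (hk : Function.Injective k) :
    Function.Injective (internalRank k) := by
  intro i j h
  rcases lt_trichotomy (k i) (k j) with h1 | h1 | h1
  · exact absurd h (internalRank_lt_of_lt k h1).ne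
  · exact hk h1
  · exact absurd h (internalRank_lt_of_lt k h1).ne'

/-- Distinct external ranks have `k i + k j + 1 ≤ 2K - 2`, so `2K` rounds suffice for all meetings,
and the counters are then `M` and the internal rank. -/
lemma stage_after_estim (ω : Game K M T T₀) {k : Fin M → Fin K} (hk : Function.Injective k)
    (h0 : ∀ j, stage T₀ ω j = .estim (k j) 0 1 0 ∧ sums T₀ ω j = 0) (j : Fin M) :
    stage (T₀ + 2 * K) ω j = .explore (Mem.first M (internalRank k j)) 0 ∧
      sums (T₀ + 2 * K) ω j = 0 := by
  classical
  have hK : 0 < K := Nat.pos_of_ne_zero (NeZero.ne K)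
  obtain ⟨n, hn⟩ : ∃ n, 2 * K = n + 1 := ⟨2 * K - 1, by omega⟩
  have ih := fun j => stage_estim ω hk h0 (n := n) (by omega) j
  have hc := collides_estim_iff ω hk (by omega) (fun j => (ih j).1) j
  have hinj : Function.Injective fun i => (k i).val + (k j).val + 1 := fun a b hab => by
    simp only at hab; exact hk (Fin.ext (by omega))
  have hcard1 := card_filter_lt_succ (fun i => i ≠ j) _ hinj n
  have hcard2 := card_filter_lt_succ (fun i => k i < k j) _ hinj n
  have hr : ¬ ∃ i, k i < k j ∧ (k i).val + (k j).val + 1 = n := by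
    rintro ⟨i, h1, h2⟩
    have h1' : (k i).val < (k j).val := h1
    have := (k j).isLt
    omega
  have hlt : ∀ i, i ≠ j → (k i).val + (k j).val + 1 < n + 1 := fun i hi => by
    have h4 : (k i).val ≠ (k j).val := fun h => hi (hk (Fin.ext h))
    have := (k i).isLt
    have := (k j).isLt
    omega
  have hM : (Finset.univ.filter fun i => i ≠ j ∧ (k i).val + (k j).val + 1 < n + 1).card + 1 = M := by
    have : (Finset.univ.filter fun i => i ≠ j ∧ (k i).val + (k j).val + 1 < n + 1) =
        Finset.univ.erase j := by
      ext i
      simp only [Finset.mem_filter, Finset.mem_univ, true_and, Finset.mem_erase, and_true]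
      exact ⟨fun h => h.1, fun h => ⟨h, hlt i h⟩⟩
    rw [this, Finset.card_erase_of_mem (Finset.mem_univ j), Finset.card_univ, Fintype.card_fin]
    have := j.pos
    omega
  have hR : (Finset.univ.filter fun i => k i < k j ∧ (k i).val + (k j).val + 1 < n + 1).card =
      internalRank k j := by
    unfold internalRank
    congr 1
    ext i
    simp only [Finset.mem_filter, Finset.mem_univ, true_and]
    exact ⟨fun h => h.1, fun h => ⟨h, hlt i fun h' => by subst h'; exact lt_irrefl _ h⟩⟩
  have hn2 : ¬ n + 1 < 2 * K := by omega
  have hcn : ¬ (collides (pulled (T₀ + n) ω) (pulled (T₀ + n) ω j) = true ∧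
      n < 2 * ((k j).val + 1)) := by
    rintro ⟨h1, h2⟩
    obtain ⟨i, h3, h4⟩ := hc.1 h1
    have h5 : (k i).val ≠ (k j).val := fun h => h3 (hk (Fin.ext h))
    exact hr ⟨i, show (k i).val < (k j).val by omega, h4⟩
  rw [hn, ← add_assoc T₀, stage_succ, sums_succ, (ih j).1, (ih j).2]
  simp only [step, hn2, if_false, hcn, and_true]
  rw [if_neg hr] at hcard2
  simp only [← hc] at hcard1
  congr 2
  · split_ifs at hcard1 ⊢ <;> omega
  · omega

lemma not_explores_of_lt {t : ℕ} (ω : Game K M T T₀) {k : Fin M → Fin K}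
    (hk : Function.Injective k) (h0 : ∀ j, stage T₀ ω j = .estim (k j) 0 1 0 ∧ sums T₀ ω j = 0)
    (ht : t < T₀ + 2 * K) (j : Fin M) (a : Fin K) : ¬ (stage t ω j).Explores a := by
  rcases lt_or_ge t T₀ with h | h
  · obtain ⟨x, hx⟩ := (exists_stage_chairs h ω j).1
    rw [hx]; exact id
  · obtain ⟨n, rfl⟩ := Nat.exists_eq_add_of_le h
    rw [(stage_estim ω hk h0 (by omega) j).1]; exact id


open SIC

variable {K M : ℕ} [NeZero K] {T T₀ : ℕ}

/-! ## Exploration phases -/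

lemma sum_range_mul_mod {R : Type*} [AddCommMonoid R] (l c a : ℕ) (f : ℕ → R) :
    ∑ n ∈ Finset.range (l * c), f ((a + n) % l) = c • ∑ i ∈ Finset.range l, f i := by
  have h1 : ∀ a, ∑ n ∈ Finset.range l, f ((a + n) % l) = ∑ i ∈ Finset.range l, f i := by
    intro a
    induction a with
    | zero =>
      refine Finset.sum_congr rfl fun n hn => ?_
      rw [zero_add, Nat.mod_eq_of_lt (Finset.mem_range.1 hn)]
    | succ a ih =>
      rw [← ih]
      rcases Nat.eq_zero_or_pos l with rfl | hl
      · simp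
      obtain ⟨l, rfl⟩ : ∃ l', l = l' + 1 := ⟨l - 1, by omega⟩
      rw [Finset.sum_range_succ, Finset.sum_range_succ' (fun n => f ((a + n) % (l + 1)))]
      congr 1
      · refine Finset.sum_congr rfl fun n _ => ?_
        congr 2; ring
      · rw [show a + 1 + l = a + (l + 1) by ring, Nat.add_mod_right, add_zero]
  induction c with
  | zero => simp
  | succ c ih =>
    rw [Nat.mul_succ, Finset.sum_range_add, ih, succ_nsmul, ← h1 (a + l * c)]
    congr 1
    refine Finset.sum_congr rfl fun n _ => ?_
    congr 2; ring

lemma sum_range_getD {α R : Type*} [DecidableEq α] [AddCommMonoid R] {l : List α} (hl : l.Nodup)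
    (d : α) (f : α → R) :
    ∑ i ∈ Finset.range l.length, f (l.getD i d) = ∑ k ∈ l.toFinset, f k := by
  rw [List.sum_toFinset f hl, ← Fin.sum_univ_eq_sum_range (fun i => f (l.getD i d)),
    ← Fin.sum_univ_fun_getElem]
  refine Finset.sum_congr rfl fun i _ => ?_
  simp [List.getD_eq_getElem?_getD]

/-- The common knowledge of the active players at the start of a phase, and the arms exploited by
the other players. -/
structure Config (K M : ℕ) where
  /-- the number of the phase -/
  phase : ℕ
  /-- the number of active players -/
  players : ℕ
  /-- the number of exploration pulls of every active arm -/
  pulls : ℕ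
  /-- the active arms -/
  active : List (Fin K)
  /-- the last quantized statistics of every player -/
  quant : Fin M → Fin K → ℕ
  /-- the arms exploited by the inactive players -/
  exploited : Fin M → Fin K

/-- The memory `m` of player `j` agrees with the common knowledge; the statistics of the players of
rank at least `c` are known. -/
structure Agrees (rank : Fin M → ℕ) (C : Config K M) (c : ℕ) (j : Fin M) (m : Mem K) : Prop where
  rank_eq : m.rank = rank j
  phase_eq : m.phase = C.phase
  players_eq : m.players = C.players
  active_eq : m.active = C.active
  pulls_eq : ∀ k ∈ C.active, m.pulls k = C.pulls
  length_eq : m.quant.length = M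
  quant_eq : ∀ i, c ≤ rank i → ∀ k ∈ C.active, m.quant.getD (rank i) 0 k = C.quant i k

/-- The consistency of a configuration. -/
structure Config.Valid (C : Config K M) (rank : Fin M → ℕ) : Prop where
  rank_inj : Function.Injective rank
  rank_lt : ∀ j, rank j < M
  nodup : C.active.Nodup
  players_pos : 0 < C.players
  players_le : C.players ≤ C.active.length
  exploited_notMem : ∀ j, C.players ≤ rank j → C.exploited j ∉ C.active
  exploited_inj : ∀ i j, C.players ≤ rank i → C.players ≤ rank j →
    C.exploited i = C.exploited j → i = j

/-- The arm explored by player `j` in round `n` of a phase. -/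
def Config.arm (C : Config K M) (rank : Fin M → ℕ) (n : ℕ) (j : Fin M) : Fin K :=
  if rank j < C.players then C.active.getD ((rank j + n + 1) % C.active.length) 0
  else C.exploited j

/-- The players are in round `n` of the exploration phase of the configuration `C`. -/
structure Exploring (rank : Fin M → ℕ) (C : Config K M) (m : Fin M → Mem K) (n t : ℕ)
    (ω : Game K M T T₀) : Prop where
  active : ∀ j, rank j < C.players → stage t ω j = .explore (m j) n
  agrees : ∀ j, rank j < C.players → Agrees rank C C.players j (m j)
  inactive : ∀ j, C.players ≤ rank j → stage t ω j = .exploit (C.exploited j)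

section Exploration

variable {rank : Fin M → ℕ} {C : Config K M} {m : Fin M → Mem K} {n t : ℕ} {ω : Game K M T T₀}

lemma getD_mod_mem {l : List (Fin K)} (hl : 0 < l.length) (i : ℕ) : l.getD (i % l.length) 0 ∈ l := by
  have h := Nat.mod_lt i hl
  rw [List.getD_eq_getElem _ _ h]
  exact List.getElem_mem h

lemma getD_inj {l : List (Fin K)} (hl : l.Nodup) {i j : ℕ} (hi : i < l.length) (hj : j < l.length)
    (h : l.getD i 0 = l.getD j 0) : i = j := by
  rw [List.getD_eq_getElem _ _ hi, List.getD_eq_getElem _ _ hj] at h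
  exact (hl.getElem_inj_iff).1 h

lemma Config.Valid.length_pos (hC : C.Valid rank) : 0 < C.active.length :=
  hC.players_pos.trans_le hC.players_le

/-- Active players keep distinct offsets below the length of the cycle, exploited arms are not
active, and they are pairwise distinct. So no collision occurs during exploration. -/
lemma Config.Valid.arm_injective (hC : C.Valid rank) (n : ℕ) :
    Function.Injective (C.arm rank n) := by
  intro i j h
  have hl := hC.length_pos
  unfold Config.arm at h
  split_ifs at h with hi hj hj
  · have h1 := getD_inj hC.nodup (Nat.mod_lt _ hl) (Nat.mod_lt _ hl) h
    have h2 : (rank i + (n + 1)) ≡ (rank j + (n + 1)) [MOD C.active.length] := h1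
    have h3 := Nat.ModEq.add_right_cancel' _ h2
    have h4 := hC.players_le
    exact hC.rank_inj (h3.eq_of_lt_of_lt (by omega) (by omega))
  · exact absurd (h ▸ getD_mod_mem hl _) (hC.exploited_notMem j (by omega))
  · exact absurd (h ▸ getD_mod_mem hl _) (hC.exploited_notMem i (by omega))
  · exact hC.exploited_inj i j (by omega) (by omega) h

lemma Agrees.arm_eq {c : ℕ} {j : Fin M} {m : Mem K} (h : Agrees rank C c j m) (i : ℕ) :
    m.arm i = C.active.getD (i % C.active.length) 0 := by
  rw [Mem.arm, h.active_eq]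

lemma Exploring.pulled_eq (h : Exploring rank C m n t ω) : pulled t ω = C.arm rank n := by
  funext j
  rw [MultiPlayerBandit.pulled_eq]
  unfold Config.arm
  split_ifs with hj
  · rw [h.active j hj, pull, (h.agrees j hj).arm_eq, (h.agrees j hj).rank_eq]
  · rw [h.inactive j (by omega), pull]

lemma collides_of_injective {a : Fin M → Fin K} (ha : Function.Injective a) (j : Fin M) :
    collides a (a j) = false := by
  rw [Bool.eq_false_iff]
  intro h
  obtain ⟨i, h1, h2⟩ := (collides_iff a j).1 h
  exact h1 (ha h2)

lemma reward_of_injective {a : Fin M → Fin K} (ha : Function.Injective a) (x : Fin K → ℝ)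
    (j : Fin M) : reward x a j = x (a j) := by
  simp [reward, collides_of_injective ha]

open Classical in
lemma Exploring.sums_succ (h : Exploring rank C m n t ω) (hC : C.Valid rank) (j : Fin M)
    (k : Fin K) :
    sums (t + 1) ω j k = sums t ω j k +
      if rank j < C.players ∧ C.arm rank n j = k then (ω t).1 k else 0 := by
  have hinj := hC.arm_injective n
  have hp := h.pulled_eq
  have hpj : pull ((ω t).2 j).1 (stage t ω j) = C.arm rank n j := congrFun hp j
  rw [MultiPlayerBandit.sums_succ]
  by_cases hj : rank j < C.players
  · rw [h.active j hj] at hpj ⊢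
    have hr : reward (ω t).1 (pulled t ω) j = (ω t).1 (C.arm rank n j) := by
      rw [hp]; exact reward_of_injective hinj _ j
    simp only [step, hpj, hr, hj, true_and]
    split_ifs with h1 h2 h2 <;>
    · simp only
      first
      | (subst h2; simp)
      | (rw [Function.update_of_ne (Ne.symm h2)]; simp)
  · rw [h.inactive j (by omega)]
    simp [step, hj]

lemma Exploring.succ (h : Exploring rank C m n t ω)
    (hn : n + 1 < C.active.length * 2 ^ C.phase) : Exploring rank C m (n + 1) (t + 1) ω where
  active j hj := by
    have ha := h.agrees j hj
    rw [stage_succ, h.active j hj]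
    simp [step, ha.active_eq, ha.phase_eq, hn]
  agrees := h.agrees
  inactive j hj := by rw [stage_succ, h.inactive j hj]; rfl

lemma Exploring.add (h : Exploring rank C m 0 t ω)
    (hn : n < C.active.length * 2 ^ C.phase) : Exploring rank C m n (t + n) ω := by
  induction n with
  | zero => exact h
  | succ n ih => exact (ih (by omega)).succ hn

lemma Exploring.last (h : Exploring rank C m n t ω)
    (hn : n + 1 = C.active.length * 2 ^ C.phase) (j : Fin M) (hj : rank j < C.players) :
    stage (t + 1) ω j = (m j).startComm T (quantize (sums (t + 1) ω j) ((ω t).2 j).2) := by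
  have ha := h.agrees j hj
  rw [MultiPlayerBandit.sums_succ, stage_succ, h.active j hj]
  simp [step, ha.active_eq, ha.phase_eq, hn]

lemma Exploring.explores_iff (h : Exploring rank C m n t ω) (j : Fin M) (k : Fin K) :
    (stage t ω j).Explores k ↔ rank j < C.players ∧ C.arm rank n j = k := by
  by_cases hj : rank j < C.players
  · rw [h.active j hj, ← h.pulled_eq, MultiPlayerBandit.pulled_eq, h.active j hj]
    simp [Stage.Explores, pull, hj]
  · rw [h.inactive j (by omega)]
    simp [Stage.Explores, hj]

-- As at most one player is on an arm, "some player explores `k`" can be counted player by player.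
-- This links `count` and `deviation` to the individual sums of rewards.
open Classical in
lemma Exploring.ite_explores {R : Type*} [AddCommMonoid R] (h : Exploring rank C m n t ω)
    (hC : C.Valid rank) (k : Fin K) (y : R) :
    (if ∃ j, (stage t ω j).Explores k then y else 0) =
      ∑ j, if rank j < C.players ∧ C.arm rank n j = k then y else 0 := by
  simp only [h.explores_iff]
  split_ifs with h1
  · obtain ⟨j, hj⟩ := h1
    rw [Finset.sum_eq_single j, if_pos hj]
    · intro i _ hi
      rw [if_neg fun h2 => hi (hC.arm_injective n (h2.2.trans hj.2.symm))]
    · simp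
  · refine (Finset.sum_eq_zero fun j _ => if_neg fun h2 => h1 ⟨j, h2⟩).symm

/-- In an exploration phase, each active player pulls each active arm `2 ^ p` times. -/
lemma Config.Valid.sum_arm {R : Type*} [AddCommMonoid R] (hC : C.Valid rank) {j : Fin M}
    (hj : rank j < C.players) (f : Fin K → R) :
    ∑ n ∈ Finset.range (C.active.length * 2 ^ C.phase), f (C.arm rank n j) =
      2 ^ C.phase • ∑ k ∈ C.active.toFinset, f k := by
  rw [← sum_range_getD hC.nodup 0 f, ← sum_range_mul_mod _ _ (rank j + 1)]
  refine Finset.sum_congr rfl fun n _ => ?_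
  rw [Config.arm, if_pos hj]
  congr 3; ring

lemma Config.Valid.image_rank (hC : C.Valid rank) : Finset.univ.image rank = Finset.range M := by
  refine Finset.eq_of_subset_of_card_le (fun x hx => ?_) ?_
  · obtain ⟨j, _, rfl⟩ := Finset.mem_image.1 hx
    exact Finset.mem_range.2 (hC.rank_lt j)
  · rw [Finset.card_image_of_injective _ hC.rank_inj]; simp

lemma Config.Valid.card_players (hC : C.Valid rank) {c : ℕ} (hc : c ≤ M) :
    (Finset.univ.filter fun j => rank j < c).card = c := by
  have h1 := hC.image_rank
  have h2 : (Finset.univ.filter fun j => rank j < c).image rank = Finset.range c := by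
    ext x
    simp only [Finset.mem_image, Finset.mem_filter, Finset.mem_univ, true_and, Finset.mem_range]
    constructor
    · rintro ⟨j, h, rfl⟩; exact h
    · intro hx
      have h3 : x ∈ Finset.univ.image rank := by rw [h1]; exact Finset.mem_range.2 (by omega)
      obtain ⟨j, _, rfl⟩ := Finset.mem_image.1 h3
      exact ⟨j, hx, rfl⟩
  rw [← Finset.card_image_of_injective _ hC.rank_inj, h2, Finset.card_range]

open Classical in
lemma Exploring.sums_add (h : Exploring rank C m 0 t ω) (hC : C.Valid rank)
    (hn : n ≤ C.active.length * 2 ^ C.phase) (j : Fin M) (k : Fin K) :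
    sums (t + n) ω j k = sums t ω j k + ∑ u ∈ Finset.range n,
      if rank j < C.players ∧ C.arm rank u j = k then (ω (t + u)).1 k else 0 := by
  induction n with
  | zero => simp
  | succ n ih =>
    rw [← add_assoc t, (h.add (by omega)).sums_succ hC, ih (by omega), Finset.sum_range_succ,
      add_assoc]

lemma Exploring.count_add (h : Exploring rank C m 0 t ω) (hC : C.Valid rank)
    (hP : C.players ≤ M) {k : Fin K} (hk : k ∈ C.active) :
    count k (t + C.active.length * 2 ^ C.phase) ω = count k t ω + C.players * 2 ^ C.phase := by
  classical
  unfold count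
  rw [Finset.sum_range_add]
  congr 1
  calc _ = ∑ u ∈ Finset.range (C.active.length * 2 ^ C.phase),
        ∑ j ∈ Finset.univ.filter (fun j => rank j < C.players),
          if C.arm rank u j = k then 1 else 0 := by
        refine Finset.sum_congr rfl fun u hu => ?_
        rw [(h.add (Finset.mem_range.1 hu)).ite_explores hC k 1, Finset.sum_filter]
        exact Finset.sum_congr rfl fun j _ => by split_ifs <;> simp_all
    _ = ∑ j ∈ Finset.univ.filter (fun j => rank j < C.players), 2 ^ C.phase := by
        rw [Finset.sum_comm]
        refine Finset.sum_congr rfl fun j hj => ?_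
        rw [hC.sum_arm (Finset.mem_filter.1 hj).2 (fun a => if a = k then 1 else 0)]
        simp [hk]
    _ = _ := by rw [Finset.sum_const, hC.card_players hP, smul_eq_mul]

lemma Exploring.deviation_add (h : Exploring rank C m 0 t ω) (hC : C.Valid rank)
    (hP : C.players ≤ M) {k : Fin K} (hk : k ∈ C.active) (ν : Fin K → Measure ℝ) :
    deviation ν k (t + C.active.length * 2 ^ C.phase) ω = deviation ν k t ω +
      (∑ j, (sums (t + C.active.length * 2 ^ C.phase) ω j k - sums t ω j k)) -
      means ν k * (C.players * 2 ^ C.phase : ℕ) := by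
  classical
  have hcount := h.count_add hC hP hk
  unfold count at hcount
  rw [Finset.sum_range_add, add_right_inj] at hcount
  rw [← hcount]
  unfold deviation
  rw [Finset.sum_range_add, add_sub_assoc]
  congr 1
  push_cast
  simp only [h.sums_add hC le_rfl, add_sub_cancel_left]
  rw [Finset.sum_comm, Finset.mul_sum, ← Finset.sum_sub_distrib]
  refine Finset.sum_congr rfl fun u hu => ?_
  rw [← (h.add (Finset.mem_range.1 hu)).ite_explores hC k ((ω (t + u)).1 k)]
  split_ifs <;> simp

lemma Exploring.sums_add_mem (h : Exploring rank C m 0 t ω) (hC : C.Valid rank)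
    (hx : ∀ t k, (ω t).1 k ∈ Set.Icc (0 : ℝ) 1) {k : Fin K} (hk : k ∈ C.active) (j : Fin M) :
    sums t ω j k ≤ sums (t + C.active.length * 2 ^ C.phase) ω j k ∧
      sums (t + C.active.length * 2 ^ C.phase) ω j k ≤ sums t ω j k + 2 ^ C.phase := by
  classical
  rw [h.sums_add hC le_rfl]
  constructor
  · refine le_add_of_nonneg_right (Finset.sum_nonneg fun u _ => ?_)
    split_ifs
    · exact (hx _ _).1
    · exact le_rfl
  · gcongr
    by_cases hj : rank j < C.players
    · simp only [hj, true_and]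
      calc _ ≤ ∑ u ∈ Finset.range (C.active.length * 2 ^ C.phase),
            (if C.arm rank u j = k then 1 else 0 : ℝ) := by
            refine Finset.sum_le_sum fun u _ => ?_
            split_ifs
            · exact (hx _ _).2
            · exact le_rfl
        _ = 2 ^ C.phase := by
            rw [hC.sum_arm hj (fun a => if a = k then 1 else 0 : Fin K → ℝ)]
            simp [hk]
    · simp [hj]

/-- The pseudo-regret of an exploration phase is the sum of the gaps between the good and the bad
active arms. -/
lemma Exploring.sum_reward (h : Exploring rank C m 0 t ω) (hC : C.Valid rank)
    (hP : C.players ≤ M) (μ : Fin K → ℝ) :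
    ∑ u ∈ Finset.range (C.active.length * 2 ^ C.phase), ∑ j, reward μ (pulled (t + u) ω) j =
      2 ^ C.phase * (C.players * ∑ k ∈ C.active.toFinset, μ k) +
        C.active.length * 2 ^ C.phase *
          ∑ j ∈ Finset.univ.filter (fun j => C.players ≤ rank j), μ (C.exploited j) := by
  calc _ = ∑ u ∈ Finset.range (C.active.length * 2 ^ C.phase),
        (∑ j ∈ Finset.univ.filter (fun j => rank j < C.players), μ (C.arm rank u j) +
          ∑ j ∈ Finset.univ.filter (fun j => C.players ≤ rank j), μ (C.exploited j)) := by
        refine Finset.sum_congr rfl fun u hu => ?_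
        have hu' := h.add (Finset.mem_range.1 hu)
        simp only [hu'.pulled_eq, reward_of_injective (hC.arm_injective u)]
        rw [← Finset.sum_filter_add_sum_filter_not Finset.univ (fun j => rank j < C.players)]
        simp only [not_lt]
        congr 1
        refine Finset.sum_congr rfl fun j hj => ?_
        rw [Config.arm, if_neg (by simpa using hj)]
    _ = _ := by
        rw [Finset.sum_add_distrib, Finset.sum_comm, Finset.sum_congr rfl fun j hj =>
          hC.sum_arm (Finset.mem_filter.1 hj).2 μ]
        rw [Finset.sum_const, Finset.sum_const, hC.card_players hP, Finset.card_range]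
        simp only [nsmul_eq_mul]
        push_cast
        ring

end Exploration


open SIC

variable {K M : ℕ} [NeZero K] {T T₀ : ℕ}

/-! ## Communication phases -/

/-- No player explores in the `l` rounds from round `t` on. -/
structure Quiet (t l : ℕ) (ω : Game K M T T₀) : Prop where
  sums_eq : sums (t + l) ω = sums t ω
  not_explores : ∀ u < l, ∀ j a, ¬ (stage (t + u) ω j).Explores a

lemma Quiet.zero (t : ℕ) (ω : Game K M T T₀) : Quiet t 0 ω := ⟨rfl, fun _ h => absurd h (by omega)⟩

lemma Quiet.trans {t l l' : ℕ} {ω : Game K M T T₀} (h : Quiet t l ω) (h' : Quiet (t + l) l' ω) :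
    Quiet t (l + l') ω := by
  refine ⟨by rw [← add_assoc, h'.sums_eq, h.sums_eq], fun u hu j a => ?_⟩
  rcases lt_or_ge u l with hl | hl
  · exact h.not_explores u hl j a
  · have := h'.not_explores (u - l) (by omega) j a
    rwa [add_assoc, Nat.add_sub_cancel' hl] at this

lemma Quiet.count_eq {t l : ℕ} {ω : Game K M T T₀} (h : Quiet t l ω) (k : Fin K) :
    count k (t + l) ω = count k t ω := by
  unfold count
  rw [Finset.sum_range_add, add_eq_left]
  refine Finset.sum_eq_zero fun u hu => if_neg ?_
  rintro ⟨j, hj⟩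
  exact h.not_explores u (Finset.mem_range.1 hu) j k hj

lemma Quiet.deviation_eq {t l : ℕ} {ω : Game K M T T₀} (h : Quiet t l ω) (ν : Fin K → Measure ℝ)
    (k : Fin K) : deviation ν k (t + l) ω = deviation ν k t ω := by
  unfold deviation
  rw [Finset.sum_range_add, add_eq_left]
  refine Finset.sum_eq_zero fun u hu => if_neg ?_
  rintro ⟨j, hj⟩
  exact h.not_explores u (Finset.mem_range.1 hu) j k hj

lemma getD_modify {α : Type*} (l : List α) (f : α → α) {i : ℕ} (hi : i < l.length) (i' : ℕ) (d : α) :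
    (l.modify i f).getD i' d = if i' = i then f (l.getD i d) else l.getD i' d := by
  split_ifs with h
  · subst h; simp [List.getD_eq_getElem?_getD, hi]
  · simp [List.getD_eq_getElem?_getD, Ne.symm h]

lemma getD_set {α : Type*} (l : List α) (x : α) {i : ℕ} (hi : i < l.length) (i' : ℕ) (d : α) :
    (l.set i x).getD i' d = if i' = i then x else l.getD i' d := by
  split_ifs with h
  · subst h; simp [List.getD_eq_getElem?_getD, hi]
  · simp [List.getD_eq_getElem?_getD, Ne.symm h]

/-- The stage of a player who has to perform the transmissions `todo`. -/
noncomputable def commStage (T : ℕ) (m : Mem K) (q : Fin K → ℕ) :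
    List (ℕ × ℕ × Fin K) → Stage K
  | [] => m.finishPhase T
  | x :: todo => .comm m q (x :: todo) 0

lemma startComm_eq (T : ℕ) (m : Mem K) (q : Fin K → ℕ) :
    m.startComm T q = commStage T { m with quant := m.quant.set m.rank q } q
      (Mem.schedule { m with quant := m.quant.set m.rank q }) := by
  rcases h : Mem.schedule { m with quant := m.quant.set m.rank q } with _ | ⟨x, todo⟩ <;>
    simp only [Mem.startComm, h, commStage]

section Communication

variable {rank : Fin M → ℕ} {C : Config K M} {q : Fin M → Fin K → ℕ}
  {todo : List (ℕ × ℕ × Fin K)}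

/-- The memory of player `j` when the transmissions `todo` are still to be completed and `q` are
the statistics of the active players. -/
structure Informed (rank : Fin M → ℕ) (C : Config K M) (q : Fin M → Fin K → ℕ)
    (todo : List (ℕ × ℕ × Fin K)) (j : Fin M) (m : Mem K) : Prop
    extends Agrees rank C C.players j m where
  own_eq : m.quant.getD (rank j) 0 = q j
  known_eq : ∀ i, rank i < C.players → i ≠ j → ∀ k ∈ C.active, (rank i, rank j, k) ∉ todo →
    m.quant.getD (rank i) 0 k = q i k

lemma Informed.receive {i j : Fin M} {m : Mem K} (h : Informed rank C q todo j m)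
    (hC : C.Valid rank) (hi : rank i < C.players) (hij : i ≠ j) {k : Fin K}
    (hk : (rank i, rank j, k) ∈ todo) (n : ℕ) (b : Bool) :
    Informed rank C q todo j (m.receive (rank i) k n b) := by
  have hlen : rank i < m.quant.length := by rw [h.length_eq]; exact hC.rank_lt i
  refine ⟨⟨h.rank_eq, h.phase_eq, h.players_eq, h.active_eq, h.pulls_eq, ?_, ?_⟩, ?_, ?_⟩
  · simp [Mem.receive, h.length_eq]
  · intro i' hi' k' hk'
    rw [Mem.receive, getD_modify _ _ hlen, if_neg (by omega)]
    exact h.quant_eq i' hi' k' hk'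
  · rw [Mem.receive, getD_modify _ _ hlen, if_neg fun h' => hij (hC.rank_inj h').symm]
    exact h.own_eq
  · intro i' hi' hij' k' hk' hn
    rw [Mem.receive, getD_modify _ _ hlen]
    by_cases h1 : rank i' = rank i
    · rw [if_pos h1]
      have h2 : k' ≠ k := fun h2 => hn (by rw [h1, h2]; exact hk)
      rw [Function.update_of_ne h2, ← h1]
      exact h.known_eq i' hi' hij' k' hk' hn
    · rw [if_neg h1]
      exact h.known_eq i' hi' hij' k' hk' hn

/-- Digits arrive lowest first, so after `n` of them the stored number is `x % 2 ^ n`. Nothing is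
required at `n = 0`, because the first reception overwrites the statistic of the previous phase. -/
lemma receive_getD {i : ℕ} {m : Mem K} (hi : i < m.quant.length) (k : Fin K) (n : ℕ) {x : ℕ}
    (h : n ≠ 0 → m.quant.getD i 0 k = x % 2 ^ n) :
    (m.receive i k n (x.testBit n)).quant.getD i 0 k = x % 2 ^ (n + 1) := by
  rw [Mem.receive, getD_modify _ _ hi, if_pos rfl, Function.update_self, Nat.mod_pow_succ, Nat.testBit_eq_decide_div_mod_eq]
  have hb : (if decide (x / 2 ^ n % 2 = 1) = true then 2 ^ n else 0) = 2 ^ n * (x / 2 ^ n % 2) := by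
    rcases Nat.mod_two_eq_zero_or_one (x / 2 ^ n) with h | h <;> simp [h]
  rw [hb]
  congr 1
  split_ifs with hn
  · subst hn; simp [Nat.mod_one]
  · exact h hn

/-- The players are in round `n` of the transmission of the statistic of arm `k` from player `i` to
player `l`. -/
structure Transmitting (rank : Fin M → ℕ) (C : Config K M) (q : Fin M → Fin K → ℕ) (i l : Fin M)
    (k : Fin K) (todo : List (ℕ × ℕ × Fin K)) (m : Fin M → Mem K) (n t : ℕ) (ω : Game K M T T₀) :
    Prop where
  active : ∀ j, rank j < C.players →
    stage t ω j = .comm (m j) (q j) ((rank i, rank l, k) :: todo) n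
  informed : ∀ j, rank j < C.players → Informed rank C q ((rank i, rank l, k) :: todo) j (m j)
  received : n ≠ 0 → (m l).quant.getD (rank i) 0 k = q i k % 2 ^ n
  inactive : ∀ j, C.players ≤ rank j → stage t ω j = .exploit (C.exploited j)

/-- The players have to perform the transmissions `todo`. -/
structure Communicating (rank : Fin M → ℕ) (C : Config K M) (q : Fin M → Fin K → ℕ)
    (todo : List (ℕ × ℕ × Fin K)) (m : Fin M → Mem K) (t : ℕ) (ω : Game K M T T₀) : Prop where
  active : ∀ j, rank j < C.players → stage t ω j = commStage T (m j) (q j) todo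
  informed : ∀ j, rank j < C.players → Informed rank C q todo j (m j)
  inactive : ∀ j, C.players ≤ rank j → stage t ω j = .exploit (C.exploited j)

variable {i l : Fin M} {k : Fin K} {m : Fin M → Mem K} {n t : ℕ} {ω : Game K M T T₀}

/-- All active players except possibly the sender sit on the arm of their own rank, and exploiting
players sit on inactive arms. Hence only the sender can hit the receiver, and does so exactly for
the bit one. -/
lemma Transmitting.collides_iff (h : Transmitting rank C q i l k todo m n t ω) (hC : C.Valid rank)
    (hi : rank i < C.players) (hl : rank l < C.players) (hil : i ≠ l) :
    collides (pulled t ω) (pulled t ω l) = (q i k).testBit n := by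
  have hlen := hC.players_le
  have harm : ∀ j, rank j < C.players → ∀ r < C.players, (m j).arm r = C.active.getD r 0 :=
    fun j hj r hr => by
      rw [(h.informed j hj).toAgrees.arm_eq, Nat.mod_eq_of_lt (by omega)]
  have hp : ∀ j, rank j < C.players → pulled t ω j =
      if i = j ∧ (q j k).testBit n = true then C.active.getD (rank l) 0
      else C.active.getD (rank j) 0 := fun j hj => by
    rw [MultiPlayerBandit.pulled_eq, h.active j hj, pull, (h.informed j hj).rank_eq,
      harm j hj _ hl, harm j hj _ hj]
    simp only [hC.rank_inj.eq_iff]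
  have hpl : pulled t ω l = C.active.getD (rank l) 0 := by
    rw [hp l hl, if_neg fun h' => hil h'.1]
  rw [Bool.eq_iff_iff, MultiPlayerBandit.collides_iff]
  constructor
  · rintro ⟨j, hjl, hj⟩
    rw [hpl] at hj
    rcases lt_or_ge (rank j) C.players with h1 | h1
    · rw [hp j h1] at hj
      split_ifs at hj with h2
      · rw [h2.1]; exact h2.2
      · exact absurd (hC.rank_inj (getD_inj hC.nodup (by omega) (by omega) hj)) hjl
    · rw [MultiPlayerBandit.pulled_eq, h.inactive j h1, pull] at hj
      have h2 := getD_mod_mem hC.length_pos (rank l)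
      rw [Nat.mod_eq_of_lt (by omega), ← hj] at h2
      exact absurd h2 (hC.exploited_notMem j h1)
  · intro hb
    exact ⟨i, hil, by rw [hpl, hp i hi, if_pos ⟨rfl, hb⟩]⟩

/-- The memory of player `j` after the reception of a bit. -/
noncomputable def bitMem (rank : Fin M → ℕ) (q : Fin M → Fin K → ℕ) (i l : Fin M) (k : Fin K)
    (m : Fin M → Mem K) (n : ℕ) (j : Fin M) : Mem K :=
  if j = l then (m j).receive (rank i) k n ((q i k).testBit n) else m j

lemma Transmitting.informed_bitMem (h : Transmitting rank C q i l k todo m n t ω)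
    (hC : C.Valid rank) (hi : rank i < C.players) (hil : i ≠ l)
    (j : Fin M) (hj : rank j < C.players) :
    Informed rank C q ((rank i, rank l, k) :: todo) j (bitMem rank q i l k m n j) := by
  unfold bitMem
  split_ifs with hjl
  · subst hjl
    exact (h.informed j hj).receive hC hi hil (by simp) _ _
  · exact h.informed j hj

lemma Transmitting.bitMem_getD (h : Transmitting rank C q i l k todo m n t ω) (hC : C.Valid rank)
    (hl : rank l < C.players) :
    (bitMem rank q i l k m n l).quant.getD (rank i) 0 k = q i k % 2 ^ (n + 1) := by
  rw [bitMem, if_pos rfl]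
  refine receive_getD ?_ k n h.received
  rw [(h.informed l hl).length_eq]
  exact hC.rank_lt i

lemma Transmitting.step_eq (h : Transmitting rank C q i l k todo m n t ω) (hC : C.Valid rank)
    (hi : rank i < C.players) (hl : rank l < C.players) (hil : i ≠ l) (j : Fin M)
    (hj : rank j < C.players) :
    stage (t + 1) ω j =
      if n < C.phase then .comm (bitMem rank q i l k m n j) (q j) ((rank i, rank l, k) :: todo) (n + 1)
      else commStage T (bitMem rank q i l k m n j) (q j) todo := by
  have hI := h.informed j hj
  have hm : (if rank l = (m j).rank then (m j).receive (rank i) k n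
      (collides (pulled t ω) (pulled t ω j)) else m j) = bitMem rank q i l k m n j := by
    unfold bitMem
    rw [hI.rank_eq]
    by_cases hjl : j = l
    · subst hjl
      rw [h.collides_iff hC hi hl hil]
      simp
    · rw [if_neg hjl, if_neg fun h' => hjl (hC.rank_inj h').symm]
  rw [stage_succ, h.active j hj]
  rcases todo with _ | ⟨x, todo⟩ <;> simp only [step, hm, hI.phase_eq, commStage] <;>
    split_ifs <;> rfl

lemma Transmitting.quiet (h : Transmitting rank C q i l k todo m n t ω) : Quiet t 1 ω := by
  have hst : ∀ j, (∃ m q x td, stage t ω j = .comm m q (x :: td) n) ∨ ∃ a, stage t ω j = .exploit a :=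
    fun j => by
      rcases lt_or_ge (rank j) C.players with hj | hj
      · exact .inl ⟨_, _, _, _, h.active j hj⟩
      · exact .inr ⟨_, h.inactive j hj⟩
  constructor
  · funext j
    rw [sums_succ]
    rcases hst j with ⟨m, q, ⟨x, y, z⟩, td, hx⟩ | ⟨a, ha⟩
    · rw [hx]
      rcases td with _ | ⟨w, td⟩ <;> simp only [step] <;> split_ifs <;> rfl
    · rw [ha]; rfl
  · intro u hu j a
    obtain rfl : u = 0 := by omega
    rw [add_zero]
    rcases hst j with ⟨m, q, x, td, hx⟩ | ⟨a, ha⟩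
    · rw [hx]; exact id
    · rw [ha]; exact id

lemma Transmitting.advance (h : Transmitting rank C q i l k todo m 0 t ω) (hC : C.Valid rank)
    (hi : rank i < C.players) (hl : rank l < C.players) (hil : i ≠ l) (hn : n ≤ C.phase) :
    ∃ m', Transmitting rank C q i l k todo m' n (t + n) ω ∧ Quiet t n ω := by
  induction n with
  | zero => exact ⟨m, h, Quiet.zero t ω⟩
  | succ n ih =>
    obtain ⟨m', h', hQ⟩ := ih (by omega)
    refine ⟨bitMem rank q i l k m' n, ⟨fun j hj => ?_, h'.informed_bitMem hC hi hil,
      fun _ => h'.bitMem_getD hC hl, fun j hj => ?_⟩, hQ.trans h'.quiet⟩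
    · rw [← add_assoc, h'.step_eq hC hi hl hil j hj, if_pos (by omega)]
    · rw [← add_assoc, stage_succ, h'.inactive j hj]; rfl

lemma Communicating.transmit
    (h : Communicating rank C q ((rank i, rank l, k) :: todo) m t ω) (hC : C.Valid rank)
    (hi : rank i < C.players) (hl : rank l < C.players) (hil : i ≠ l)
    (hq : q i k < 2 ^ (C.phase + 1)) :
    ∃ m', Communicating rank C q todo m' (t + (C.phase + 1)) ω ∧ Quiet t (C.phase + 1) ω := by
  have h0 : Transmitting rank C q i l k todo m 0 t ω :=
    ⟨h.active, h.informed, fun h => absurd rfl h, h.inactive⟩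
  obtain ⟨m', h', hQ⟩ := h0.advance hC hi hl hil (n := C.phase) le_rfl
  refine ⟨bitMem rank q i l k m' C.phase, ⟨fun j hj => ?_, fun j hj => ?_, fun j hj => ?_⟩,
    hQ.trans h'.quiet⟩
  · rw [← add_assoc, h'.step_eq hC hi hl hil j hj, if_neg (by omega)]
  · have hI := h'.informed_bitMem hC hi hil j hj
    refine ⟨hI.toAgrees, hI.own_eq, fun i' hi' hij' k' hk' hn => ?_⟩
    by_cases heq : (rank i', rank j, k') = (rank i, rank l, k)
    · simp only [Prod.mk.injEq] at heq
      obtain ⟨h1, h2, rfl⟩ := heq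
      obtain rfl := hC.rank_inj h1
      obtain rfl := hC.rank_inj h2
      -- The statistic has at most `p + 1` binary digits, so nothing is truncated.
      rw [h'.bitMem_getD hC hl, Nat.mod_eq_of_lt hq]
    · exact hI.known_eq i' hi' hij' k' hk' (by simp [heq, hn])
  · rw [← add_assoc, stage_succ, h'.inactive j hj]; rfl

lemma Communicating.finish (hC : C.Valid rank) (hP : C.players ≤ M)
    (hq : ∀ j, rank j < C.players → ∀ k ∈ C.active, q j k < 2 ^ (C.phase + 1))
    (h : Communicating rank C q todo m t ω)
    (htodo : ∀ x ∈ todo, x.1 < C.players ∧ x.2.1 < C.players ∧ x.1 ≠ x.2.1 ∧ x.2.2 ∈ C.active) :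
    ∃ m', Communicating rank C q [] m' (t + (C.phase + 1) * todo.length) ω ∧
      Quiet t ((C.phase + 1) * todo.length) ω := by
  have hplayer : ∀ r < C.players, ∃ j, rank j = r := fun r hr => by
    have h2 : r ∈ Finset.univ.image rank := by rw [hC.image_rank, Finset.mem_range]; omega
    simpa using h2
  induction todo generalizing m t with
  | nil => exact ⟨m, by simpa using h, by simpa using Quiet.zero t ω⟩
  | cons x todo ih =>
    obtain ⟨r, s, k⟩ := x
    obtain ⟨h1, h2, h3, h4⟩ := htodo (r, s, k) (by simp)
    obtain ⟨i, rfl⟩ := hplayer r h1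
    obtain ⟨l, rfl⟩ := hplayer s h2
    obtain ⟨m', h', hQ⟩ := h.transmit hC h1 h2 (fun h' => h3 (by rw [h'])) (hq i h1 k h4)
    obtain ⟨m'', h'', hQ'⟩ := ih h' fun x hx => htodo x (by simp [hx])
    refine ⟨m'', ?_, ?_⟩
    · convert h'' using 1
      simp only [List.length_cons]; ring
    · convert hQ.trans hQ' using 1
      simp only [List.length_cons]; ring

lemma mem_schedule {m : Mem K} {x : ℕ × ℕ × Fin K} :
    x ∈ m.schedule ↔ x.1 < m.players ∧ x.2.1 < m.players ∧ x.1 ≠ x.2.1 ∧ x.2.2 ∈ m.active := by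
  obtain ⟨i, l, k⟩ := x
  simp only [Mem.schedule, List.mem_flatMap, List.mem_range, List.mem_filter, List.mem_map,
    Prod.mk.injEq, decide_eq_true_eq]
  constructor
  · rintro ⟨i', h1, l', ⟨h2, h3⟩, k', h4, rfl, rfl, rfl⟩
    exact ⟨h1, h2, h3, h4⟩
  · rintro ⟨h1, h2, h3, h4⟩
    exact ⟨i, h1, l, ⟨h2, h3⟩, k, h4, rfl, rfl, rfl⟩

lemma length_schedule_le (m : Mem K) :
    m.schedule.length ≤ m.players * (m.players * m.active.length) := by
  have h1 : ∀ i, (((List.range m.players).filter fun l => decide (i ≠ l)).flatMap fun l =>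
      m.active.map fun k => (i, l, k)).length ≤ m.players * m.active.length := fun i => by
    rw [List.length_flatMap]
    simp only [List.length_map, List.map_const', List.sum_replicate, smul_eq_mul]
    gcongr
    exact (List.length_filter_le _ _).trans (by simp)
  rw [Mem.schedule, List.length_flatMap]
  refine (List.sum_le_card_nsmul _ (m.players * m.active.length) fun x hx => ?_).trans (by simp)
  obtain ⟨i, _, rfl⟩ := List.mem_map.1 hx
  exact h1 i

/-- The configuration after a communication phase with the statistics `q`. -/
def Config.learn (C : Config K M) (rank : Fin M → ℕ) (q : Fin M → Fin K → ℕ) : Config K M :=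
  { C with quant := fun j => if rank j < C.players then q j else C.quant j }

/-- The communication phase: all the players who are still active end up with the same
statistics. -/
lemma communicate (hC : C.Valid rank) (hP : C.players ≤ M)
    (hq : ∀ j, rank j < C.players → ∀ k ∈ C.active, q j k < 2 ^ (C.phase + 1))
    (hactive : ∀ j, rank j < C.players → stage t ω j = (m j).startComm T (q j))
    (hagrees : ∀ j, rank j < C.players → Agrees rank C C.players j (m j))
    (hinactive : ∀ j, C.players ≤ rank j → stage t ω j = .exploit (C.exploited j)) :
    ∃ (l : ℕ) (m' : Fin M → Mem K), l ≤ (C.phase + 1) * (C.players * (C.players * C.active.length)) ∧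
      Quiet t l ω ∧
      (∀ j, rank j < C.players → stage (t + l) ω j = (m' j).finishPhase T ∧
        Agrees rank (C.learn rank q) 0 j (m' j)) ∧
      ∀ j, C.players ≤ rank j → stage (t + l) ω j = .exploit (C.exploited j) := by
  -- The schedule depends only on the number of active players and on the active arms; the other
  -- fields of this memory are dummies.
  let todo := Mem.schedule (K := K) ⟨0, 0, 0, C.players, C.active, [], 0⟩
  let m₁ : Fin M → Mem K := fun j => { m j with quant := (m j).quant.set (m j).rank (q j) }
  have hsched : ∀ j, rank j < C.players → (m₁ j).schedule = todo := fun j hj => by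
    simp only [todo, m₁, Mem.schedule, (hagrees j hj).players_eq, (hagrees j hj).active_eq]
  have hcomm : Communicating rank C q todo m₁ t ω := by
    refine ⟨fun j hj => ?_, fun j hj => ?_, hinactive⟩
    · rw [hactive j hj, startComm_eq, ← hsched j hj]
    · have ha := hagrees j hj
      have hlt : rank j < (m j).quant.length := by rw [ha.length_eq]; exact hC.rank_lt j
      refine ⟨⟨ha.rank_eq, ha.phase_eq, ha.players_eq, ha.active_eq, ha.pulls_eq, ?_, ?_⟩, ?_, ?_⟩
      · simp [m₁, ha.length_eq]
      · intro i hi k hk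
        simp only [m₁, ha.rank_eq]
        rw [getD_set _ _ hlt, if_neg (by omega)]
        exact ha.quant_eq i hi k hk
      · simp only [m₁, ha.rank_eq]
        rw [getD_set _ _ hlt, if_pos rfl]
      · intro i hi hij k hk hn
        -- At the start every foreign statistic is still scheduled, so nothing has to be known yet.
        refine absurd (mem_schedule.2 ⟨hi, hj, fun h => hij (hC.rank_inj h), hk⟩) hn
  obtain ⟨m', h', hQ⟩ := hcomm.finish hC hP hq fun x hx => mem_schedule.1 hx
  refine ⟨_, m', Nat.mul_le_mul_left _ (length_schedule_le _), hQ, fun j hj =>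
    ⟨h'.active j hj, ?_⟩, h'.inactive⟩
  have hI := h'.informed j hj
  refine ⟨hI.rank_eq, hI.phase_eq, hI.players_eq, hI.active_eq, hI.pulls_eq, hI.length_eq,
    fun i _ k hk => ?_⟩
  simp only [Config.learn]
  split_ifs with hi
  · by_cases hij : i = j
    · subst hij; rw [hI.own_eq]
    · exact hI.known_eq i hi hij k hk (by simp)
  · exact hI.quant_eq i (by omega) k hk

end Communication


open SIC

variable {K M : ℕ} [NeZero K] {T T₀ : ℕ}

/-! ## The update of the active arms and players -/

namespace Config

/-- The number of pulls of the active arms after the phase. -/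
def newPulls (C : Config K M) : ℕ := C.pulls + C.players * 2 ^ C.phase

/-- The empirical mean of an active arm after the phase. -/
noncomputable def mean (C : Config K M) (k : Fin K) : ℝ :=
  ((∑ j, C.quant j k : ℕ) : ℝ) / C.newPulls

/-- Arm `i` is better than arm `k` with confidence. -/
def Better (T : ℕ) (C : Config K M) (i k : Fin K) : Prop :=
  C.mean i - radius T C.newPulls ≥ C.mean k + radius T C.newPulls

open Classical in
/-- The accepted arms. -/
noncomputable def accepted (T : ℕ) (C : Config K M) : List (Fin K) :=
  C.active.filter fun k =>
    decide (C.active.countP (fun i => decide (C.Better T k i)) + C.players ≥ C.active.length)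

open Classical in
/-- The rejected arms. -/
noncomputable def rejected (T : ℕ) (C : Config K M) : List (Fin K) :=
  C.active.filter fun k =>
    decide (C.active.countP (fun i => decide (C.Better T i k)) ≥ C.players)

/-- The configuration at the start of the next phase. -/
noncomputable def next (T : ℕ) (C : Config K M) (rank : Fin M → ℕ) : Config K M where
  phase := C.phase + 1
  players := C.players - (C.accepted T).length
  pulls := C.newPulls
  active := C.active.filter fun k => decide (k ∉ C.accepted T ∧ k ∉ C.rejected T)
  quant := C.quant
  exploited j := if rank j < C.players then (C.accepted T).getD (C.players - rank j - 1) 0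
    else C.exploited j

end Config

section Update

variable {rank : Fin M → ℕ} {C : Config K M}

lemma Agrees.sum_quant {j : Fin M} {m : Mem K} (h : Agrees rank C 0 j m) (hC : C.Valid rank)
    {k : Fin K} (hk : k ∈ C.active) :
    (m.quant.map fun f => f k).sum = ∑ j, C.quant j k := by
  have h1 : (m.quant.map fun f => f k).sum = ∑ i ∈ Finset.range M, m.quant.getD i 0 k := by
    rw [← h.length_eq, ← Fin.sum_univ_eq_sum_range (fun i => m.quant.getD i 0 k),
      ← Fin.sum_univ_fun_getElem]
    refine Finset.sum_congr rfl fun i _ => ?_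
    simp [List.getD_eq_getElem?_getD]
  rw [h1, ← hC.image_rank, Finset.sum_image fun i _ i' _ hii => hC.rank_inj hii]
  exact Finset.sum_congr rfl fun i _ => h.quant_eq i (by omega) k hk

/-- The update is a function of data shared by all the active players. Each of them therefore
computes the same accepted and rejected arms as the configuration, and only the rank decides who
leaves. -/
lemma Agrees.finishPhase_eq {j : Fin M} {m : Mem K} (h : Agrees rank C 0 j m) (hC : C.Valid rank)
    (hj : rank j < C.players) :
    ((C.next T rank).players ≤ rank j → m.finishPhase T = .exploit ((C.next T rank).exploited j)) ∧
    (rank j < (C.next T rank).players → ∃ m', m.finishPhase T = .explore m' 0 ∧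
      Agrees rank (C.next T rank) (C.next T rank).players j m') := by
  classical
  let pulls : Fin K → ℕ := fun k =>
    if k ∈ m.active then m.pulls k + m.players * 2 ^ m.phase else m.pulls k
  let mean : Fin K → ℝ := fun k => (((m.quant.map fun f => f k).sum : ℕ) : ℝ) / pulls k
  have hpulls : ∀ k ∈ C.active, pulls k = C.newPulls := fun k hk => by
    simp only [pulls, h.active_eq, hk, if_true, h.pulls_eq k hk, h.players_eq, h.phase_eq]
    rfl
  have hmean : ∀ k ∈ C.active, mean k = C.mean k := fun k hk => by
    simp only [mean, h.sum_quant hC hk, hpulls k hk, Config.mean]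
  have hb : ∀ i ∈ C.active, ∀ k ∈ C.active,
      decide (mean i - radius T (pulls i) ≥ mean k + radius T (pulls k)) =
        decide (C.Better T i k) := fun i hi k hk => by
    rw [decide_eq_decide, hmean i hi, hmean k hk, hpulls i hi, hpulls k hk, Config.Better]
  have hacc : m.active.filter (fun k => decide (m.active.countP (fun i =>
      decide (mean k - radius T (pulls k) ≥ mean i + radius T (pulls i))) + m.players ≥
        m.active.length)) = C.accepted T := by
    rw [h.active_eq, h.players_eq]
    refine List.filter_congr fun k hk => ?_
    rw [List.countP_congr (q := fun i => decide (C.Better T k i))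
      fun i hi => by rw [hb k hk i hi]]
  have hrej : m.active.filter (fun k => decide (m.active.countP (fun i =>
      decide (mean i - radius T (pulls i) ≥ mean k + radius T (pulls k))) ≥ m.players)) =
        C.rejected T := by
    rw [h.active_eq, h.players_eq]
    refine List.filter_congr fun k hk => ?_
    rw [List.countP_congr (q := fun i => decide (C.Better T i k))
      fun i hi => by rw [hb i hi k hk]]
  have hfin : m.finishPhase T = if m.players - m.rank ≤ (C.accepted T).length then
      .exploit ((C.accepted T).getD (m.players - m.rank - 1) 0)
      else .explore
      { m with
        phase := m.phase + 1
        players := m.players - (C.accepted T).length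
        active := m.active.filter fun k => decide (k ∉ C.accepted T ∧ k ∉ C.rejected T)
        pulls := pulls } 0 := by
    rw [← hacc, ← hrej]
    rfl
  rw [hfin, h.players_eq, h.rank_eq]
  constructor
  · intro h1
    simp only [Config.next] at h1
    rw [if_pos (by omega)]
    simp [Config.next, hj]
  · intro h1
    simp only [Config.next] at h1
    rw [if_neg (by omega)]
    refine ⟨_, rfl, ⟨rfl, ?_, rfl, ?_, ?_, h.length_eq, ?_⟩⟩
    · simp [Config.next, h.phase_eq]
    · simp [Config.next, h.active_eq]
    · intro k hk
      exact hpulls k (List.mem_of_mem_filter hk)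
    · intro i _ k hk
      exact h.quant_eq i (by omega) k (List.mem_of_mem_filter hk)

lemma Config.newPulls_pos (hC : C.Valid rank) : 0 < C.newPulls := by
  have := hC.players_pos
  unfold Config.newPulls
  positivity

lemma radius_pos (hT : 2 ≤ T) {s : ℕ} (hs : 0 < s) : 0 < radius T s := by
  have : 0 < Real.log T := Real.log_pos (by exact_mod_cast hT)
  unfold radius
  positivity

lemma Config.Better.mean_lt (hT : 2 ≤ T) (hC : C.Valid rank) {i k : Fin K} (h : C.Better T i k) :
    C.mean k < C.mean i := by
  have := radius_pos hT (Config.newPulls_pos hC)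
  unfold Config.Better at h
  linarith

open Classical in
lemma countP_eq_card {l : List (Fin K)} (hl : l.Nodup) (p : Fin K → Prop) :
    l.countP (fun i => decide (p i)) = (l.toFinset.filter p).card := by
  rw [List.countP_eq_length_filter, ← List.toFinset_card_of_nodup (hl.filter _),
    List.toFinset_filter]
  simp

lemma Config.Valid.mem_accepted (hC : C.Valid rank) {k : Fin K} :
    k ∈ C.accepted T ↔ k ∈ C.active ∧ (open Classical in
      C.active.length ≤ (C.active.toFinset.filter fun i => C.Better T k i).card + C.players) := by
  classical
  rw [Config.accepted, List.mem_filter, countP_eq_card hC.nodup]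
  simp

lemma Config.Valid.mem_rejected (hC : C.Valid rank) {k : Fin K} :
    k ∈ C.rejected T ↔ k ∈ C.active ∧ (open Classical in
      C.players ≤ (C.active.toFinset.filter fun i => C.Better T i k).card) := by
  classical
  rw [Config.rejected, List.mem_filter, countP_eq_card hC.nodup]
  simp

lemma Config.Valid.card_active (hC : C.Valid rank) : C.active.toFinset.card = C.active.length :=
  List.toFinset_card_of_nodup hC.nodup

/-- Take the rejected arm with the largest empirical mean: the `M_p` or more arms that beat it have
larger means, hence are not rejected. No accuracy of the means is needed, so enough active arms
remain in any case. -/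
lemma Config.Valid.card_rejected_add_le (hC : C.Valid rank) (hT : 2 ≤ T) :
    (C.rejected T).toFinset.card + C.players ≤ C.active.length := by
  classical
  have hsub : (C.rejected T).toFinset ⊆ C.active.toFinset := fun k hk => by
    rw [List.mem_toFinset] at hk ⊢
    exact (hC.mem_rejected.1 hk).1
  rcases (C.rejected T).toFinset.eq_empty_or_nonempty with h | h
  · rw [h]; simpa using hC.players_le
  · obtain ⟨k, hk, hmax⟩ := Finset.exists_max_image _ C.mean h
    have h1 := (hC.mem_rejected.1 (List.mem_toFinset.1 hk)).2
    have h2 : (C.active.toFinset.filter fun i => C.Better T i k) ⊆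
        C.active.toFinset \ (C.rejected T).toFinset := fun i hi => by
      rw [Finset.mem_filter] at hi
      rw [Finset.mem_sdiff]
      exact ⟨hi.1, fun h3 => absurd (hmax i h3) (not_le.2 (hi.2.mean_lt hT hC))⟩
    have h3 := Finset.card_le_card h2
    rw [Finset.card_sdiff_of_subset hsub, hC.card_active] at h3
    have h4 := Finset.card_le_card hsub
    rw [hC.card_active] at h4
    omega

lemma Config.Valid.nodup_accepted (hC : C.Valid rank) : (C.accepted T).Nodup := hC.nodup.filter _

lemma Config.next_toFinset : (C.next T rank).active.toFinset =
    (C.active.toFinset \ (C.accepted T).toFinset) \ (C.rejected T).toFinset := by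
  ext k
  simp [Config.next, and_assoc]

lemma Config.Valid.next_exploited_mem (hC : C.Valid rank) {j : Fin M} (hj : rank j < C.players)
    (hj' : (C.next T rank).players ≤ rank j) :
    (C.next T rank).exploited j ∈ C.accepted T := by
  simp only [Config.next] at hj' ⊢
  rw [if_pos hj, List.getD_eq_getElem _ _ (by omega)]
  exact List.getElem_mem _

/-- Players who leave now take different positions in the list of accepted arms; these arms were
active, unlike the arms already exploited. -/
lemma Config.Valid.next_exploited_inj (hC : C.Valid rank) (i j : Fin M)
    (hi : (C.next T rank).players ≤ rank i) (hj : (C.next T rank).players ≤ rank j)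
    (h : (C.next T rank).exploited i = (C.next T rank).exploited j) : i = j := by
  have hacc : ∀ k ∈ C.accepted T, k ∈ C.active := fun k hk => (hC.mem_accepted.1 hk).1
  have hold : ∀ j, C.players ≤ rank j → (C.next T rank).exploited j = C.exploited j :=
    fun j hj => by simp [Config.next, hj]
  rcases lt_or_ge (rank i) C.players with h1 | h1 <;>
    rcases lt_or_ge (rank j) C.players with h2 | h2
  · simp only [Config.next] at h hi hj
    rw [if_pos h1, if_pos h2] at h
    have := getD_inj hC.nodup_accepted (by omega) (by omega) h
    exact hC.rank_inj (by omega)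
  · have h3 := hacc _ (hC.next_exploited_mem h1 hi)
    rw [h, hold j h2] at h3
    exact absurd h3 (hC.exploited_notMem j h2)
  · have h3 := hacc _ (hC.next_exploited_mem h2 hj)
    rw [← h, hold i h1] at h3
    exact absurd h3 (hC.exploited_notMem i h1)
  · rw [hold i h1, hold j h2] at h
    exact hC.exploited_inj i j h1 h2 h

lemma Config.Valid.next (hC : C.Valid rank) (hT : 2 ≤ T) (hpos : 0 < (C.next T rank).players) :
    (C.next T rank).Valid rank where
  rank_inj := hC.rank_inj
  rank_lt := hC.rank_lt
  nodup := hC.nodup.filter _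
  players_pos := hpos
  players_le := by
    have hnd : (C.next T rank).active.Nodup := hC.nodup.filter _
    have h1 := hC.card_rejected_add_le hT
    have h2 := Finset.le_card_sdiff (C.rejected T).toFinset
      (C.active.toFinset \ (C.accepted T).toFinset)
    have h3 := Finset.le_card_sdiff (C.accepted T).toFinset C.active.toFinset
    rw [hC.card_active, List.toFinset_card_of_nodup hC.nodup_accepted] at h3
    rw [← Config.next_toFinset, List.toFinset_card_of_nodup hnd] at h2
    have h4 : (C.next T rank).players = C.players - (C.accepted T).length := rfl
    omega
  exploited_notMem j hj hmem := by
    have h1 : (C.next T rank).exploited j ∈ C.active ∧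
        (C.next T rank).exploited j ∉ C.accepted T := by
      have := List.mem_filter.1 hmem
      simp only [decide_eq_true_eq] at this
      exact ⟨this.1, this.2.1⟩
    rcases lt_or_ge (rank j) C.players with h2 | h2
    · exact h1.2 (hC.next_exploited_mem h2 hj)
    · have h3 : (C.next T rank).exploited j = C.exploited j := by simp [Config.next, h2]
      rw [h3] at h1
      exact hC.exploited_notMem j h2 h1.1
  exploited_inj := hC.next_exploited_inj

lemma Config.Valid.learn (hC : C.Valid rank) (q : Fin M → Fin K → ℕ) : (C.learn rank q).Valid rank :=
  ⟨hC.rank_inj, hC.rank_lt, hC.nodup, hC.players_pos, hC.players_le, hC.exploited_notMem,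
    hC.exploited_inj⟩

end Update


open SIC

/-! ## The best arms -/

section Top

variable {K : ℕ} {μ : Fin K → ℝ} {M : ℕ}

/-- A set of `M` arms with the largest means. -/
noncomputable def topArms (μ : Fin K → ℝ) (M : ℕ) : Finset (Fin K) :=
  (Finset.univ.filter fun i : Fin K => (i : ℕ) < M).image (Tuple.sort fun k => -μ k)

lemma orderStat_succ (i : Fin K) : orderStat μ (i + 1) = μ (Tuple.sort (fun k => -μ k) i) := by
  rw [orderStat, dif_pos ⟨by omega, by omega⟩]
  rfl

lemma sort_antitone {i j : Fin K} (h : i ≤ j) :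
    μ (Tuple.sort (fun k => -μ k) j) ≤ μ (Tuple.sort (fun k => -μ k) i) := by
  have := Tuple.monotone_sort (fun k => -μ k) h
  simpa using this

lemma orderStat_nonneg (hμ : ∀ k, 0 ≤ μ k) (n : ℕ) : 0 ≤ orderStat μ n := by
  unfold orderStat
  split_ifs
  · exact hμ _
  · exact le_rfl

lemma orderStat_antitone (hμ : ∀ k, 0 ≤ μ k) {m n : ℕ} (hm : 1 ≤ m) (hmn : m ≤ n) :
    orderStat μ n ≤ orderStat μ m := by
  rcases lt_or_ge K n with hn | hn
  · have h0 : orderStat μ n = 0 := dif_neg (by omega)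
    rw [h0]
    exact orderStat_nonneg hμ m
  · have h1 := orderStat_succ (μ := μ) (⟨m - 1, by omega⟩ : Fin K)
    have h2 := orderStat_succ (μ := μ) (⟨n - 1, by omega⟩ : Fin K)
    simp only [Nat.sub_add_cancel hm, Nat.sub_add_cancel (hm.trans hmn)] at h1 h2
    rw [h1, h2]
    exact sort_antitone (by simp [Fin.le_def]; omega)

/-- The function `F` is general because the reindexing serves both the sum of the best means and the
sum of the rates over the bad arms. -/
lemma sum_orderStat {a b : ℕ} (hb : b ≤ K) (F : ℝ → ℝ) :
    ∑ k ∈ Finset.Icc (a + 1) b, F (orderStat μ k) =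
      ∑ i ∈ Finset.univ.filter (fun i : Fin K => a ≤ (i : ℕ) ∧ (i : ℕ) < b),
        F (μ (Tuple.sort (fun k => -μ k) i)) := by
  refine (Finset.sum_nbij (fun i : Fin K => (i : ℕ) + 1) (fun i hi => ?_) (fun i _ j _ h => ?_)
    (fun n hn => ?_) fun i _ => by rw [orderStat_succ]).symm
  · simp only [Finset.mem_filter, Finset.mem_univ, true_and] at hi
    exact Finset.mem_Icc.2 ⟨by omega, by omega⟩
  · simp only at h
    exact Fin.ext (by omega)
  · have h := Finset.mem_Icc.1 (Finset.mem_coe.1 hn)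
    refine ⟨⟨n - 1, by omega⟩, ?_, ?_⟩
    · simp only [Finset.coe_filter, Finset.mem_univ, true_and, Set.mem_ofPred_eq]
      omega
    · simp only; omega

lemma sum_topArms (hM : M ≤ K) : ∑ k ∈ Finset.Icc 1 M, orderStat μ k = ∑ a ∈ topArms μ M, μ a := by
  have h := sum_orderStat (μ := μ) (a := 0) hM id
  simp only [id, zero_add, zero_le, true_and] at h
  rw [h, topArms, Finset.sum_image fun i _ j _ hij => (Tuple.sort _).injective hij]

lemma sum_topArms_compl (F : ℝ → ℝ) :
    ∑ k ∈ Finset.Icc (M + 1) K, F (orderStat μ k) = ∑ b ∈ (topArms μ M)ᶜ, F (μ b) := by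
  rw [sum_orderStat le_rfl F, ← Finset.sum_image (g := Tuple.sort fun k => -μ k)
    (f := fun k => F (μ k)) fun i _ j _ hij => (Tuple.sort _).injective hij]
  congr 1
  ext b
  simp only [topArms, Finset.mem_image, Finset.mem_filter, Finset.mem_univ, true_and,
    Finset.mem_compl, not_exists, not_and]
  constructor
  · rintro ⟨i, hi, rfl⟩ j hj h
    have := (Tuple.sort _).injective h
    subst this; omega
  · intro h
    refine ⟨(Tuple.sort _).symm b, ⟨?_, (Fin.isLt _)⟩, Equiv.apply_symm_apply _ _⟩
    by_contra h2
    exact h ((Tuple.sort fun k => -μ k).symm b) (by omega) (Equiv.apply_symm_apply _ _)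

lemma card_topArms (hM : M ≤ K) : (topArms μ M).card = M := by
  rw [topArms, Finset.card_image_of_injective _ (Tuple.sort _).injective]
  have := Fin.card_filter_val_lt (n := K) (m := M)
  simpa [hM] using this

lemma le_of_mem_topArms (hM : 1 ≤ M) (hMK : M ≤ K) {a : Fin K} (ha : a ∈ topArms μ M) :
    orderStat μ M ≤ μ a := by
  obtain ⟨i, hi, rfl⟩ := Finset.mem_image.1 ha
  simp only [Finset.mem_filter, Finset.mem_univ, true_and] at hi
  have h1 := orderStat_succ (μ := μ) (⟨M - 1, by omega⟩ : Fin K)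
  simp only [Nat.sub_add_cancel hM] at h1
  rw [h1]
  exact sort_antitone (by simp [Fin.le_def]; omega)

lemma le_of_notMem_topArms {b : Fin K} (hb : b ∉ topArms μ M) : μ b ≤ orderStat μ (M + 1) := by
  have h0 : M ≤ ((Tuple.sort fun k => -μ k).symm b : ℕ) := by
    by_contra h
    exact hb (Finset.mem_image.2 ⟨(Tuple.sort fun k => -μ k).symm b, by simpa using h, by simp⟩)
  have h2 := ((Tuple.sort fun k => -μ k).symm b).isLt
  have h1 := orderStat_succ (μ := μ) (⟨M, by omega⟩ : Fin K)
  simp only at h1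
  rw [h1]
  have h3 := sort_antitone (μ := μ) (i := ⟨M, by omega⟩) (j := (Tuple.sort fun k => -μ k).symm b)
    (by simp [Fin.le_def]; omega)
  simpa using h3

lemma le_orderStat_of_notMem_topArms (hμ : ∀ k, 0 ≤ μ k) (hM : 1 ≤ M) {b : Fin K}
    (hb : b ∉ topArms μ M) : μ b ≤ orderStat μ M :=
  (le_of_notMem_topArms hb).trans (orderStat_antitone hμ hM (by omega))

/-- Exchange argument through the threshold `orderStat μ M`: arms of `B` outside the top are below
it, and at least as many missing top arms are above it. Nonnegativity of the threshold handles sets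
with fewer than `M` arms. -/
lemma sum_le_sum_topArms (hμ : ∀ k, 0 ≤ μ k) (hM : 1 ≤ M) (hMK : M ≤ K) (B : Finset (Fin K))
    (hB : B.card ≤ M) : ∑ k ∈ B, μ k ≤ ∑ a ∈ topArms μ M, μ a := by
  have hcard : (B \ topArms μ M).card ≤ (topArms μ M \ B).card := by
    have h1 := Finset.card_sdiff_add_card_inter B (topArms μ M)
    have h2 := Finset.card_sdiff_add_card_inter (topArms μ M) B
    rw [Finset.inter_comm, card_topArms hMK] at h2
    omega
  have h1 : ∑ k ∈ B \ topArms μ M, μ k ≤ (B \ topArms μ M).card • orderStat μ M :=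
    Finset.sum_le_card_nsmul _ _ _ fun k hk =>
      le_orderStat_of_notMem_topArms hμ hM (Finset.mem_sdiff.1 hk).2
  have h2 : (topArms μ M \ B).card • orderStat μ M ≤ ∑ k ∈ topArms μ M \ B, μ k :=
    Finset.card_nsmul_le_sum _ _ _ fun k hk => le_of_mem_topArms hM hMK (Finset.mem_sdiff.1 hk).1
  have h3 : (B \ topArms μ M).card • orderStat μ M ≤ (topArms μ M \ B).card • orderStat μ M :=
    nsmul_le_nsmul_left (orderStat_nonneg hμ M) hcard
  rw [← Finset.sum_inter_add_sum_sdiff B (topArms μ M),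
    ← Finset.sum_inter_add_sum_sdiff (topArms μ M) B, Finset.inter_comm]
  linarith

/-- Colliding players earn nothing and the others sit on distinct arms. -/
lemma sum_reward_le (hμ : ∀ k, 0 ≤ μ k) (hM : 1 ≤ M) (hMK : M ≤ K) (a : Fin M → Fin K) :
    ∑ j, reward μ a j ≤ ∑ k ∈ topArms μ M, μ k := by
  classical
  have h1 : ∑ j, reward μ a j =
      ∑ k ∈ (Finset.univ.filter fun j => collides a (a j) = false).image a, μ k := by
    rw [Finset.sum_image, Finset.sum_filter]
    · refine Finset.sum_congr rfl fun j _ => ?_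
      unfold reward
      cases collides a (a j) <;> simp
    · intro i hi j hj hij
      simp only [Finset.coe_filter, Finset.mem_univ, true_and, Set.mem_ofPred_eq] at hj
      by_contra hne
      have h2 : 1 < (Finset.univ.filter fun i => a i = a j).card :=
        Finset.one_lt_card.2 ⟨i, by simp [hij], j, by simp, hne⟩
      simp [collides] at hj
      omega
  rw [h1]
  refine sum_le_sum_topArms hμ hM hMK _ (Finset.card_image_le.trans ?_)
  exact (Finset.card_filter_le _ _).trans (by simp)

end Top

/-! ## Correctness of the acceptances and rejections -/

section Correctness

variable {K M : ℕ} [NeZero K] {T : ℕ} {rank : Fin M → ℕ} {C : Config K M} {μ : Fin K → ℝ}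

/-- The active arms contain as many of the best arms as there are active players, and the other
players exploit the other best arms. -/
structure Config.Correct (C : Config K M) (rank : Fin M → ℕ) (μ : Fin K → ℝ) : Prop where
  card_eq : (topArms μ M ∩ C.active.toFinset).card = C.players
  exploited_mem : ∀ j, C.players ≤ rank j → C.exploited j ∈ topArms μ M

/-- The empirical means are accurate. -/
def Config.Accurate (T : ℕ) (C : Config K M) (μ : Fin K → ℝ) : Prop :=
  ∀ k ∈ C.active, |C.mean k - μ k| < radius T C.newPulls

/-- The gaps between the active arms and the threshold are at most `w`. -/
structure Config.Tight (C : Config K M) (μ : Fin K → ℝ) (w : ℝ) : Prop where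
  top_le : ∀ a ∈ topArms μ M, a ∈ C.active → μ a - orderStat μ (M + 1) ≤ w
  le_bot : ∀ b ∉ topArms μ M, b ∈ C.active → orderStat μ M - μ b ≤ w

lemma Config.Accurate.lt_of_better (h : C.Accurate T μ) {i k : Fin K} (hi : i ∈ C.active)
    (hk : k ∈ C.active) (hb : C.Better T i k) : μ k < μ i := by
  have h1 := abs_lt.1 (h i hi)
  have h2 := abs_lt.1 (h k hk)
  unfold Config.Better at hb
  linarith [h1.1, h1.2, h2.1, h2.2]

lemma Config.Accurate.sub_le_of_not_better (h : C.Accurate T μ) {i k : Fin K} (hi : i ∈ C.active)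
    (hk : k ∈ C.active) (hb : ¬ C.Better T i k) : μ i - μ k ≤ 4 * radius T C.newPulls := by
  have h1 := abs_lt.1 (h i hi)
  have h2 := abs_lt.1 (h k hk)
  unfold Config.Better at hb
  linarith [h1.1, h1.2, h2.1, h2.2]

variable (hC : C.Valid rank) (hT : C.Correct rank μ) (hA : C.Accurate T μ) (hμ : ∀ k, 0 ≤ μ k)
  (hM : 1 ≤ M) (hMK : M ≤ K)
include hC hT hA

omit hA in
lemma Config.Correct.card_sdiff :
    (C.active.toFinset \ topArms μ M).card + C.players = C.active.length := by
  have h := Finset.card_sdiff_add_card_inter C.active.toFinset (topArms μ M)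
  rw [Finset.inter_comm, hT.card_eq, hC.card_active] at h
  exact h

include hμ hM hMK

/-- If a bad arm were accepted, it and the arms it beats would all be bad and active. These would be
at least `K_p - M_p + 1` arms, while only `K_p - M_p` bad arms are active. -/
lemma Config.Correct.accepted_mem {k : Fin K} (hk : k ∈ C.accepted T) : k ∈ topArms μ M := by
  classical
  obtain ⟨hk1, hk2⟩ := hC.mem_accepted.1 hk
  by_contra hk3
  have hsub : insert k (C.active.toFinset.filter fun i => C.Better T k i) ⊆
      C.active.toFinset \ topArms μ M := by
    intro i hi
    rw [Finset.mem_sdiff]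
    rcases Finset.mem_insert.1 hi with rfl | hi
    · exact ⟨List.mem_toFinset.2 hk1, hk3⟩
    · rw [Finset.mem_filter, List.mem_toFinset] at hi
      refine ⟨List.mem_toFinset.2 hi.1, fun h => ?_⟩
      have h1 := hA.lt_of_better hk1 hi.1 hi.2
      have h2 := le_of_mem_topArms hM hMK h
      have h3 := le_orderStat_of_notMem_topArms hμ hM hk3
      linarith
  have h1 := Finset.card_le_card hsub
  rw [Finset.card_insert_of_notMem] at h1
  · have h2 := hT.card_sdiff hC
    omega
  · intro h
    have h2 := hA.lt_of_better hk1 hk1 (Finset.mem_filter.1 h).2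
    exact lt_irrefl _ h2

/-- Dually, a rejected top arm and the arms that beat it would be at least `M_p + 1` active top
arms, one too many. -/
lemma Config.Correct.rejected_notMem {k : Fin K} (hk : k ∈ C.rejected T) : k ∉ topArms μ M := by
  classical
  obtain ⟨hk1, hk2⟩ := hC.mem_rejected.1 hk
  intro hk3
  have hsub : insert k (C.active.toFinset.filter fun i => C.Better T i k) ⊆
      topArms μ M ∩ C.active.toFinset := by
    intro i hi
    rw [Finset.mem_inter]
    rcases Finset.mem_insert.1 hi with rfl | hi
    · exact ⟨hk3, List.mem_toFinset.2 hk1⟩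
    · rw [Finset.mem_filter, List.mem_toFinset] at hi
      refine ⟨?_, List.mem_toFinset.2 hi.1⟩
      by_contra h
      have h1 := hA.lt_of_better hi.1 hk1 hi.2
      have h2 := le_of_mem_topArms hM hMK hk3
      have h3 := le_orderStat_of_notMem_topArms hμ hM h
      linarith
  have h1 := Finset.card_le_card hsub
  rw [Finset.card_insert_of_notMem, hT.card_eq] at h1
  · omega
  · intro h
    have h2 := hA.lt_of_better hk1 hk1 (Finset.mem_filter.1 h).2
    exact lt_irrefl _ h2

lemma Config.Correct.next : (C.next T rank).Correct rank μ := by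
  have hacc : (C.accepted T).toFinset ⊆ topArms μ M ∩ C.active.toFinset := fun k hk => by
    rw [List.mem_toFinset] at hk
    rw [Finset.mem_inter, List.mem_toFinset]
    exact ⟨hT.accepted_mem hC hA hμ hM hMK hk, (hC.mem_accepted.1 hk).1⟩
  constructor
  · have h1 : topArms μ M ∩ (C.next T rank).active.toFinset =
        (topArms μ M ∩ C.active.toFinset) \ (C.accepted T).toFinset := by
      rw [Config.next_toFinset]
      ext k
      simp only [Finset.mem_inter, Finset.mem_sdiff, List.mem_toFinset]
      constructor
      · rintro ⟨h1, ⟨h2, h3⟩, _⟩; exact ⟨⟨h1, h2⟩, h3⟩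
      · rintro ⟨⟨h1, h2⟩, h3⟩
        exact ⟨h1, ⟨h2, h3⟩, fun h4 => hT.rejected_notMem hC hA hμ hM hMK h4 h1⟩
    rw [h1, Finset.card_sdiff_of_subset hacc, hT.card_eq,
      List.toFinset_card_of_nodup hC.nodup_accepted]
    rfl
  · intro j hj
    rcases lt_or_ge (rank j) C.players with h | h
    · exact hT.accepted_mem hC hA hμ hM hMK (hC.next_exploited_mem h hj)
    · have h3 : (C.next T rank).exploited j = C.exploited j := by simp [Config.next, h]
      rw [h3]
      exact hT.exploited_mem j h

-- A surviving top arm fails to beat some bad active arm, since otherwise it would have been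
-- accepted. Accuracy puts the two means within four radii, and the bad mean is at most the
-- `(M+1)`-th. Surviving bad arms are symmetric.
omit hμ in
lemma Config.Correct.next_tight :
    (C.next T rank).Tight μ (4 * radius T (C.next T rank).pulls) := by
  classical
  constructor
  · intro a ha ha'
    have ha1 := List.mem_filter.1 ha'
    simp only [decide_eq_true_eq] at ha1
    have h1 : ∃ b ∈ C.active.toFinset \ topArms μ M, ¬ C.Better T a b := by
      by_contra! h
      refine ha1.2.1 (hC.mem_accepted.2 ⟨ha1.1, ?_⟩)
      have h2 := hT.card_sdiff hC
      have h3 : C.active.toFinset \ topArms μ M ⊆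
          C.active.toFinset.filter fun i => C.Better T a i := fun b hb =>
        Finset.mem_filter.2 ⟨(Finset.mem_sdiff.1 hb).1, h b hb⟩
      have h4 := Finset.card_le_card h3
      omega
    obtain ⟨b, hb, hab⟩ := h1
    rw [Finset.mem_sdiff, List.mem_toFinset] at hb
    have h2 := hA.sub_le_of_not_better ha1.1 hb.1 hab
    have h3 := le_of_notMem_topArms hb.2
    change _ ≤ 4 * radius T C.newPulls
    linarith
  · intro b hb hb'
    have hb1 := List.mem_filter.1 hb'
    simp only [decide_eq_true_eq] at hb1
    have h1 : ∃ a ∈ topArms μ M ∩ C.active.toFinset, ¬ C.Better T a b := by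
      by_contra! h
      refine hb1.2.2 (hC.mem_rejected.2 ⟨hb1.1, ?_⟩)
      rw [← hT.card_eq]
      exact Finset.card_le_card fun a ha =>
        Finset.mem_filter.2 ⟨(Finset.mem_inter.1 ha).2, h a ha⟩
    obtain ⟨a, ha, hab⟩ := h1
    rw [Finset.mem_inter, List.mem_toFinset] at ha
    have h2 := hA.sub_le_of_not_better ha.2 hb1.1 hab
    have h3 := le_of_mem_topArms hM hMK ha.1
    change _ ≤ 4 * radius T C.newPulls
    linarith

end Correctness


open SIC

variable {K M : ℕ} [NeZero K] {T T₀ : ℕ}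

/-! ## Accuracy of the statistics -/

/-- The constant that controls the rounding errors of the players who left before phase `p`. -/
noncomputable def roundConst (p : ℕ) : ℝ := ∑ q ∈ Finset.Ico 1 p, 1 / ((2 : ℝ) ^ (q + 1) - 2)

lemma two_lt_two_pow {p : ℕ} (hp : 1 ≤ p) : (0 : ℝ) < 2 ^ (p + 1) - 2 := by
  have h : (2 : ℝ) ^ 2 ≤ 2 ^ (p + 1) := pow_le_pow_right₀ (by norm_num) (by omega)
  linarith

lemma roundConst_succ {p : ℕ} (hp : 1 ≤ p) :
    roundConst (p + 1) = roundConst p + 1 / ((2 : ℝ) ^ (p + 1) - 2) :=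
  Finset.sum_Ico_succ_top hp _

lemma roundConst_nonneg (p : ℕ) : 0 ≤ roundConst p :=
  Finset.sum_nonneg fun q hq =>
    div_nonneg zero_le_one (two_lt_two_pow (Finset.mem_Ico.1 hq).1).le

/-- The first two terms give `1/2 + 1/6`. From `q = 3` on, the denominators are at least `7/8` of `2
^ (q + 1)`, so the tail is bounded by a geometric series. -/
lemma roundConst_le (p : ℕ) : roundConst p ≤ 17 / 21 := by
  have h3 : ∀ p, 3 ≤ p → roundConst p ≤ 17 / 21 - 8 / 7 / 2 ^ p := by
    intro p hp
    induction p, hp using Nat.le_induction with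
    | base => norm_num [roundConst, Finset.sum_Ico_succ_top]
    | succ p hp ih =>
      rw [roundConst_succ (by omega)]
      have h8 : (2 : ℝ) ^ 3 ≤ 2 ^ p := pow_le_pow_right₀ (by norm_num) hp
      have h1 : 1 / ((2 : ℝ) ^ (p + 1) - 2) ≤ 8 / 7 / 2 ^ p - 8 / 7 / 2 ^ (p + 1) := by
        rw [pow_succ, div_le_iff₀ (by linarith)]
        have h4 : (0 : ℝ) < 2 ^ p := by positivity
        field_simp
        linarith
      linarith
  rcases lt_or_ge p 3 with h | h
  · interval_cases p <;> norm_num [roundConst, Finset.sum_Ico_succ_top]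
  · have := h3 p h
    have h4 : (0 : ℝ) < 8 / 7 / 2 ^ p := by positivity
    linarith

/-- One step of Cauchy-Schwarz: `√(c w)` bounds the error of the players who left earlier, with `w`
pulls in total, and `b` further players leave with `d` pulls each. Iterated, it yields `Σ √b_q ≤ √(Σ
1/d_q) √(Σ b_q d_q)`. -/
lemma sqrt_add_sqrt_le {L c w b d : ℝ} (hL : 0 ≤ L) (hc : 0 ≤ c) (hw : 0 ≤ w) (hb : 0 ≤ b)
    (hd : 0 < d) : √(L * (c * w)) + √(L * b) ≤ √(L * ((c + 1 / d) * (w + b * d))) := by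
  have h1 : √(L * (c * w)) * √(L * b) = √(L * (c * (b * d))) * √(L * (w / d)) := by
    rw [← Real.sqrt_mul (by positivity), ← Real.sqrt_mul (by positivity)]
    congr 1
    field_simp
  refine Real.le_sqrt_of_sq_le ?_
  have h2 := Real.sq_sqrt (show 0 ≤ L * (c * w) by positivity)
  have h3 := Real.sq_sqrt (show 0 ≤ L * b by positivity)
  have h4 := Real.sq_sqrt (show 0 ≤ L * (c * (b * d)) by positivity)
  have h5 := Real.sq_sqrt (show 0 ≤ L * (w / d) by positivity)
  have h6 := two_mul_le_add_sq (√(L * (c * (b * d)))) (√(L * (w / d)))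
  have h7 : L * ((c + 1 / d) * (w + b * d)) =
      L * (c * w) + L * b + L * (c * (b * d)) + L * (w / d) := by field_simp; ring
  rw [h7, add_sq, h2, h3]
  linarith

/-- The exact constant is `3 / √2 ≈ 2.1213`; the margin above `2.1021` is what `Tracked.accurate`
needs. -/
lemma mul_sqrt_le_mul_radius (T : ℕ) {N : ℕ} (hN : 0 < N) :
    2.12 * √(N * Real.log T) ≤ N * radius T N := by
  have hN' : (0 : ℝ) < N := by exact_mod_cast hN
  have hL : 0 ≤ Real.log T := Real.log_natCast_nonneg T
  rw [radius, mul_left_comm]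
  have h1 : (N : ℝ) * √(Real.log T / (2 * N)) = √(N * Real.log T / 2) := by
    rw [← Real.sqrt_sq hN'.le, ← Real.sqrt_mul (by positivity), Real.sqrt_sq hN'.le]
    congr 1
    field_simp
  rw [h1]
  have h2 : √(N * Real.log T) = √2 * √(N * Real.log T / 2) := by
    rw [← Real.sqrt_mul (by positivity)]
    congr 1
    ring
  rw [h2, ← mul_assoc]
  gcongr
  have h3 : √2 ≤ 1.415 := by
    rw [Real.sqrt_le_left (by norm_num)]
    norm_num
  linarith

lemma quantize_sub {s : Fin K → ℝ} {k : Fin K} (hs : 0 ≤ s k) (v : Fin K → unitInterval) :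
    (quantize s v k : ℝ) - s k = roundErr k (Int.fract (s k)) v := by
  have h1 := natCast_floor_eq_intCast_floor hs
  have h2 := Int.self_sub_floor (s k)
  unfold quantize roundErr
  push_cast
  rw [h1]
  linarith

/-- A player has explored each active arm `2 + 4 + ⋯ + 2 ^ p = 2 ^ (p + 1) - 2` times, so even the
value rounded up fits in `p + 1` digits. -/
lemma quantize_lt {s : Fin K → ℝ} {k : Fin K} {p : ℕ} (hs : s k ≤ 2 ^ (p + 1) - 2)
    (v : Fin K → unitInterval) : quantize s v k < 2 ^ (p + 1) := by
  have h1 : ⌊s k⌋₊ + 2 ≤ 2 ^ (p + 1) := by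
    rcases le_or_gt 0 (s k) with h | h
    · have h2 := Nat.floor_le h
      have h3 : ((⌊s k⌋₊ + 2 : ℕ) : ℝ) ≤ ((2 ^ (p + 1) : ℕ) : ℝ) := by push_cast; linarith
      exact_mod_cast h3
    · rw [Nat.floor_of_nonpos h.le, pow_succ]
      have := Nat.one_le_two_pow (n := p)
      omega
  unfold quantize
  split_ifs <;> omega

section Finishers

variable {rank : Fin M → ℕ} {C : Config K M} {m : Fin M → Mem K} {n t : ℕ} {ω : Game K M T T₀}

lemma Exploring.finishers_eq (h : Exploring rank C m n t ω)
    (hn : n + 1 = C.active.length * 2 ^ C.phase) (r : ℕ) :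
    finishers (stage t ω) r = Finset.univ.filter fun j => r ≤ rank j ∧ rank j < C.players := by
  ext j
  simp only [finishers, Finset.mem_filter, Finset.mem_univ, true_and]
  rcases lt_or_ge (rank j) C.players with hj | hj
  · have ha := h.agrees j hj
    rw [h.active j hj]
    simp only [Stage.EndsExploration, ha.active_eq, ha.phase_eq, ha.rank_eq, hn, hj, true_and,
      and_true]
  · rw [h.inactive j hj]
    simp only [Stage.EndsExploration, false_iff]
    omega

lemma Config.Valid.card_finishers (hC : C.Valid rank) (hP : C.players ≤ M) {r : ℕ}
    (hr : r ≤ C.players) :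
    (Finset.univ.filter fun j => r ≤ rank j ∧ rank j < C.players).card = C.players - r := by
  have h1 := hC.card_players hP
  have h2 := hC.card_players (hr.trans hP)
  have h3 : (Finset.univ.filter fun j => rank j < C.players) =
      (Finset.univ.filter fun j => rank j < r) ∪
        Finset.univ.filter fun j => r ≤ rank j ∧ rank j < C.players := by
    ext j
    simp only [Finset.mem_union, Finset.mem_filter, Finset.mem_univ, true_and]
    omega
  rw [h3, Finset.card_union_of_disjoint, h2] at h1
  · omega
  · rw [Finset.disjoint_filter]
    intro j _ h4 h5
    omega

end Finishers

/-- The invariants at the start of a phase. -/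
structure Tracked (ν : Fin K → Measure ℝ) (rank : Fin M → ℕ) (C : Config K M) (m : Fin M → Mem K)
    (t : ℕ) (ω : Game K M T T₀) : Prop where
  valid : C.Valid rank
  players_le : C.players ≤ M
  exploring : Exploring rank C m 0 t ω
  phase_pos : 1 ≤ C.phase
  correct : C.Correct rank (means ν)
  count_eq : ∀ k ∈ C.active, count k t ω = C.pulls
  sum_eq : ∀ k ∈ C.active, ∑ j, sums t ω j k = means ν k * C.pulls + deviation ν k t ω
  sums_mem : ∀ j, ∀ k ∈ C.active, 0 ≤ sums t ω j k ∧ sums t ω j k ≤ 2 ^ C.phase - 2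
  pulls_ge : C.players * ((2 : ℝ) ^ C.phase - 2) ≤ C.pulls
  round_err : ∀ k ∈ C.active,
    |∑ j ∈ Finset.univ.filter (fun j => C.players ≤ rank j), ((C.quant j k : ℝ) - sums t ω j k)| ≤
      √(3 / 2 * Real.log T *
        (roundConst C.phase * (C.pulls - C.players * ((2 : ℝ) ^ C.phase - 2))))

/-! ### Preservation of the invariants through a phase -/

namespace Tracked

variable {ν : Fin K → Measure ℝ} {rank : Fin M → ℕ} {C : Config K M} {m : Fin M → Mem K}
  {t : ℕ} {ω : Game K M T T₀}

/-- The number of rounds of an exploration phase. -/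
def _root_.MultiPlayerBandit.Config.rounds (C : Config K M) : ℕ := C.active.length * 2 ^ C.phase

/-- The quantized statistics of the active players. -/
noncomputable def _root_.MultiPlayerBandit.Config.stats (C : Config K M) (t : ℕ)
    (ω : Game K M T T₀) (j : Fin M) : Fin K → ℕ :=
  quantize (sums (t + C.rounds) ω j) ((ω (t + C.rounds - 1)).2 j).2

lemma rounds_pos (h : Tracked ν rank C m t ω) : 0 < C.rounds :=
  Nat.mul_pos h.valid.length_pos (by positivity)

lemma stage_end (h : Tracked ν rank C m t ω) (j : Fin M) (hj : rank j < C.players) :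
    stage (t + C.rounds) ω j = (m j).startComm T (C.stats t ω j) := by
  have hpos := h.rounds_pos
  obtain ⟨n, hn⟩ : ∃ n, C.rounds = n + 1 := ⟨C.rounds - 1, by omega⟩
  have h1 := h.exploring.add (n := n) (by unfold Config.rounds at hn; omega)
  have h2 := h1.last (by rw [← hn]; rfl) j hj
  rw [Config.stats, hn, Nat.add_succ_sub_one, ← add_assoc]
  exact h2

lemma stage_end_inactive (h : Tracked ν rank C m t ω) (j : Fin M) (hj : C.players ≤ rank j) :
    stage (t + C.rounds) ω j = .exploit (C.exploited j) := by
  have hpos := h.rounds_pos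
  obtain ⟨n, hn⟩ : ∃ n, C.rounds = n + 1 := ⟨C.rounds - 1, by omega⟩
  have h1 := h.exploring.add (n := n) (by unfold Config.rounds at hn; omega)
  rw [hn, ← add_assoc, stage_succ, h1.inactive j hj]
  rfl

variable (h : Tracked ν rank C m t ω) (hG : Good ν ω)
include h hG

lemma sums_end_mem (j : Fin M) {k : Fin K} (hk : k ∈ C.active) :
    0 ≤ sums (t + C.rounds) ω j k ∧ sums (t + C.rounds) ω j k ≤ 2 ^ (C.phase + 1) - 2 := by
  have h1 := h.exploring.sums_add_mem h.valid hG.reward hk j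
  have h2 := h.sums_mem j k hk
  refine ⟨h2.1.trans h1.1, h1.2.trans ?_⟩
  rw [pow_succ]
  linarith [h2.2]

lemma roundSum_eq {k : Fin K} (hk : k ∈ C.active) (r : ℕ) :
    roundSum r k (t + C.rounds - 1) ω =
      ∑ j ∈ Finset.univ.filter (fun j => r ≤ rank j ∧ rank j < C.players),
        ((C.stats t ω j k : ℝ) - sums (t + C.rounds) ω j k) := by
  have hpos := h.rounds_pos
  obtain ⟨n, hn⟩ : ∃ n, C.rounds = n + 1 := ⟨C.rounds - 1, by omega⟩
  have h1 := h.exploring.add (n := n) (by unfold Config.rounds at hn; omega)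
  have hs : t + C.rounds - 1 = t + n := by omega
  rw [roundSum, hs, h1.finishers_eq (by rw [← hn]; rfl)]
  refine Finset.sum_congr rfl fun j _ => ?_
  rw [Config.stats, quantize_sub (h.sums_end_mem hG j hk).1, hs]
  congr 2
  rw [nextSum, hn, ← add_assoc, h1.sums_succ h.valid]
  simp only [h1.explores_iff]

/-- The error of the players of rank at least `r` splits into the frozen error of those who left
earlier and the fresh roundings of the others, combined by `sqrt_add_sqrt_le`. The case `r = 0`
gives the accuracy of the current means; taking `r` to be the next number of active players restores
the invariant. -/
lemma round_err_end (hT : t + C.rounds ≤ T) {k : Fin K} (hk : k ∈ C.active) {r : ℕ}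
    (hr : r ≤ C.players) :
    |∑ j ∈ Finset.univ.filter (fun j => r ≤ rank j),
      (((C.learn rank (C.stats t ω)).quant j k : ℝ) - sums (t + C.rounds) ω j k)| ≤
      √(3 / 2 * Real.log T *
        (roundConst (C.phase + 1) * (C.newPulls - r * ((2 : ℝ) ^ (C.phase + 1) - 2)))) := by
  have hpos := h.rounds_pos
  have hlog : 0 ≤ Real.log T := Real.log_natCast_nonneg T
  have hsplit : (Finset.univ.filter fun j => r ≤ rank j) =
      (Finset.univ.filter fun j => C.players ≤ rank j) ∪
        Finset.univ.filter fun j => r ≤ rank j ∧ rank j < C.players := by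
    ext j
    simp only [Finset.mem_union, Finset.mem_filter, Finset.mem_univ, true_and]
    omega
  rw [hsplit, Finset.sum_union (by
    rw [Finset.disjoint_filter]
    intro j _ h4 h5
    omega)]
  have hold : ∑ j ∈ Finset.univ.filter (fun j => C.players ≤ rank j),
      (((C.learn rank (C.stats t ω)).quant j k : ℝ) - sums (t + C.rounds) ω j k) =
      ∑ j ∈ Finset.univ.filter (fun j => C.players ≤ rank j),
        ((C.quant j k : ℝ) - sums t ω j k) := by
    refine Finset.sum_congr rfl fun j hj => ?_
    have hj' := (Finset.mem_filter.1 hj).2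
    have h1 := h.exploring.sums_add h.valid le_rfl j k
    simp only [not_lt.2 hj', false_and, if_false, Finset.sum_const_zero, add_zero] at h1
    change sums (t + C.rounds) ω j k = _ at h1
    rw [h1]
    simp only [Config.learn]
    rw [if_neg (not_lt.2 hj')]
  have hnew : ∑ j ∈ Finset.univ.filter (fun j => r ≤ rank j ∧ rank j < C.players),
      (((C.learn rank (C.stats t ω)).quant j k : ℝ) - sums (t + C.rounds) ω j k) =
      roundSum r k (t + C.rounds - 1) ω := by
    rw [h.roundSum_eq hG hk r]
    refine Finset.sum_congr rfl fun j hj => ?_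
    simp [Config.learn, (Finset.mem_filter.1 hj).2.2]
  rw [hold, hnew]
  have hround : |roundSum r k (t + C.rounds - 1) ω| ≤
      √(3 / 2 * Real.log T * (C.players - r : ℝ)) := by
    obtain ⟨n, hn⟩ : ∃ n, C.rounds = n + 1 := ⟨C.rounds - 1, by omega⟩
    have h1 := h.exploring.add (n := n) (by unfold Config.rounds at hn; omega)
    have hs : t + C.rounds - 1 = t + n := by omega
    -- The good event only speaks of `r < M`; for larger `r` the set of finishers is empty.
    rcases lt_or_ge r M with hrM | hrM
    · have h2 := hG.rounding (t + C.rounds - 1) (by omega) r hrM k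
      rw [hs, h1.finishers_eq (by rw [← hn]; rfl), h.valid.card_finishers h.players_le hr,
        Nat.cast_sub hr] at h2
      rw [hs]
      refine h2.trans (le_of_eq ?_)
      congr 1; ring
    · rw [h.roundSum_eq hG hk r, Finset.filter_false_of_mem]
      · simp
      · intro j _ h3
        have := h.valid.rank_lt j
        omega
  refine (abs_add_le _ _).trans ((add_le_add (h.round_err k hk) hround).trans ?_)
  have hr' : (r : ℝ) ≤ C.players := by exact_mod_cast hr
  refine (sqrt_add_sqrt_le (by positivity) (roundConst_nonneg _) (sub_nonneg.2 h.pulls_ge)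
    (sub_nonneg.2 hr') (two_lt_two_pow h.phase_pos)).trans (le_of_eq ?_)
  rw [roundConst_succ h.phase_pos, Config.newPulls]
  congr 1
  push_cast
  ring

omit hG in
lemma sum_eq_end {k : Fin K} (hk : k ∈ C.active) :
    ∑ j, sums (t + C.rounds) ω j k =
      means ν k * C.newPulls + deviation ν k (t + C.rounds) ω := by
  have h1 := h.exploring.deviation_add h.valid h.players_le hk ν
  have h2 := h.sum_eq k hk
  change deviation ν k (t + C.rounds) ω = deviation ν k t ω +
    (∑ j, (sums (t + C.rounds) ω j k - sums t ω j k)) - _ at h1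
  rw [h1, Finset.sum_sub_distrib, h2, Config.newPulls]
  push_cast
  ring

omit hG in
lemma count_end {k : Fin K} (hk : k ∈ C.active) : count k (t + C.rounds) ω = C.newPulls := by
  rw [Config.rounds, h.exploring.count_add h.valid h.players_le hk, h.count_eq k hk]
  rfl

/-- With `S = √(N log T)`, the rewards deviate by at most `S` and the roundings by at most `√(3/2 ·
17/21) S ≤ 1.1021 S`. Their sum stays below `2.12 S`, which is at most `N` times the radius. -/
lemma accurate (hT2 : 2 ≤ T) (hT : t + C.rounds ≤ T) :
    (C.learn rank (C.stats t ω)).Accurate T (means ν) := by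
  intro k hk
  change k ∈ C.active at hk
  have hlog : 0 < Real.log T := Real.log_pos (by exact_mod_cast hT2)
  have hN : 0 < C.newPulls := Config.newPulls_pos h.valid
  have hN' : (0 : ℝ) < C.newPulls := by exact_mod_cast hN
  have h1 := h.round_err_end hG hT hk (Nat.zero_le _)
  simp only [Nat.zero_le, Finset.filter_true, Nat.cast_zero, zero_mul, sub_zero,
    Finset.sum_sub_distrib, h.sum_eq_end hk] at h1
  have h2 := hG.deviation (t + C.rounds) hT k
  rw [h.count_end hk] at h2
  set S := √(C.newPulls * Real.log T)
  have hS : 0 < S := Real.sqrt_pos.2 (by positivity)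
  have h3 : √(3 / 2 * Real.log T * (roundConst (C.phase + 1) * C.newPulls)) ≤ 1.1021 * S := by
    rw [Real.sqrt_le_left (by positivity), mul_pow, Real.sq_sqrt (by positivity)]
    have h4 : roundConst (C.phase + 1) * (Real.log T * C.newPulls) ≤
        17 / 21 * (Real.log T * C.newPulls) := by
      gcongr
      exact roundConst_le _
    have h5 : 0 < Real.log T * C.newPulls := by positivity
    linarith
  have h6 := mul_sqrt_le_mul_radius T hN
  change |((∑ j, (C.learn rank (C.stats t ω)).quant j k : ℕ) : ℝ) / C.newPulls - means ν k| <
    radius T C.newPulls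
  rw [div_sub' hN'.ne', abs_div, abs_of_pos hN', div_lt_iff₀ hN']
  push_cast
  have h7 := abs_le.1 h1
  have h8 := abs_le.1 h2
  rw [abs_lt]
  constructor <;> linarith [h7.1, h7.2, h8.1, h8.2]

/-- The effect of a phase that ends before the horizon. -/
lemma phase (hT2 : 2 ≤ T) (hT : t + C.rounds ≤ T) (hν : ∀ k, 0 ≤ means ν k) (hM : 1 ≤ M)
    (hMK : M ≤ K) :
    ∃ (l : ℕ) (C' : Config K M) (m' : Fin M → Mem K),
      l ≤ (C.phase + 1) * (C.players * (C.players * C.active.length)) ∧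
      C'.Correct rank (means ν) ∧ C'.Tight (means ν) (4 * radius T C'.pulls) ∧
      C'.phase = C.phase + 1 ∧ C'.pulls = C.newPulls ∧ C'.players ≤ C.players ∧
      C'.active ⊆ C.active ∧ (∀ i j, C'.players ≤ rank i → C'.players ≤ rank j →
        C'.exploited i = C'.exploited j → i = j) ∧
      (∀ j, C'.players ≤ rank j → stage (t + C.rounds + l) ω j = .exploit (C'.exploited j)) ∧
      (0 < C'.players → Tracked ν rank C' m' (t + C.rounds + l) ω) := by
  obtain ⟨l, m₁, hl, hQ, hact, hinact⟩ := communicate (T := T) h.valid h.players_le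
    (fun j hj k hk => quantize_lt (h.sums_end_mem hG j hk).2 _) h.stage_end h.exploring.agrees
    h.stage_end_inactive
  have hA := h.accurate hG hT2 hT
  change ∀ j, rank j < C.players → stage (t + C.rounds + l) ω j = (m₁ j).finishPhase T ∧
        Agrees rank (C.learn rank (C.stats t ω)) 0 j (m₁ j) at hact
  set L := C.learn rank (C.stats t ω) with hL
  have hLV : L.Valid rank := h.valid.learn _
  have hLC : L.Correct rank (means ν) := ⟨h.correct.card_eq, h.correct.exploited_mem⟩
  have hfin := fun j hj => (hact j hj).2.finishPhase_eq (T := T) hLV hj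
  -- Players who leave have no memory any more; a dummy is chosen for them to make `m'` total.
  have hmem : ∀ j, ∃ m' : Mem K, rank j < (L.next T rank).players →
      (m₁ j).finishPhase T = .explore m' 0 ∧
      Agrees rank (L.next T rank) (L.next T rank).players j m' := fun j => by
    by_cases hj : rank j < (L.next T rank).players
    · obtain ⟨m', hm'⟩ := (hfin j (hj.trans_le (Nat.sub_le _ _))).2 hj
      exact ⟨m', fun _ => hm'⟩
    · exact ⟨m₁ j, fun h => absurd h hj⟩
  choose m' hm' using hmem
  have hsub : (L.next T rank).active ⊆ C.active := fun k hk => List.mem_of_mem_filter hk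
  have hple : (L.next T rank).players ≤ C.players := Nat.sub_le _ _
  have hinactive : ∀ j, (L.next T rank).players ≤ rank j →
      stage (t + C.rounds + l) ω j = .exploit ((L.next T rank).exploited j) := fun j hj => by
    rcases lt_or_ge (rank j) C.players with h1 | h1
    · rw [(hact j h1).1, (hfin j h1).1 hj]
    · rw [hinact j h1]
      have h3 : (L.next T rank).exploited j = C.exploited j := by
        simp only [Config.next]
        exact if_neg (show ¬ rank j < L.players from not_lt.2 h1)
      rw [h3]
  refine ⟨l, L.next T rank, m', hl, hLC.next hLV hA hν hM hMK, hLC.next_tight hLV hA hM hMK,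
    rfl, rfl, hple, hsub, hLV.next_exploited_inj, hinactive, fun hpos => ?_⟩
  have hsums : ∀ j k, sums (t + C.rounds + l) ω j k = sums (t + C.rounds) ω j k := fun j k => by
    rw [hQ.sums_eq]
  refine ⟨hLV.next hT2 hpos, hple.trans h.players_le, ⟨fun j hj => ?_, fun j hj => (hm' j hj).2,
    hinactive⟩, Nat.le_add_left _ _, hLC.next hLV hA hν hM hMK, fun k hk => ?_, fun k hk => ?_,
    fun j k hk => ?_, ?_, fun k hk => ?_⟩
  · rw [(hact j (hj.trans_le hple)).1, (hm' j hj).1]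
  · rw [hQ.count_eq, h.count_end (hsub hk)]
    rfl
  · simp only [hsums]
    rw [h.sum_eq_end (hsub hk), hQ.deviation_eq]
    rfl
  · rw [hsums]
    exact h.sums_end_mem hG j (hsub hk)
  · have h1 := h.pulls_ge
    have h2 : ((L.next T rank).players : ℝ) ≤ C.players := by exact_mod_cast hple
    have h3 : ((L.next T rank).pulls : ℝ) = C.pulls + C.players * 2 ^ C.phase := by
      change ((C.pulls + C.players * 2 ^ C.phase : ℕ) : ℝ) = _
      push_cast; ring
    change _ * ((2 : ℝ) ^ (C.phase + 1) - 2) ≤ _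
    rw [h3]
    calc _ ≤ (C.players : ℝ) * ((2 : ℝ) ^ (C.phase + 1) - 2) := by
          gcongr
          exact (two_lt_two_pow h.phase_pos).le
      _ = C.players * ((2 : ℝ) ^ C.phase - 2) + C.players * 2 ^ C.phase := by ring
      _ ≤ _ := by linarith
  · simp only [hsums]
    exact h.round_err_end hG hT (hsub hk) hple

end Tracked


open SIC

variable {K M : ℕ} [NeZero K] {T T₀ : ℕ}

/-! ## The cost of a phase -/

/-- The rate of the regret caused by a suboptimal arm with gap `d`. -/
noncomputable def armRate (T : ℕ) (d : ℝ) : ℝ := minDiv (Real.log T) d √((T : ℝ) * Real.log T)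

/-- The rate that controls the number of phases when the gap is `d`. -/
noncomputable def phaseRate (T : ℕ) (d : ℝ) : ℝ := minDiv (Real.log T) (d ^ 2) T

lemma radius_eq (T : ℕ) {N : ℕ} (hN : 0 < N) : radius T N * √N = 3 * √(Real.log T / 2) := by
  have hN' : (0 : ℝ) < N := by exact_mod_cast hN
  have hL : 0 ≤ Real.log T := Real.log_natCast_nonneg T
  rw [radius, mul_assoc, ← Real.sqrt_mul (by positivity)]
  congr 2
  field_simp

lemma sqrt_half_log_le (T : ℕ) : √(Real.log T / 2) ≤ 0.7075 * √(Real.log T) := by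
  have hL : 0 ≤ Real.log T := Real.log_natCast_nonneg T
  rw [Real.sqrt_le_left (by positivity), mul_pow, Real.sq_sqrt hL]
  linarith

/-- Here `N` pulls precede a phase and `D` are added. The radius is of order `√(log T / N)`, so the
cost is a discrete derivative of `√(N log T)` and telescopes over phases. The condition `D ≤ 2 N`
keeps `√(N + D)` within the factor `√3` of `√N`; the constants multiply to `8 · 2.733 · 2.1225 <
48`. -/
lemma mul_radius_le {N D : ℕ} (hN : 0 < N) (hD : D ≤ 2 * N) :
    D * (2 * (4 * radius T N)) ≤
      48 * √(((N + D : ℕ) : ℝ) * Real.log T) - 48 * √(N * Real.log T) := by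
  have hN' : (0 : ℝ) < N := by exact_mod_cast hN
  have hD' : (D : ℝ) ≤ 2 * N := by exact_mod_cast hD
  have hL : 0 ≤ Real.log T := Real.log_natCast_nonneg T
  have h1 := radius_eq T hN
  have h2 := sqrt_half_log_le T
  rw [Real.sqrt_mul (Nat.cast_nonneg _), Real.sqrt_mul hN'.le]
  set l := √(Real.log T)
  set x := √(N : ℝ) with hx
  set y := √((N + D : ℕ) : ℝ) with hy
  have hl : 0 ≤ l := Real.sqrt_nonneg _
  have hx0 : 0 < x := Real.sqrt_pos.2 hN'
  have hxx : x ^ 2 = N := Real.sq_sqrt hN'.le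
  have hyy : y ^ 2 = N + D := by rw [hy, Real.sq_sqrt (Nat.cast_nonneg _)]; push_cast; ring
  have hy0 : 0 ≤ y := Real.sqrt_nonneg _
  have hxy : x ≤ y := Real.sqrt_le_sqrt (by push_cast; linarith [Nat.cast_nonneg (α := ℝ) D])
  have hyx : y ≤ 1.733 * x := abs_le_of_sq_le_sq' (by rw [mul_pow, hxx, hyy]; linarith)
    (by positivity) |>.2
  have hDxy : (D : ℝ) = (y - x) * (y + x) := by linear_combination hxx - hyy
  have h3 : radius T N * x ≤ 2.1225 * l := by rw [h1]; linarith
  have h4 : 0 ≤ radius T N := by unfold radius; positivity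
  calc D * (2 * (4 * radius T N)) = 8 * (y - x) * ((y + x) * radius T N) := by rw [hDxy]; ring
    _ ≤ 8 * (y - x) * (2.733 * x * radius T N) := by
        gcongr
        linarith
    _ = 8 * 2.733 * (y - x) * (radius T N * x) := by ring
    _ ≤ 8 * 2.733 * (y - x) * (2.1225 * l) := by
        gcongr
    _ ≤ 48 * ((y - x) * l) := by
        have : 0 ≤ (y - x) * l := mul_nonneg (by linarith) hl
        linarith
    _ = _ := by ring

/-- This caps the telescoped sum. An arm with gap `d` that is active after `N` pulls has `d ≤ 4`
radii, hence `√(N log T) ≤ 8.5 log T / d`; the coming phase at most triples the pulls. The constants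
give `48 · 1.733 · 8.5 < 720`. -/
lemma sqrt_le_armRate {N N' : ℕ} (hN : 0 < N) (hNT : N ≤ T) (hN' : N' ≤ 3 * N) {d : ℝ}
    (hd : 0 ≤ d) (hdN : d ≤ 4 * radius T N) :
    48 * √(N' * Real.log T) ≤ 720 * armRate T d := by
  have hL : 0 ≤ Real.log T := Real.log_natCast_nonneg T
  have hNp : (0 : ℝ) < N := by exact_mod_cast hN
  have hN'r : (N' : ℝ) ≤ 3 * N := by exact_mod_cast hN'
  have hNTr : (N : ℝ) ≤ T := by exact_mod_cast hNT
  have h1 : √(N' * Real.log T) ≤ 1.733 * √(N * Real.log T) := by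
    rw [Real.sqrt_le_left (by positivity), mul_pow, Real.sq_sqrt (by positivity)]
    have h := mul_le_mul_of_nonneg_right hN'r hL
    have h' := mul_nonneg hNp.le hL
    linarith
  have h2 : √(N * Real.log T) ≤ √(T * Real.log T) :=
    Real.sqrt_le_sqrt (mul_le_mul_of_nonneg_right hNTr hL)
  have h0 := Real.sqrt_nonneg (N * Real.log T)
  unfold armRate minDiv
  split_ifs with hd0
  · linarith
  · have h3 : √(N * Real.log T) ≤ 8.5 * (Real.log T / d) := by
      rw [← mul_div_assoc, le_div_iff₀ (lt_of_le_of_ne hd (Ne.symm hd0))]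
      have h4 := radius_eq T hN
      have h5 := sqrt_half_log_le T
      rw [Real.sqrt_mul hNp.le]
      calc √(N : ℝ) * √(Real.log T) * d
          ≤ √(N : ℝ) * √(Real.log T) * (4 * radius T N) := by gcongr
        _ = 4 * √(Real.log T) * (radius T N * √(N : ℝ)) := by ring
        _ = 4 * √(Real.log T) * (3 * √(Real.log T / 2)) := by rw [h4]
        _ ≤ 4 * √(Real.log T) * (3 * (0.7075 * √(Real.log T))) := by gcongr
        _ = 8.49 * (√(Real.log T) * √(Real.log T)) := by ring
        _ ≤ _ := by rw [Real.mul_self_sqrt hL]; linarith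
    rcases min_cases (Real.log T / d) √(T * Real.log T) with ⟨h, _⟩ | ⟨h, _⟩ <;> rw [h] <;> linarith

/-- A gap below four radii means `d² N ≤ 72 log T`. This limits the number of phases. -/
lemma pow_le_phaseRate {N p : ℕ} (hN : 0 < N) (hNT : N ≤ T) (hp : (2 : ℝ) ^ (p - 1) ≤ N) {d : ℝ}
    (hd : 0 ≤ d) (hdN : d ≤ 4 * radius T N) : (2 : ℝ) ^ (p - 1) ≤ 72 * phaseRate T d := by
  have hL : 0 ≤ Real.log T := Real.log_natCast_nonneg T
  have hNp : (0 : ℝ) < N := by exact_mod_cast hN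
  have hNTr : (N : ℝ) ≤ T := by exact_mod_cast hNT
  refine hp.trans ?_
  unfold phaseRate minDiv
  split_ifs with hd0
  · linarith
  · have h3 : (N : ℝ) ≤ 72 * (Real.log T / d ^ 2) := by
      rw [← mul_div_assoc, le_div_iff₀ (lt_of_le_of_ne (sq_nonneg d) (Ne.symm hd0))]
      have h4 : d ^ 2 ≤ (4 * radius T N) ^ 2 := by gcongr
      have h5 : (4 * radius T N) ^ 2 * N = 72 * Real.log T := by
        rw [radius, mul_pow, mul_pow, Real.sq_sqrt (by positivity)]
        field_simp
        ring
      have h6 := mul_le_mul_of_nonneg_right h4 hNp.le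
      linarith
    rcases min_cases (Real.log T / d ^ 2) (T : ℝ) with ⟨h, _⟩ | ⟨h, _⟩ <;> rw [h] <;> linarith

lemma log_phaseRate_ge (hT : 8 ≤ T) {d : ℝ} (hd : 0 ≤ d) (hd1 : d ≤ 1) :
    0.7 ≤ Real.log (phaseRate T d) ∧ 2.07 ≤ phaseRate T d := by
  have hTr : (8 : ℝ) ≤ T := by exact_mod_cast hT
  have h8 : 2.07 ≤ Real.log T := by
    have h1 : Real.log 8 = 3 * Real.log 2 := by
      rw [show (8 : ℝ) = 2 ^ 3 by norm_num, Real.log_pow]; norm_num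
    have h2 := Real.log_le_log (by norm_num) hTr
    have h3 := Real.log_two_gt_d9
    linarith
  have h2 : 2.07 ≤ phaseRate T d := by
    unfold phaseRate minDiv
    split_ifs with hd0
    · linarith
    · refine le_min ?_ (by linarith)
      rw [le_div_iff₀ (lt_of_le_of_ne (sq_nonneg d) (Ne.symm hd0))]
      have : d ^ 2 ≤ 1 := pow_le_one₀ hd hd1
      linarith
  refine ⟨?_, h2⟩
  have h3 := Real.log_two_gt_d9
  have h4 : Real.log 2.07 = Real.log 2 + Real.log 1.035 := by
    rw [← Real.log_mul (by norm_num) (by norm_num)]; norm_num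
  have h5 := Real.one_sub_inv_le_log_of_pos (show (0 : ℝ) < 1.035 by norm_num)
  have h6 := Real.log_le_log (by norm_num) h2
  norm_num at h5
  linarith

/-- Taking logarithms, `p ≤ 8 + log R / log 2` with `R` the rate; `log R ≥ 0.7` absorbs the additive
constant into the factor `16`. This is why horizons below `8` are treated apart. -/
lemma add_two_le_log_phaseRate (hT : 8 ≤ T) {p : ℕ} (hp : 1 ≤ p) {d : ℝ} (hd : 0 ≤ d)
    (hd1 : d ≤ 1) (h : (2 : ℝ) ^ (p - 1) ≤ 72 * phaseRate T d) :
    (p : ℝ) + 2 ≤ 16 * Real.log (phaseRate T d) := by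
  obtain ⟨h1, h2⟩ := log_phaseRate_ge hT hd hd1
  have h3 := Real.log_le_log (by positivity) h
  rw [Real.log_pow, Real.log_mul (by norm_num) (by linarith), Nat.cast_sub hp] at h3
  have h4 : Real.log 72 ≤ 7 * Real.log 2 := by
    have := Real.log_le_log (show (0 : ℝ) < 72 by norm_num) (show (72 : ℝ) ≤ 2 ^ 7 by norm_num)
    rwa [Real.log_pow] at this
  have h5 := Real.log_two_gt_d9
  have h6 := Real.log_two_lt_d9
  push_cast at h3
  by_contra! h7
  nlinarith

/-! ### The regret of one phase and its summation over the phases -/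

section Gap

variable {ν : Fin K → Measure ℝ} {rank : Fin M → ℕ} {C : Config K M} {m : Fin M → Mem K}
  {t : ℕ} {ω : Game K M T T₀}

lemma gap_eq (hMK : M ≤ K) (t : ℕ) (ω : Game K M T T₀) :
    gap (sicMMAB K T T₀) M ν t ω =
      ∑ k ∈ topArms (means ν) M, means ν k - ∑ j, reward (means ν) (pulled t ω) j := by
  rw [gap, sum_topArms hMK]
  rfl

lemma gap_nonneg (hν : ∀ k, 0 ≤ means ν k) (hM : 1 ≤ M) (hMK : M ≤ K) (t : ℕ)
    (ω : Game K M T T₀) : 0 ≤ gap (sicMMAB K T T₀) M ν t ω := by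
  rw [gap_eq hMK]
  exact sub_nonneg.2 (sum_reward_le hν hM hMK _)

/-- Once every player exploits one of the best arms, there is no more regret. -/
lemma gap_eq_zero_of_exploit (hMK : M ≤ K) {e : Fin M → Fin K} (he : Function.Injective e)
    (hmem : ∀ j, e j ∈ topArms (means ν) M) (h : ∀ j, stage t ω j = .exploit (e j)) {u : ℕ}
    (hu : t ≤ u) : gap (sicMMAB K T T₀) M ν u ω = 0 := by
  have h1 : ∀ j, stage u ω j = .exploit (e j) := by
    induction u, hu using Nat.le_induction with
    | base => exact h
    | succ u _ ih => exact fun j => by rw [stage_succ, ih j]; rfl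
  have h2 : pulled u ω = e := funext fun j => by rw [pulled_eq, h1 j]; rfl
  have h3 : Finset.univ.image e = topArms (means ν) M :=
    Finset.eq_of_subset_of_card_le (Finset.image_subset_iff.2 fun j _ => hmem j) (by
      rw [card_topArms hMK, Finset.card_image_of_injective _ he]; simp)
  rw [gap_eq hMK, h2, ← h3, Finset.sum_image fun i _ j _ hij => he hij, sub_eq_zero]
  exact Finset.sum_congr rfl fun j _ => (reward_of_injective he _ j).symm

/-- The inactive players occupy exactly the top arms that are no longer active, so they cause no
regret. -/
lemma Config.Valid.sum_exploited (hC : C.Valid rank) (hP : C.players ≤ M) (hMK : M ≤ K)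
    {μ : Fin K → ℝ} (h : C.Correct rank μ) :
    ∑ j ∈ Finset.univ.filter (fun j => C.players ≤ rank j), μ (C.exploited j) =
      ∑ k ∈ topArms μ M \ C.active.toFinset, μ k := by
  have hinj : Set.InjOn C.exploited (Finset.univ.filter fun j => C.players ≤ rank j) := by
    intro i hi j hj hij
    simp only [Finset.coe_filter, Finset.mem_univ, true_and, Set.mem_ofPred_eq] at hi hj
    exact hC.exploited_inj i j hi hj hij
  rw [← Finset.sum_image hinj]
  congr 1
  refine Finset.eq_of_subset_of_card_le (Finset.image_subset_iff.2 fun j hj => ?_) ?_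
  · have hj' := (Finset.mem_filter.1 hj).2
    rw [Finset.mem_sdiff, List.mem_toFinset]
    exact ⟨h.exploited_mem j hj', hC.exploited_notMem j hj'⟩
  · rw [Finset.card_image_of_injOn hinj]
    have h1 := Finset.card_sdiff_add_card_inter (topArms μ M) C.active.toFinset
    rw [h.card_eq, card_topArms hMK] at h1
    have h2 := Finset.card_filter_add_card_filter_not (s := (Finset.univ : Finset (Fin M)))
      (fun j => rank j < C.players)
    rw [hC.card_players hP] at h2
    simp only [not_lt, Finset.card_univ, Fintype.card_fin] at h2
    omega

/-- With `P` active players and `S` bad active arms there are `S + P` active arms, each pulled `2 ^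
p` times by each active player. The regret is therefore `2 ^ p (S Σ_good μ - P Σ_bad μ)`. Both sums
are compared with the threshold up to `w`, which gives `2 ^ p · S P · 2 w`. -/
lemma Tracked.sum_gap_exploration (h : Tracked ν rank C m t ω) (hν : ∀ k, 0 ≤ means ν k)
    (hM : 1 ≤ M) (hMK : M ≤ K) {w : ℝ} (hw : C.Tight (means ν) w) :
    ∑ u ∈ Finset.range C.rounds, gap (sicMMAB K T T₀) M ν (t + u) ω ≤
      ((C.active.toFinset \ topArms (means ν) M).card : ℝ) *
        ((C.players * 2 ^ C.phase : ℕ) * (2 * w)) := by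
  set μ := means ν
  set A := C.active.toFinset
  have h1 := h.exploring.sum_reward h.valid h.players_le μ
  rw [h.valid.sum_exploited h.players_le hMK h.correct] at h1
  simp only [gap_eq hMK]
  rw [Finset.sum_sub_distrib, Config.rounds, h1]
  have h2 := Finset.sum_inter_add_sum_sdiff (topArms μ M) A μ
  have h3 := Finset.sum_inter_add_sum_sdiff A (topArms μ M) μ
  rw [Finset.inter_comm] at h3
  have h4 : ∑ k ∈ topArms μ M ∩ A, μ k ≤ C.players * (orderStat μ (M + 1) + w) := by
    have := Finset.sum_le_card_nsmul (topArms μ M ∩ A) μ (orderStat μ (M + 1) + w) fun k hk => by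
      obtain ⟨hk1, hk2⟩ := Finset.mem_inter.1 hk
      have := hw.top_le k hk1 (List.mem_toFinset.1 hk2)
      linarith
    rwa [h.correct.card_eq, nsmul_eq_mul] at this
  have h5 : ((A \ topArms μ M).card : ℝ) * (orderStat μ M - w) ≤ ∑ k ∈ A \ topArms μ M, μ k := by
    have := Finset.card_nsmul_le_sum (A \ topArms μ M) μ (orderStat μ M - w) fun k hk => by
      obtain ⟨hk1, hk2⟩ := Finset.mem_sdiff.1 hk
      have := hw.le_bot k hk2 (List.mem_toFinset.1 hk1)
      linarith
    rwa [nsmul_eq_mul] at this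
  have h6 : ((A \ topArms μ M).card : ℝ) + C.players = C.active.length := by
    exact_mod_cast h.correct.card_sdiff h.valid
  have h7 := orderStat_antitone hν hM (Nat.le_succ M)
  rw [Finset.sum_const, Finset.card_range, nsmul_eq_mul, ← h2, ← h3]
  push_cast
  rw [← h6]
  set S := ((A \ topArms μ M).card : ℝ)
  have hS : 0 ≤ S := Nat.cast_nonneg _
  have hP : (0 : ℝ) ≤ C.players := Nat.cast_nonneg _
  have h8 := mul_le_mul_of_nonneg_left h4 hS
  have h9 := mul_le_mul_of_nonneg_left h5 hP
  have h10 := mul_le_mul_of_nonneg_left h7 (mul_nonneg hS hP)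
  have h11 : S * (∑ k ∈ topArms μ M ∩ A, μ k) - C.players * ∑ k ∈ A \ topArms μ M, μ k ≤
      S * (C.players * (2 * w)) := by
    linarith
  have h12 := mul_le_mul_of_nonneg_left h11 (show (0 : ℝ) ≤ 2 ^ C.phase by positivity)
  linarith

lemma Tracked.pulls_le (h : Tracked ν rank C m t ω) : C.pulls ≤ t := by
  obtain ⟨k, hk⟩ := List.exists_mem_of_length_pos h.valid.length_pos
  rw [← h.count_eq k hk]
  exact count_le _ _ _

/-- From `p ≥ 2` on, `2 ^ p - 2 ≥ 2 ^ p / 2`: a new phase adds at most twice the pulls already made.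
The first phase has no earlier pulls and is charged separately. -/
lemma Tracked.pow_le_pulls (h : Tracked ν rank C m t ω) (hp : 2 ≤ C.phase) :
    C.players * 2 ^ C.phase ≤ 2 * C.pulls := by
  have h1 := h.pulls_ge
  obtain ⟨p, hp'⟩ := Nat.exists_eq_add_of_le hp
  have h2 : (4 : ℝ) ≤ 2 ^ C.phase := by
    rw [hp', pow_add]
    have : (1 : ℝ) ≤ 2 ^ p := one_le_pow₀ (by norm_num)
    linarith
  have h3 := mul_le_mul_of_nonneg_left h2 (Nat.cast_nonneg (α := ℝ) C.players)
  have h4 : (C.players : ℝ) * 2 ^ C.phase ≤ 2 * C.pulls := by linarith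
  exact_mod_cast h4

lemma Tracked.pulls_pos (h : Tracked ν rank C m t ω) (hp : 2 ≤ C.phase) : 0 < C.pulls := by
  have h1 := h.pow_le_pulls hp
  have h2 : 0 < C.players * 2 ^ C.phase := Nat.mul_pos h.valid.players_pos (by positivity)
  omega

lemma Tracked.two_pow_le_pulls (h : Tracked ν rank C m t ω) (hp : 2 ≤ C.phase) :
    (2 : ℝ) ^ (C.phase - 1) ≤ C.pulls := by
  have h1 := h.pow_le_pulls hp
  have h2 := Nat.le_mul_of_pos_left (2 ^ C.phase) h.valid.players_pos
  obtain ⟨p, hp'⟩ : ∃ p, C.phase = p + 1 := ⟨C.phase - 1, by omega⟩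
  rw [hp', pow_succ] at h1 h2
  rw [hp', Nat.add_sub_cancel]
  have h3 : 2 ^ p ≤ C.pulls := by omega
  exact_mod_cast h3

/-- While a player is active some top arm is active too, and its gap to the `(M+1)`-th mean is at
least the gap between the `M`-th and the `(M+1)`-th. -/
lemma Tracked.gap_le_of_tight (h : Tracked ν rank C m t ω) (hM : 1 ≤ M) (hMK : M ≤ K) {w : ℝ}
    (hw : C.Tight (means ν) w) : orderStat (means ν) M - orderStat (means ν) (M + 1) ≤ w := by
  have h1 : 0 < (topArms (means ν) M ∩ C.active.toFinset).card := by
    rw [h.correct.card_eq]; exact h.valid.players_pos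
  obtain ⟨a, ha⟩ := Finset.card_pos.1 h1
  obtain ⟨ha1, ha2⟩ := Finset.mem_inter.1 ha
  have h2 := hw.top_le a ha1 (List.mem_toFinset.1 ha2)
  have h3 := le_of_mem_topArms hM hMK ha1
  linarith

lemma sum_range_gap_le (hν : ∀ k, ∀ᵐ x ∂(ν k), x ∈ Set.Icc (0 : ℝ) 1)
    [∀ k, IsProbabilityMeasure (ν k)] (t l : ℕ) (ω : Game K M T T₀) :
    ∑ u ∈ Finset.range l, gap (sicMMAB K T T₀) M ν (t + u) ω ≤ M * l := by
  have := Finset.sum_le_card_nsmul (Finset.range l)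
    (fun u => gap (sicMMAB K T T₀) M ν (t + u) ω) M fun u _ => (gap_mem hν _ ω).2
  rw [Finset.card_range, nsmul_eq_mul] at this
  linarith

/-- The regret of a phase that is followed by an all-exploiting state or by a later phase. -/
lemma Tracked.sum_gap_le_phase (h : Tracked ν rank C m t ω) (hG : Good ν ω) (hT2 : 2 ≤ T)
    [∀ k, IsProbabilityMeasure (ν k)] (hν : ∀ k, ∀ᵐ x ∂(ν k), x ∈ Set.Icc (0 : ℝ) 1)
    (hM : 1 ≤ M) (hMK : M ≤ K) {E F : ℝ} (hF : 0 ≤ F)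
    (hE : ∑ u ∈ Finset.range C.rounds, gap (sicMMAB K T T₀) M ν (t + u) ω ≤ E)
    (hnext : ∀ t' C' m', t < t' → t' ≤ T → Tracked ν rank C' m' t' ω →
      C'.Tight (means ν) (4 * radius T C'.pulls) → C'.phase = C.phase + 1 →
      C'.pulls = C.newPulls → C'.active ⊆ C.active →
      ∑ u ∈ Finset.Ico t' T, gap (sicMMAB K T T₀) M ν u ω ≤ F) :
    ∑ u ∈ Finset.Ico t T, gap (sicMMAB K T T₀) M ν u ω ≤
      E + (C.phase + 1) * (K * (M : ℝ) ^ 3) + F := by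
  have hν0 := fun k => (means_mem hν k).1
  have hnn := fun u => gap_nonneg hν0 hM hMK u ω
  have hsub : ∀ a b c : ℕ, b ≤ c → ∑ u ∈ Finset.Ico a b, gap (sicMMAB K T T₀) M ν u ω ≤
      ∑ u ∈ Finset.Ico a c, gap (sicMMAB K T T₀) M ν u ω := fun a b c hbc =>
    Finset.sum_le_sum_of_subset_of_nonneg (Finset.Ico_subset_Ico_right hbc) fun u _ _ => hnn u
  have hE' : ∑ u ∈ Finset.Ico t (t + C.rounds), gap (sicMMAB K T T₀) M ν u ω ≤ E := by
    rwa [Finset.sum_Ico_eq_sum_range, Nat.add_sub_cancel_left]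
  have hX : 0 ≤ ((C.phase : ℝ) + 1) * (K * (M : ℝ) ^ 3) := by positivity
  -- If the horizon interrupts a procedure, nonnegativity of the pseudo-regret lets the sum be
  -- extended to its end.
  rcases lt_or_ge T (t + C.rounds) with hT | hT
  · linarith [hsub t T _ hT.le]
  obtain ⟨l, C', m', hl, hcor, htight, hphase, hpulls, -, hact, hinj, hexp, htr⟩ :=
    h.phase hG hT2 hT hν0 hM hMK
  have hcomm : ∑ u ∈ Finset.Ico (t + C.rounds) (t + C.rounds + l),
      gap (sicMMAB K T T₀) M ν u ω ≤ (C.phase + 1) * (K * (M : ℝ) ^ 3) := by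
    rw [Finset.sum_Ico_eq_sum_range, Nat.add_sub_cancel_left]
    refine (sum_range_gap_le hν _ l ω).trans ?_
    have h1 : C.active.length ≤ K := by
      simpa using h.valid.nodup.length_le_card
    have h2 : l ≤ (C.phase + 1) * (M * (M * K)) :=
      hl.trans (by gcongr <;> exact h.players_le)
    have h3 : (l : ℝ) ≤ (C.phase + 1) * (M * (M * K)) := by exact_mod_cast h2
    calc (M : ℝ) * l ≤ M * ((C.phase + 1) * (M * (M * K))) := by gcongr
      _ = _ := by ring
  have hfirst : ∑ u ∈ Finset.Ico t (t + C.rounds + l), gap (sicMMAB K T T₀) M ν u ω ≤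
      E + (C.phase + 1) * (K * (M : ℝ) ^ 3) := by
    rw [← Finset.sum_Ico_consecutive _ (Nat.le_add_right t C.rounds) (Nat.le_add_right _ l)]
    linarith
  rcases lt_or_ge T (t + C.rounds + l) with hT' | hT'
  · linarith [hsub t T _ hT'.le]
  rw [← Finset.sum_Ico_consecutive _ (show t ≤ t + C.rounds + l by omega) hT']
  refine add_le_add hfirst ?_
  rcases Nat.eq_zero_or_pos C'.players with h0 | h0
  -- No active player is left: all exploit distinct top arms, and the remaining regret vanishes.
  · refine (Finset.sum_eq_zero fun u hu => ?_).trans_le hF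
    refine gap_eq_zero_of_exploit hMK (e := C'.exploited) (fun i j hij => hinj i j ?_ ?_ hij)
      (fun j => hcor.exploited_mem j ?_) (fun j => hexp j ?_) (Finset.mem_Ico.1 hu).1 <;> omega
  · exact hnext _ C' m' (by have := h.rounds_pos; omega) hT' (htr h0) htight hphase hpulls hact

/-- The regret from a phase with tight gaps on. -/
lemma Tracked.sum_gap_le (h : Tracked ν rank C m t ω) (hG : Good ν ω) (hT8 : 8 ≤ T)
    [∀ k, IsProbabilityMeasure (ν k)] (hν : ∀ k, ∀ᵐ x ∂(ν k), x ∈ Set.Icc (0 : ℝ) 1)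
    (hM : 1 ≤ M) (hMK : M ≤ K) (htT : t ≤ T) (hp : 2 ≤ C.phase)
    (hw : C.Tight (means ν) (4 * radius T C.pulls)) {Q : ℝ}
    (hQ : Q = 16 * Real.log
      (phaseRate T (orderStat (means ν) M - orderStat (means ν) (M + 1)))) :
    ∑ u ∈ Finset.Ico t T, gap (sicMMAB K T T₀) M ν u ω ≤
      ∑ b ∈ C.active.toFinset \ topArms (means ν) M,
        (720 * armRate T (orderStat (means ν) M - means ν b) - 48 * √(C.pulls * Real.log T)) +
      K * (M : ℝ) ^ 3 / 2 * (Q ^ 2 - C.phase * (C.phase + 1)) := by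
  -- The right-hand side is a potential. An exploration phase pays its regret with the growth of
  -- `√(pulls · log T)`, and a communication phase pays `p + 1 = ((p+1)(p+2) - p(p+1)) / 2`.
  induction hn : T - t using Nat.strong_induction_on generalizing t C m with
  | _ n ih =>
  have hν0 := fun k => (means_mem hν k).1
  have hpos := h.pulls_pos hp
  have hpow := h.pow_le_pulls hp
  have hNT := h.pulls_le.trans htT
  have hd0 : 0 ≤ orderStat (means ν) M - orderStat (means ν) (M + 1) :=
    sub_nonneg.2 (orderStat_antitone hν0 hM (Nat.le_succ M))
  have hd1 : orderStat (means ν) M - orderStat (means ν) (M + 1) ≤ 1 := by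
    linarith [(orderStat_mem hν M).2, (orderStat_mem hν (M + 1)).1]
  have hpQ : (C.phase : ℝ) + 2 ≤ Q := by
    rw [hQ]
    exact add_two_le_log_phaseRate hT8 h.phase_pos hd0 hd1
      (pow_le_phaseRate hpos hNT (h.two_pow_le_pulls hp) hd0 (h.gap_le_of_tight hM hMK hw))
  -- The potential of each bad arm stays nonnegative after the phase, so arms that are rejected can
  -- be dropped from the sum.
  have hrate : ∀ b ∈ C.active.toFinset \ topArms (means ν) M,
      0 ≤ 720 * armRate T (orderStat (means ν) M - means ν b) -
        48 * √(C.newPulls * Real.log T) := fun b hb => by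
    obtain ⟨hb1, hb2⟩ := Finset.mem_sdiff.1 hb
    refine sub_nonneg.2 (sqrt_le_armRate hpos hNT (by rw [Config.newPulls]; omega)
      (sub_nonneg.2 (le_orderStat_of_notMem_topArms hν0 hM hb2))
      (hw.le_bot b hb2 (List.mem_toFinset.1 hb1)))
  have hE : ∑ u ∈ Finset.range C.rounds, gap (sicMMAB K T T₀) M ν (t + u) ω ≤
      ∑ b ∈ C.active.toFinset \ topArms (means ν) M,
        (48 * √(C.newPulls * Real.log T) - 48 * √(C.pulls * Real.log T)) := by
    refine (h.sum_gap_exploration hν0 hM hMK hw).trans ?_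
    rw [Finset.sum_const, nsmul_eq_mul]
    gcongr
    exact mul_radius_le hpos hpow
  have hKM : 0 ≤ K * (M : ℝ) ^ 3 / 2 := by positivity
  -- The communication potential remains nonnegative because `p + 2 ≤ Q` as long as a phase takes
  -- place.
  have hQ2 : 0 ≤ Q ^ 2 - (C.phase + 1) * (C.phase + 2) := by
    have : ((C.phase : ℝ) + 2) ^ 2 ≤ Q ^ 2 := by gcongr
    nlinarith [Nat.cast_nonneg (α := ℝ) C.phase]
  have := h.sum_gap_le_phase hG (by omega) hν hM hMK
    (F := ∑ b ∈ C.active.toFinset \ topArms (means ν) M,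
        (720 * armRate T (orderStat (means ν) M - means ν b) - 48 * √(C.newPulls * Real.log T)) +
      K * (M : ℝ) ^ 3 / 2 * (Q ^ 2 - (C.phase + 1) * (C.phase + 2)))
    (add_nonneg (Finset.sum_nonneg hrate) (mul_nonneg hKM hQ2)) hE
    fun t' C' m' ht' htT' h' hw' hph hpu hact => by
      refine (ih (T - t') (by omega) h' htT' (by omega) hw' rfl).trans ?_
      rw [hph, hpu]
      refine add_le_add (Finset.sum_le_sum_of_subset_of_nonneg
        (Finset.sdiff_subset_sdiff (fun k hk => ?_) le_rfl) fun b hb _ => hrate b hb)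
        (le_of_eq (by push_cast; ring))
      exact List.mem_toFinset.2 (hact (List.mem_toFinset.1 hk))
  refine this.trans (le_of_eq ?_)
  simp only [Finset.sum_sub_distrib]
  ring

end Gap


open SIC

variable {K M : ℕ} [NeZero K] {T T₀ : ℕ}

/-! ## The total regret -/

/-- The configuration at the start of the first phase. -/
def Config.first (K M : ℕ) [NeZero K] : Config K M where
  phase := 1
  players := M
  pulls := 0
  active := List.finRange K
  quant := 0
  exploited := 0

lemma tracked_first {ν : Fin K → Measure ℝ} {ω : Game K M T T₀} (hM : 1 ≤ M) (hMK : M ≤ K)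
    {k : Fin M → Fin K} (hk : Function.Injective k)
    (h0 : ∀ j, stage T₀ ω j = .estim (k j) 0 1 0 ∧ sums T₀ ω j = 0) :
    Tracked ν (internalRank k) (Config.first K M) (fun j => Mem.first M (internalRank k j))
      (T₀ + 2 * K) ω := by
  have hlt := internalRank_lt k
  have hnot : ∀ j, ¬ (Config.first K M).players ≤ internalRank k j := fun j => not_le.2 (hlt j)
  have hsums : ∀ j, sums (T₀ + 2 * K) ω j = 0 := fun j => (stage_after_estim ω hk h0 j).2
  have hcount : ∀ a, count a (T₀ + 2 * K) ω = 0 := fun a => Finset.sum_eq_zero fun u hu =>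
    if_neg fun ⟨j, hj⟩ => not_explores_of_lt ω hk h0 (Finset.mem_range.1 hu) j a hj
  have hdev : ∀ a, deviation ν a (T₀ + 2 * K) ω = 0 := fun a => Finset.sum_eq_zero fun u hu =>
    if_neg fun ⟨j, hj⟩ => not_explores_of_lt ω hk h0 (Finset.mem_range.1 hu) j a hj
  refine ⟨⟨internalRank_injective hk, hlt, List.nodup_finRange K, hM, ?_,
      fun j hj => absurd hj (hnot j), fun i _ hi _ _ => absurd hi (hnot i)⟩, le_rfl,
    ⟨fun j _ => (stage_after_estim ω hk h0 j).1, fun j _ => ⟨rfl, rfl, rfl, rfl, fun _ _ => rfl,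
      List.length_replicate, fun i hi => absurd hi (hnot i)⟩, fun j hj => absurd hj (hnot j)⟩,
    le_rfl, ⟨?_, fun j hj => absurd hj (hnot j)⟩, fun a _ => hcount a, fun a _ => ?_,
    fun j a _ => ?_, ?_, fun a _ => ?_⟩
  · simpa [Config.first] using hMK
  · simpa [Config.first] using card_topArms hMK
  · simp [hsums, hdev, Config.first]
  · norm_num [hsums, Config.first]
  · norm_num [Config.first]
  · rw [Finset.filter_false_of_mem fun j _ => hnot j]
    simp

lemma armRate_nonneg (T : ℕ) {d : ℝ} (hd : 0 ≤ d) : 0 ≤ armRate T d := by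
  have hL : 0 ≤ Real.log T := Real.log_natCast_nonneg T
  unfold armRate minDiv
  split_ifs
  · positivity
  · exact le_min (by positivity) (by positivity)

section Total

variable {ν : Fin K → Measure ℝ} [∀ k, IsProbabilityMeasure (ν k)]
  (hν : ∀ k, ∀ᵐ x ∂(ν k), x ∈ Set.Icc (0 : ℝ) 1) (hM : 1 ≤ M) (hMK : M ≤ K)
include hν hM hMK

/-- The pseudo-regret on the good event. -/
lemma sum_gap_le_of_good {ω : Game K M T T₀} (hG : Good ν ω) (hT8 : 8 ≤ T) (hT₀ : 0 < T₀)
    (hT : T₀ + 2 * K ≤ T) :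
    ∑ u ∈ Finset.range T, gap (sicMMAB K T T₀) M ν u ω ≤
      720 * ∑ k ∈ Finset.Icc (M + 1) K,
        armRate T (orderStat (means ν) M - orderStat (means ν) k) +
      M * (T₀ + 4 * K) +
      140 * (K * (M : ℝ) ^ 3 * Real.log
        (phaseRate T (orderStat (means ν) M - orderStat (means ν) (M + 1))) ^ 2) := by
  have hν0 := fun k => (means_mem hν k).1
  have hd0 : 0 ≤ orderStat (means ν) M - orderStat (means ν) (M + 1) :=
    sub_nonneg.2 (orderStat_antitone hν0 hM (Nat.le_succ M))
  have hd1 : orderStat (means ν) M - orderStat (means ν) (M + 1) ≤ 1 := by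
    linarith [(orderStat_mem hν M).2, (orderStat_mem hν (M + 1)).1]
  have hlog := (log_phaseRate_ge hT8 hd0 hd1).1
  set l := Real.log (phaseRate T (orderStat (means ν) M - orderStat (means ν) (M + 1))) with hl
  obtain ⟨k, hk, h0⟩ := exists_externalRank hT₀ ω hG.chairs
  have h := tracked_first (ν := ν) hM hMK hk h0
  have hKM : 0 ≤ K * (M : ℝ) ^ 3 := by positivity
  have hrate : ∀ b ∈ (topArms (means ν) M)ᶜ,
      0 ≤ 720 * armRate T (orderStat (means ν) M - means ν b) := fun b hb =>
    mul_nonneg (by norm_num) (armRate_nonneg T (sub_nonneg.2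
      (le_orderStat_of_notMem_topArms hν0 hM (Finset.mem_compl.1 hb))))
  -- The first phase starts without confidence bounds, so its `2K` exploration rounds are charged at
  -- `M` each; the potential argument applies from phase two on.
  have hphases := h.sum_gap_le_phase hG (by omega) hν hM hMK
    (F := ∑ b ∈ (topArms (means ν) M)ᶜ, 720 * armRate T (orderStat (means ν) M - means ν b) +
      K * (M : ℝ) ^ 3 / 2 * (16 * l) ^ 2)
    (add_nonneg (Finset.sum_nonneg hrate) (by positivity)) (sum_range_gap_le hν _ _ ω)
    fun t' C' m' _ htT' h' hw' hph _ _ => by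
      refine (h'.sum_gap_le hG hT8 hν hM hMK htT' (by rw [hph]; rfl) hw' rfl).trans
        (add_le_add ?_ (mul_le_mul_of_nonneg_left ?_ (by positivity)))
      · refine (Finset.sum_le_sum fun b _ => sub_le_self _ (by positivity)).trans
          (Finset.sum_le_sum_of_subset_of_nonneg (fun b hb => ?_) fun b hb _ => hrate b hb)
        exact Finset.mem_compl.2 (Finset.mem_sdiff.1 hb).2
      · exact sub_le_self _ (by positivity)
  have hinit := sum_range_gap_le hν 0 (T₀ + 2 * K) ω
  simp only [zero_add] at hinit
  rw [← Finset.sum_range_add_sum_Ico _ hT]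
  rw [sum_topArms_compl (μ := means ν) fun x => armRate T (orderStat (means ν) M - x),
    Finset.mul_sum]
  have hrounds : (Config.first K M).rounds = K * 2 := by
    simp [Config.rounds, Config.first]
  rw [hrounds, show (Config.first K M).phase = 1 from rfl] at hphases
  push_cast at hphases hinit
  -- The first communication phase costs `2 K M³ ≤ (2 / 0.49) K M³ l²`; added to `16² / 2 = 128`,
  -- this stays below `140`.
  have h1 : K * (M : ℝ) ^ 3 * 0.49 ≤ K * (M : ℝ) ^ 3 * l ^ 2 := by
    gcongr
    nlinarith
  linarith

lemma regret_le_mul (T T₀ : ℕ) : regret (sicMMAB K T T₀) M T ν ≤ M * T := by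
  have h := regret_le_of_bound (sicMMAB_isMeasurable (K := K) (T := T) (T₀ := T₀)) hν T
    (M := M) (δ := 0) (D := M * T) le_rfl (by positivity) (B := ∅) (by simp) fun ω _ _ => by
      simpa using sum_range_gap_le hν 0 T ω
  simpa using h

lemma regret_le (hT : 2 ≤ T) :
    regret (sicMMAB K T ⌈(K : ℝ) * Real.log T⌉₊) M T ν ≤
      720 * ∑ k ∈ Finset.Icc (M + 1) K,
        armRate T (orderStat (means ν) M - orderStat (means ν) k) +
      20 * (K * M * Real.log T) +
      140 * (K * (M : ℝ) ^ 3 * Real.log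
        (phaseRate T (orderStat (means ν) M - orderStat (means ν) (M + 1))) ^ 2) := by
  have hν0 := fun k => (means_mem hν k).1
  set T₀ := ⌈(K : ℝ) * Real.log T⌉₊ with hT₀
  have hK : (1 : ℝ) ≤ K := by exact_mod_cast hM.trans hMK
  have hMr : (1 : ℝ) ≤ M := by exact_mod_cast hM
  have hTr : (2 : ℝ) ≤ T := by exact_mod_cast hT
  have hlog : 0.69 ≤ Real.log T := by
    have h1 := Real.log_le_log (by norm_num) hTr
    have h2 := Real.log_two_gt_d9
    linarith
  have hceil : (T₀ : ℝ) ≤ K * Real.log T + 1 := (Nat.ceil_lt_add_one (by positivity)).le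
  have hX : 0 ≤ 720 * ∑ k ∈ Finset.Icc (M + 1) K,
      armRate T (orderStat (means ν) M - orderStat (means ν) k) :=
    mul_nonneg (by norm_num) (Finset.sum_nonneg fun k hk => armRate_nonneg T (sub_nonneg.2
      (orderStat_antitone hν0 hM (by have := (Finset.mem_Icc.1 hk).1; omega))))
  have hY : 0 ≤ 140 * (K * (M : ℝ) ^ 3 * Real.log
      (phaseRate T (orderStat (means ν) M - orderStat (means ν) (M + 1))) ^ 2) := by positivity
  have hMK1 : (M : ℝ) ≤ K * M := le_mul_of_one_le_left (by positivity) hK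
  have hMKl : K * M * 0.69 ≤ K * M * Real.log T := by gcongr
  -- For short horizons, or if the initialization alone does not fit, the crude bound `M T` is
  -- already of order `K M log T`.
  rcases lt_or_ge T 8 with hT8 | hT8
  · have h1 := regret_le_mul hν hM hMK T T₀
    have h2 : (T : ℝ) ≤ 8 := by exact_mod_cast hT8.le
    have h3 : (M : ℝ) * T ≤ M * 8 := by gcongr
    linarith
  rcases lt_or_ge T (T₀ + 2 * K) with hTK | hTK
  · have h1 := regret_le_mul hν hM hMK T T₀
    have h2 : (T : ℝ) ≤ T₀ + 2 * K := by exact_mod_cast hTK.le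
    have h3 : (M : ℝ) * T ≤ M * (K * Real.log T + 1 + 2 * K) := by
      gcongr
      linarith
    linarith
  have hlog0 : (K : ℝ) * Real.log T ≤ T₀ := Nat.le_ceil _
  have hT₀pos : 0 < T₀ := Nat.ceil_pos.2 (by positivity)
  -- Here `M ≤ K ≤ T`, because the horizon exceeds the initialization.
  obtain ⟨B, hB, hgood⟩ := exists_bad_event (M := M) hν hMK (by omega) (by omega) hlog0
  have h1 := regret_le_of_bound (sicMMAB_isMeasurable (K := K) (T := T) (T₀ := T₀)) hν T
    (by positivity) (by positivity) hB fun ω hω hx =>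
      sum_gap_le_of_good hν hM hMK (hgood ω hω hx) hT8 hT₀pos hTK
  have h2 : (M : ℝ) * T * (5 * K / T) = 5 * (K * M) := by
    field_simp
  have h3 : (M : ℝ) * T₀ ≤ M * (K * Real.log T + 1) := by gcongr
  rw [h2] at h1
  linarith

end Total

end MultiPlayerBandit

theorem theorem1 :
    ∃ c₁ c₂ c₃ : ℝ, 0 < c₁ ∧ 0 < c₂ ∧ 0 < c₃ ∧
      ∀ (K M T : ℕ) [NeZero K], 1 ≤ M → M ≤ K → 2 ≤ T →
      ∀ (ν : Fin K → Measure ℝ) [∀ k, IsProbabilityMeasure (ν k)],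
        (∀ k, ∀ᵐ x ∂(ν k), x ∈ Set.Icc (0 : ℝ) 1) →
        regret (sicMMAB K T ⌈(K : ℝ) * Real.log T⌉₊) M T ν ≤
          c₁ * ∑ k ∈ Finset.Icc (M + 1) K,
              minDiv (Real.log T) (orderStat (means ν) M - orderStat (means ν) k)
                (√((T : ℝ) * Real.log T))
            + c₂ * (K * M * Real.log T)
            + c₃ * (K * (M : ℝ) ^ 3 *
                Real.log (minDiv (Real.log T)
                  ((orderStat (means ν) M - orderStat (means ν) (M + 1)) ^ 2) T) ^ 2) :=
  ⟨720, 20, 140, by norm_num, by norm_num, by norm_num,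
    fun _ _ _ _ hM hMK hT _ _ hν => regret_le hν hM hMK hT⟩
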